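/- **Theorem 5.1.** The series $\Phi^{\Xi}(\hbar)$ is independent of the choice of a nondegenerate quad, up to multiplication by $e^{c\hbar}$ with $c\in\frac1{24}\mathbb Z$. Precisely: *Series.* Let $K$ be a field of characteristic $0$ and let $\Xi=(A,B,\nu,z,f,f'')$ with $A,B\in M_N(\mathbb Z)$, $\nu,f,f''\in\mathbb Z^N$, $z\in (K\setminus\{0,1\})^N$, such that $\det B\neq0$ and $\Lambda:=-B^{-1}A+\mathrm{diag}(1/(1-z_j))$ is symmetric and invertible. With Bernoulli numbers $B_k$ ($B_1=-\frac12$), $\mathrm{Li}_0(z)=\frac z{1-z}$ and $\mathrm{Li}_{-m-1}=z\frac{d}{dz}\mathrm{Li}_{-m}$, put $$\psi_\hbar(x,z)=\exp\Big(-\sum_{k,\ell\ge0,\ k+\ell/2>1}\frac{B_k\,x^\ell\,\hbar^{k+\ell/2-1}}{\ell!\,k!}\,\mathrm{Li}_{2-k-\ell}(z)\Big)\in K[x][[\hbar^{1/2}]],$$ $$f^\Xi_\hbar(x,z)=\exp\Big(\tfrac{\hbar^{1/2}}2x^t\mathbf 1-\tfrac{\hbar^{1/2}}2x^tB^{-1}\nu+\tfrac\hbar8f^tB^{-1}Af\Big)\prod_{i=1}^N\psi_\hbar(x_i,z_i),$$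 where $x=(x_1,\dots,x_N)^t$ and $\mathbf 1=(1,\dots,1)^t$, and $$\Phi^\Xi(\hbar)=\exp\Big(\tfrac12\sum_{i,j}(\Lambda^{-1})_{ij}\partial_{x_i}\partial_{x_j}\Big)f^\Xi_\hbar(x,z)\Big|_{x=0}\in K[[\hbar^{1/2}]].$$ *Quads.* Let $G^{(0)},G^{(1)},G^{(2)}\in M_N(\mathbb Z)$ and $\eta\in\mathbb Z^N$ be such that $(G^{(0)}-G^{(1)})(G^{(2)}-G^{(1)})^t$ is symmetric (for instance the Neumann–Zagier matrices of the gluing equations of an ideal triangulation, attached to the shapes $z,z',z''$, with $\eta=(2,\dots,2,0)^t$). A flattening is a triple $F=(F^{(0)},F^{(1)},F^{(2)})$ of vectors in $\mathbb Z^N$ with $\sum_kF^{(k)}=\mathbf 1$ and $\sum_kG^{(k)}F^{(k)}=\eta$. For $z\in(K\setminus\{0,1\})^N$ let $z_j^{(0)}=z_j$, $z_j^{(1)}=1/(1-z_j)$, $z_j^{(2)}=1-1/z_j$. A choice of quad is a map $q:\{1,\dots,N\}\to\mathbb Z/3$; it eliminates the shape $z_j^{(q_j+1)}$ of the $j$-th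 tetrahedron, and gives $\Xi(q,z,F)=(A,B,\nu,\tilde z,f,f'')$ with $$A_{ij}=G^{(q_j)}_{ij}-G^{(q_j+1)}_{ij},\quad B_{ij}=G^{(q_j+2)}_{ij}-G^{(q_j+1)}_{ij},\quad \nu_i=\eta_i-\sum_jG^{(q_j+1)}_{ij},$$ $$\tilde z_j=z_j^{(q_j)},\quad f_j=F^{(q_j)}_j,\quad f''_j=F^{(q_j+2)}_j.$$ It is nondegenerate if $\det B\neq0$. *Claim.* Let $q_1,q_2$ be nondegenerate choices of quad and $F_1,F_2$ flattenings (possibly equal). There is $c\in\frac1{24}\mathbb Z$ such that for every $z\in(K\setminus\{0,1\})^N$ for which the matrix $\Lambda$ of $\Xi(q_1,z,F_1)$ is invertible, the matrix $\Lambda$ of $\Xi(q_2,z,F_2)$ is invertible as well, and $$\Phi^{\Xi(q_1,z,F_1)}(\hbar)=e^{c\hbar}\,\Phi^{\Xi(q_2,z,F_2)}(\hbar).$$ -/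

import Mathlib

open Matrix

/-!
All power series below are in the variable `h = ħ^{1/2}` (written `PowerSeries.X`),
so `ħ` is `PowerSeries.X ^ 2`.
-/

noncomputable section

namespace NZ

/-- The formal exponential `exp F = ∑ Fⁿ / n!` of a power series `F` with zero constant term. -/
def fexp {R : Type*} [CommRing R] [Algebra ℚ R] (F : PowerSeries R) : PowerSeries R :=
  (PowerSeries.exp R).subst F

/-- `Li_{-m}(z)` written as a polynomial in `u = z / (1 - z)`.  Since `Li_0(z) = u`,
`Li_{-(m+1)} = z d/dz Li_{-m}` and `z du/dz = u + u ^ 2`, the polynomials satisfy the recursion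
below. -/
def liPoly : ℕ → Polynomial ℚ
  | 0 => Polynomial.X
  | m + 1 => (Polynomial.X + Polynomial.X ^ 2) * Polynomial.derivative (liPoly m)

/-- The polylogarithm `Li_{-m}(z)` of nonpositive integer order, a rational function of `z`
with its only pole at `z = 1`. -/
def li {K : Type*} [Field K] [CharZero K] (m : ℕ) (z : K) : K :=
  Polynomial.aeval (z / (1 - z)) (liPoly m)

/-- The exponent of `ψ_ħ(x, z)`,
`- ∑_{k + ℓ/2 > 1} B_k x^ℓ ħ^{k + ℓ/2 - 1} / (ℓ! k!) Li_{2-k-ℓ}(z)`.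
The coefficient of `h ^ n` collects the finitely many pairs `(k, ℓ)` with `2k + ℓ - 2 = n`, and
`k + ℓ/2 > 1` says `n ≥ 1`; for such pairs `k + ℓ ≥ 2`, so the subtraction in `ℕ` is exact.
`bernoulli` is the convention `B_1 = -1/2`.  The variable `x` lives in any `K`-algebra `R`. -/
def psiExponent {K R : Type*} [Field K] [CharZero K] [CommRing R] [Algebra K R]
    (x : R) (z : K) : PowerSeries R :=
  PowerSeries.mk fun n =>
    if n = 0 then 0 else
      - ∑ p ∈ (Finset.range (n + 3) ×ˢ Finset.range (n + 3)).filter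
            (fun p : ℕ × ℕ => 2 * p.1 + p.2 = n + 2),
          algebraMap K R
            ((bernoulli p.1 : K) / ((p.2.factorial : K) * (p.1.factorial : K))
              * li (p.1 + p.2 - 2) z) * x ^ p.2

/-- The series `ψ_ħ(x, z)`. -/
def psi {K R : Type*} [Field K] [CharZero K] [CommRing R] [Algebra K R] [Algebra ℚ R]
    (x : R) (z : K) : PowerSeries R :=
  fexp (psiExponent x z)

section Gaussian

variable {ι K : Type*} [Fintype ι] [DecidableEq ι] [Field K] [CharZero K]

/-- The operator `½ ∑_{i,j} (Λ⁻¹)_{ij} ∂/∂x_i ∂/∂x_j` on polynomials in the `x_i`. -/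
def gaussOp (L : Matrix ι ι K) : MvPolynomial ι K →ₗ[K] MvPolynomial ι K :=
  (1 / 2 : K) • ∑ i, ∑ j, L⁻¹ i j •
    ((MvPolynomial.pderiv i : Derivation K (MvPolynomial ι K) (MvPolynomial ι K)).toLinearMap ∘ₗ
      (MvPolynomial.pderiv j : Derivation K (MvPolynomial ι K) (MvPolynomial ι K)).toLinearMap)

/-- `exp(½ ∑ (Λ⁻¹)_{ij} ∂_i ∂_j) p` at `x = 0`.  The operator lowers the degree by two, so the
exponential series terminates within the given range. -/
def gaussPoly (L : Matrix ι ι K) (p : MvPolynomial ι K) : K :=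
  ∑ m ∈ Finset.range (p.totalDegree + 1),
    (1 / (m.factorial : K)) * MvPolynomial.constantCoeff ((gaussOp L ^ m) p)

/-- Formal Gaussian integration `⟨F⟩_{x,Λ}` of `F ∈ K[x]⟦ħ^{1/2}⟧`, coefficientwise in
`ħ^{1/2}`. -/
def gauss (L : Matrix ι ι K) (F : PowerSeries (MvPolynomial ι K)) : PowerSeries K :=
  PowerSeries.mk fun n => gaussPoly L (PowerSeries.coeff n F)

end Gaussian

/-- A Neumann–Zagier tuple `Ξ = (A, B, ν, z, f, f″)`. -/
structure Datum (ι K : Type*) where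
  /-- The matrix `A`. -/
  A : Matrix ι ι ℤ
  /-- The matrix `B`. -/
  B : Matrix ι ι ℤ
  /-- The vector `ν`. -/
  nu : ι → ℤ
  /-- The shapes `z`. -/
  z : ι → K
  /-- The part `f` of the flattening. -/
  f : ι → ℤ
  /-- The part `f″` of the flattening. -/
  fpp : ι → ℤ

namespace Datum

variable {ι K : Type*} [Fintype ι] [DecidableEq ι] [Field K] [CharZero K]

/-- `A` as a matrix over `K`. -/
def AK (X : Datum ι K) : Matrix ι ι K := X.A.map (fun a : ℤ => (a : K))

/-- `B` as a matrix over `K`. -/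
def BK (X : Datum ι K) : Matrix ι ι K := X.B.map (fun a : ℤ => (a : K))

/-- `ν` as a vector over `K`. -/
def nuK (X : Datum ι K) : ι → K := fun i => (X.nu i : K)

/-- `f` as a vector over `K`. -/
def fK (X : Datum ι K) : ι → K := fun i => (X.f i : K)

/-- `Λ = - B⁻¹ A + diag (1 / (1 - z_j))`. -/
def Lam (X : Datum ι K) : Matrix ι ι K :=
  - (X.BK⁻¹ * X.AK) + Matrix.diagonal (fun j => 1 / (1 - X.z j))

/-- The integrand
`exp(ħ^{1/2}/2 xᵗ1 - ħ^{1/2}/2 xᵗ B⁻¹ ν + ħ/8 fᵗ B⁻¹ A f) ∏ ψ_ħ(x_i, z_i)`. -/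
def integrand (X : Datum ι K) : PowerSeries (MvPolynomial ι K) :=
  fexp
    (PowerSeries.X * PowerSeries.C
        (∑ i, MvPolynomial.C ((1 / 2 : K)) * MvPolynomial.X i
          - ∑ i, MvPolynomial.C ((1 / 2 : K) * (X.BK⁻¹ *ᵥ X.nuK) i) * MvPolynomial.X i)
      + PowerSeries.X ^ 2 * PowerSeries.C
        (MvPolynomial.C ((1 / 8 : K) * (X.fK ⬝ᵥ ((X.BK⁻¹ * X.AK) *ᵥ X.fK)))))
    * ∏ i, psi (MvPolynomial.X i : MvPolynomial ι K) (X.z i)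

/-- The series `Φ^Ξ(ħ) = ⟨f^Ξ_ħ(x, z)⟩_{x,Λ}`, as a power series in `ħ^{1/2}`. -/
def Phi (X : Datum ι K) : PowerSeries K := gauss X.Lam X.integrand

end Datum

/-- The exponents of a square system of gluing equations in the shapes `z, z′, z″` of the
tetrahedra: `G 0`, `G 1`, `G 2` are the matrices attached to `z`, `z′`, `z″` (rows: equations,
columns: tetrahedra), and `π i · rhs` is the right-hand side in logarithmic form. -/
structure Gluing (ι : Type*) where
  /-- The three exponent matrices. -/
  G : Fin 3 → Matrix ι ι ℤ
  /-- The right-hand side, `(2, …, 2, 0)` for a one-cusped triangulation. -/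
  rhs : ι → ℤ

/-- The three shapes `z`, `z′ = 1 / (1 - z)`, `z″ = 1 - 1 / z` of a tetrahedron. -/
def shape {K : Type*} [Field K] (z : K) : Fin 3 → K
  | 0 => z
  | 1 => 1 / (1 - z)
  | 2 => 1 - 1 / z

namespace Gluing

variable {ι : Type*} [Fintype ι]

/-- A choice of quad is a map `q : ι → Fin 3`: in the tetrahedron `j` the shape number `q j`
plays the role of `z`, the cyclically next one `q j + 1` (the role of `z′`) is eliminated, and
`q j + 2` plays the role of `z″`.  This is the matrix `A` of that choice. -/
def A (D : Gluing ι) (q : ι → Fin 3) : Matrix ι ι ℤ :=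
  Matrix.of fun i j => D.G (q j) i j - D.G (q j + 1) i j

/-- The matrix `B` of a choice of quad. -/
def B (D : Gluing ι) (q : ι → Fin 3) : Matrix ι ι ℤ :=
  Matrix.of fun i j => D.G (q j + 2) i j - D.G (q j + 1) i j

/-- The vector `ν` of a choice of quad. -/
def nu (D : Gluing ι) (q : ι → Fin 3) : ι → ℤ :=
  fun i => D.rhs i - ∑ j, D.G (q j + 1) i j

/-- The Neumann–Zagier symmetry: `A Bᵗ` is symmetric, where `A = G - G′`, `B = G″ - G′`.
(Equivalently for the `A`, `B` of any other choice of quad.) -/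
def IsSymplectic (D : Gluing ι) : Prop :=
  ((D.G 0 - D.G 1) * (D.G 2 - D.G 1)ᵀ).IsSymm

/-- Flattenings `(f, f′, f″) = (F 0, F 1, F 2)`: integer vectors with
`f + f′ + f″ = (1, …, 1)` and `G f + G′ f′ + G″ f″ = rhs`. -/
def IsFlattening (D : Gluing ι) (F : Fin 3 → ι → ℤ) : Prop :=
  (∀ j, F 0 j + F 1 j + F 2 j = 1) ∧
    D.G 0 *ᵥ F 0 + D.G 1 *ᵥ F 1 + D.G 2 *ᵥ F 2 = D.rhs

/-- The Neumann–Zagier tuple attached to a choice of quad `q`, shapes `z` and a flattening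
`F`. -/
def datum {K : Type*} [Field K] (D : Gluing ι) (q : ι → Fin 3) (z : ι → K)
    (F : Fin 3 → ι → ℤ) : Datum ι K where
  A := D.A q
  B := D.B q
  nu := D.nu q
  z := fun j => shape (z j) (q j)
  f := fun j => F (q j) j
  fpp := fun j => F (q j + 2) j

end Gluing

end NZ

end

/-! Write `h` for the square root of `ħ`. The series changes in a simple way when the quad of a
single tetrahedron is rotated, `z_j ↦ z_j' = 1 / (1 - z_j)`, and any two nondegenerate quads are
joined by such moves through nondegenerate ones.

The analytic heart is `fourierDilog_eq`, the Fourier transform of the formal quantum dilogarithm: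
with `u = z / (1 - z)`, averaging `exp(h t / 2) ψ(t, z')` over `t = y + u x`, with `y` Gaussian of
variance `-u`, gives `e^{ħ/24} ψ(x, z)`. Both sides obey the same first order difference equation in
`x` (`shift_dilog`, `shift_fourierDilog`) and the same differential equation linking `x` and `z`
(`X_mul_dpar_dilog`, `X_mul_dpar_fourierDilog`). Their ratio is therefore independent of `x` and of
`z`. The ratio is computed over Laurent polynomials in `u`, at `u = -1` (that is, `z = ∞`, `z' =
0`), where both sides are exponentials of polynomials.

Inserting this identity for `ψ(x_j, z_j)` into the multivariate Gaussian integral and integrating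
out the old variable `x_j` is a formal Fubini argument. It rests on the fact that integration by
parts determines the Gaussian functional up to a factor (`GaussLike.eq_mul`). The form `Λ` undergoes
a pivot in the `j`-th row and column (`gaussDilog_pivot`), and `B⁻¹ A` undergoes the matching pivot
when the quad is rotated (`pivotForm_eq`, `quot_update`). A flattening gives `B⁻¹ ν = B⁻¹ A f +
f''`, so the linear terms correspond as well. The squares produced by the Gaussian cancel against
the change of `fᵗ B⁻¹ A f`, up to an integer over `8`; together with the `1/24` this is
`equiv_succ`.

Connectivity (`connected`) is an exchange argument that uses the symmetry of `B⁻¹ A`. When no single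
change towards the target quad is available, two tetrahedra are changed with a detour through the
third quad of one of them.

For a fixed quad, `Λ` and the linear form do not involve the flattening, and the difference of the
two values of `fᵗ B⁻¹ A f` is an integer (`Phi_flattening`). -/

noncomputable section

namespace NZ

open PowerSeries

/-! ### Additive and multiplicative maps between power series rings that fix the variable -/

section Toolkit

variable {R S : Type*} [CommRing R] [CommRing S]

/-- A map of power series that is additive, commutes with `X`, and kills the constants vanishes. -/
theorem hlin_eq_zero (T : PowerSeries R →+ PowerSeries S)
    (hX : ∀ F, T (X * F) = X * T F) (hC : ∀ r, T (C r) = 0) (F : PowerSeries R) : T F = 0 := by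
  ext n
  induction n using Nat.strong_induction_on generalizing F with
  | _ n ih =>
    -- Splitting off the constant term lowers the coefficient index by one, so no continuity of `T`
    -- has to be assumed.
    rw [F.eq_X_mul_shift_add_const, map_add, hX, hC, add_zero]
    cases n with
    | zero => simp
    | succ n => rw [coeff_succ_X_mul]; exact ih n (Nat.lt_succ_self n) _

theorem hlin_ext (T₁ T₂ : PowerSeries R →+ PowerSeries S)
    (h₁ : ∀ F, T₁ (X * F) = X * T₁ F) (h₂ : ∀ F, T₂ (X * F) = X * T₂ F)
    (hC : ∀ r, T₁ (C r) = T₂ (C r)) (F : PowerSeries R) : T₁ F = T₂ F := by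
  have := hlin_eq_zero (T₁ - T₂) (fun F => by simp [h₁, h₂, mul_sub]) (fun r => by simp [hC]) F
  simpa [sub_eq_zero] using this

/-- Coefficientwise application of an additive map. -/
def cmap (T : R →+ S) : PowerSeries R →+ PowerSeries S where
  toFun F := PowerSeries.mk fun n => T (coeff n F)
  map_zero' := by ext; simp
  map_add' F G := by ext; simp

@[simp] theorem coeff_cmap (T : R →+ S) (F : PowerSeries R) (n : ℕ) :
    coeff n (cmap T F) = T (coeff n F) := by simp [cmap]

@[simp] theorem cmap_C (T : R →+ S) (r : R) : cmap T (C r) = C (T r) := by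
  ext n; simp only [coeff_cmap, coeff_C]; split_ifs <;> simp

@[simp] theorem cmap_X_mul (T : R →+ S) (F : PowerSeries R) : cmap T (X * F) = X * cmap T F := by
  ext n; cases n <;> simp [coeff_succ_X_mul]

theorem cmap_leibniz (T : R →+ R) (hT : ∀ a b, T (a * b) = a * T b + b * T a)
    (F G : PowerSeries R) : cmap T (F * G) = F * cmap T G + G * cmap T F := by
  ext n
  rw [mul_comm G]
  simp only [coeff_cmap, coeff_mul, map_add, map_sum, hT, Finset.sum_add_distrib]
  simp only [mul_comm (coeff _ G)]

/-- A coefficientwise map which is linear over the image of a ring map is linear over the series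
with coefficients there. -/
theorem cmap_mul_of_semilinear {A : Type*} [CommRing A] (f : A →+* R) (g : A →+* S) (T : R →+ S)
    (hT : ∀ a r, T (f a * r) = g a * T r) (s : PowerSeries A) (F : PowerSeries R) :
    cmap T (PowerSeries.map f s * F) = PowerSeries.map g s * cmap T F := by
  ext n; simp [coeff_mul, hT]

/-- The extension of a map `R → S⟦X⟧` to `R⟦X⟧` with `X ↦ X`. -/
def hextAdd (τ : R →+ PowerSeries S) : PowerSeries R →+ PowerSeries S where
  toFun F := PowerSeries.mk fun n => ∑ p ∈ Finset.HasAntidiagonal.antidiagonal n, coeff p.2 (τ (coeff p.1 F))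
  map_zero' := by ext; simp
  map_add' F G := by ext; simp [Finset.sum_add_distrib]

theorem hextAdd_C (τ : R →+ PowerSeries S) (r : R) : hextAdd τ (C r) = τ r := by
  ext n
  simp only [hextAdd, AddMonoidHom.coe_mk, ZeroHom.coe_mk, coeff_mk]
  rw [Finset.sum_eq_single (0, n)]
  · simp
  · rintro ⟨i, j⟩ h hne
    have : i ≠ 0 := by
      rintro rfl; simp at h; simp [h] at hne
    simp [coeff_C, this]
  · simp

theorem hextAdd_X_mul (τ : R →+ PowerSeries S) (F : PowerSeries R) :
    hextAdd τ (X * F) = X * hextAdd τ F := by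
  ext n
  cases n with
  | zero => simp [hextAdd]
  | succ n =>
    rw [coeff_succ_X_mul]
    simp [hextAdd, Finset.Nat.antidiagonal_succ, coeff_succ_X_mul]

/-- The extension of a ring homomorphism `R → S⟦X⟧` to `R⟦X⟧` with `X ↦ X`. -/
def hext (τ : R →+* PowerSeries S) : PowerSeries R →+* PowerSeries S where
  __ := hextAdd τ.toAddMonoidHom
  map_one' := by
    have := hextAdd_C τ.toAddMonoidHom 1
    simpa using this
  map_mul' F G := by
    have key : ∀ r : R, ∀ G, hextAdd τ.toAddMonoidHom (C r * G) =
        τ r * hextAdd τ.toAddMonoidHom G := fun r G =>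
      hlin_ext ((hextAdd τ.toAddMonoidHom).comp (AddMonoidHom.mulLeft (C r)))
        ((AddMonoidHom.mulLeft (τ r)).comp (hextAdd τ.toAddMonoidHom))
        (fun F => by simp [mul_left_comm _ X, hextAdd_X_mul])
        (fun F => by simp [mul_left_comm _ X, hextAdd_X_mul])
        (fun s => by
          have h := hextAdd_C τ.toAddMonoidHom (r * s)
          have h' := hextAdd_C τ.toAddMonoidHom s
          simp only [map_mul, RingHom.toAddMonoidHom_eq_coe, AddMonoidHom.coe_coe] at h h'
          simp [h, h']) G
    exact hlin_ext ((hextAdd τ.toAddMonoidHom).comp (AddMonoidHom.mulRight G))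
        ((AddMonoidHom.mulRight (hextAdd τ.toAddMonoidHom G)).comp (hextAdd τ.toAddMonoidHom))
        (fun F => by simp [mul_assoc, hextAdd_X_mul])
        (fun F => by simp [mul_assoc, hextAdd_X_mul])
        (fun s => by
          have h' := hextAdd_C τ.toAddMonoidHom s
          simp only [RingHom.toAddMonoidHom_eq_coe, AddMonoidHom.coe_coe] at h'
          have := key s G
          simp only [RingHom.toAddMonoidHom_eq_coe] at this
          simp [h', this]) F

theorem hext_C (τ : R →+* PowerSeries S) (r : R) : hext τ (C r) = τ r :=
  hextAdd_C τ.toAddMonoidHom r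

theorem hext_X_mul (τ : R →+* PowerSeries S) (F : PowerSeries R) :
    hext τ (X * F) = X * hext τ F := hextAdd_X_mul τ.toAddMonoidHom F

theorem coeff_hext (τ : R →+* PowerSeries S) (F : PowerSeries R) (n : ℕ) :
    coeff n (hext τ F) =
      ∑ p ∈ Finset.HasAntidiagonal.antidiagonal n, coeff p.2 (τ (coeff p.1 F)) :=
  coeff_mk n fun n => ∑ p ∈ Finset.HasAntidiagonal.antidiagonal n, coeff p.2 (τ (coeff p.1 F))

@[simp] theorem hext_X (τ : R →+* PowerSeries S) : hext τ X = X := by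
  simpa using hext_X_mul τ 1

/-- Two ring homomorphisms of power series rings over a polynomial ring fixing `X` agree if they
agree on the coefficients. -/
theorem ringHom_ext_of_X (φ₁ φ₂ : PowerSeries R →+* PowerSeries S) (h₁ : φ₁ X = X)
    (h₂ : φ₂ X = X) (hC : φ₁.comp C = φ₂.comp C) (F : PowerSeries R) : φ₁ F = φ₂ F :=
  hlin_ext φ₁.toAddMonoidHom φ₂.toAddMonoidHom (by simp [h₁]) (by simp [h₂])
    (fun r => RingHom.congr_fun hC r) F

theorem derivative_cmap (T : R →+ S) (G : PowerSeries R) :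
    d⁄dX S (cmap T G) = cmap T (d⁄dX R G) := by
  ext n
  rw [coeff_cmap, coeff_derivative, coeff_derivative, coeff_cmap]
  have h1 : (coeff (n + 1) G) * ((n : R) + 1) = (n + 1) • coeff (n + 1) G := by
    rw [nsmul_eq_mul, mul_comm]; push_cast; rfl
  have h2 : T (coeff (n + 1) G) * ((n : S) + 1) = (n + 1) • T (coeff (n + 1) G) := by
    rw [nsmul_eq_mul, mul_comm]; push_cast; rfl
  rw [h1, h2, map_nsmul]

end Toolkit

/-! ### The formal exponential and uniqueness for linear differential equations in `h` -/

section Fexp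

/-- The element `1/2` of a `ℚ`-algebra. -/
def half (A : Type*) [CommRing A] [Algebra ℚ A] : A := algebraMap ℚ A (1 / 2)

theorem half_mul_two (A : Type*) [CommRing A] [Algebra ℚ A] : half A * 2 = 1 := by
  rw [half, ← map_ofNat (algebraMap ℚ A) 2, ← map_mul]; norm_num

theorem map_half {A B : Type*} [CommRing A] [Algebra ℚ A] [CommRing B] [Algebra ℚ B]
    (f : A →+* B) : f (half A) = half B :=
  RingHom.congr_fun (RingHom.ext_rat (f.comp (algebraMap ℚ A)) (algebraMap ℚ B)) _

@[simp] theorem derivation_half {A : Type*} [CommRing A] [Algebra ℚ A] (d : Derivation ℚ A A) :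
    d (half A) = 0 := Derivation.map_algebraMap _ _

variable {R S : Type*} [CommRing R] [Algebra ℚ R] [CommRing S] [Algebra ℚ S]

omit [Algebra ℚ R] in
theorem hasSubst_of {F : PowerSeries R} (hF : constantCoeff F = 0) : HasSubst F :=
  HasSubst.of_constantCoeff_zero' hF

/-- Modulo `X ^ (n + 1)` the exponential is a polynomial in `F`. This lets any ring homomorphism
fixing `X` commute with `fexp`, without continuity. -/
theorem fexp_expand (n : ℕ) {F : PowerSeries R} (hF : constantCoeff F = 0) :
    ∃ G, fexp F = X ^ (n + 1) * G +
      ∑ k ∈ Finset.range (n + 1), algebraMap ℚ (PowerSeries R) (1 / k.factorial) * F ^ k := by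
  obtain ⟨F₁, hF₁⟩ := X_dvd_iff.2 hF
  have hs := hasSubst_of hF
  have := eq_X_pow_mul_shift_add_trunc (n + 1) (PowerSeries.exp R)
  rw [fexp, this, subst_add hs, subst_mul hs, subst_pow hs, subst_X hs]
  refine ⟨F₁ ^ (n + 1) * subst F (PowerSeries.mk fun i ↦ coeff (i + (n + 1)) (PowerSeries.exp R)), ?_⟩
  congr 1
  · rw [← mul_assoc, ← mul_pow, ← hF₁]
  · rw [subst_coe hs, Polynomial.aeval_eq_sum_range' (natDegree_trunc_lt _ _)]
    refine Finset.sum_congr rfl fun k hk => ?_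
    rw [coeff_trunc, if_pos (Finset.mem_range.1 hk), coeff_exp, Algebra.smul_def]
    congr 1
    exact RingHom.congr_fun (RingHom.ext_rat
      ((algebraMap R (MvPowerSeries Unit R)).comp (algebraMap ℚ R)) (algebraMap ℚ R⟦X⟧)) _

theorem constantCoeff_fexp {F : PowerSeries R} (hF : constantCoeff F = 0) :
    constantCoeff (fexp F) = 1 := by
  obtain ⟨G, hG⟩ := fexp_expand 0 hF
  simp [hG]

theorem derivative_fexp {F : PowerSeries R} (hF : constantCoeff F = 0) :
    d⁄dX R (fexp F) = fexp F * d⁄dX R F := by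
  rw [fexp, derivative_subst (hasSubst_of hF), derivative_exp]

theorem smul_eq_zero_of_nat {n : ℕ} {r : R} (h : r * (n + 1) = 0) : r = 0 := by
  have h1 : algebraMap ℚ R ((n + 1 : ℚ)) * algebraMap ℚ R (1 / (n + 1 : ℚ)) = 1 := by
    rw [← map_mul, mul_one_div_cancel (by positivity), map_one]
  have h2 : algebraMap ℚ R ((n + 1 : ℚ)) = n + 1 := by simp
  rw [h2] at h1
  calc r = r * (n + 1) * algebraMap ℚ R (1 / (n + 1 : ℚ)) := by rw [mul_assoc, h1, mul_one]
    _ = 0 := by rw [h, zero_mul]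

/-- The equation determines `(n + 1)` times coefficient `n + 1` from the lower ones, and `n + 1` is
invertible in a `ℚ`-algebra. Identities between exponentials are proved below by comparing
logarithmic derivatives in `h`. -/
theorem eq_zero_of_ode {W A : PowerSeries R} (h0 : constantCoeff W = 0)
    (h : d⁄dX R W = W * A) : W = 0 := by
  ext n
  induction n using Nat.strong_induction_on with
  | _ n ih =>
    cases n with
    | zero => simpa using h0
    | succ n =>
      have := congrArg (coeff n) h
      rw [coeff_derivative, coeff_mul, Finset.sum_eq_zero] at this
      · simpa using smul_eq_zero_of_nat this
      · rintro ⟨i, j⟩ hij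
        have : i < n + 1 := by
          have := Finset.HasAntidiagonal.mem_antidiagonal.1 hij; dsimp at this; omega
        simp [ih i this]

theorem eq_of_ode {V W A : PowerSeries R} (h0 : constantCoeff V = constantCoeff W)
    (hV : d⁄dX R V = V * A) (hW : d⁄dX R W = W * A) : V = W := by
  rw [← sub_eq_zero]
  exact eq_zero_of_ode (A := A) (by simp [h0]) (by rw [map_sub, hV, hW, sub_mul])

theorem fexp_add {F G : PowerSeries R} (hF : constantCoeff F = 0) (hG : constantCoeff G = 0) :
    fexp (F + G) = fexp F * fexp G := by
  have hFG : constantCoeff (F + G) = 0 := by simp [hF, hG]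
  refine eq_of_ode (A := d⁄dX R (F + G)) ?_ (derivative_fexp hFG) ?_
  · simp [constantCoeff_fexp, hF, hG]
  · rw [Derivation.leibniz, derivative_fexp hF, derivative_fexp hG, map_add]
    simp only [smul_eq_mul]; ring

@[simp] theorem fexp_zero : fexp (0 : PowerSeries R) = 1 :=
  eq_of_ode (A := 0) (by rw [constantCoeff_fexp (map_zero _), map_one])
    (by rw [derivative_fexp (map_zero _)]; simp) (by simp)

theorem fexp_neg_mul {F : PowerSeries R} (hF : constantCoeff F = 0) :
    fexp (-F) * fexp F = 1 := by
  rw [← fexp_add (by simp [hF]) hF, neg_add_cancel, fexp_zero]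

theorem fexp_sum {ι : Type*} (s : Finset ι) (F : ι → PowerSeries R)
    (hF : ∀ i, constantCoeff (F i) = 0) : fexp (∑ i ∈ s, F i) = ∏ i ∈ s, fexp (F i) := by
  classical
  induction s using Finset.induction_on with
  | empty => simp
  | insert a s ha ih =>
    rw [Finset.sum_insert ha, Finset.prod_insert ha, fexp_add (hF a) (by simp [hF]), ih]

theorem cmap_fexp (T : R →+ R) (hT : ∀ a b, T (a * b) = a * T b + b * T a)
    {F : PowerSeries R} (hF : constantCoeff F = 0) :
    cmap T (fexp F) = fexp F * cmap T F := by
  have T1 : T 1 = 0 := by simpa using hT 1 1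
  rw [← sub_eq_zero]
  refine eq_zero_of_ode (A := d⁄dX R F) ?_ ?_
  · rw [map_sub, map_mul, ← coeff_zero_eq_constantCoeff_apply, ← coeff_zero_eq_constantCoeff_apply,
      coeff_cmap, ← coeff_zero_eq_constantCoeff_apply (cmap T F), coeff_cmap]
    simp [constantCoeff_fexp hF, hF, T1]
  · rw [map_sub, derivative_cmap, derivative_fexp hF, cmap_leibniz T hT, Derivation.leibniz, derivative_cmap,
      derivative_fexp hF]
    simp only [smul_eq_mul]; ring

theorem map_fexp_of_X (φ : PowerSeries R →+* PowerSeries S) (hφ : φ X = X)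
    {F : PowerSeries R} (hF : constantCoeff F = 0) : φ (fexp F) = fexp (φ F) := by
  have hφF : ∀ G : PowerSeries R, constantCoeff G = 0 → constantCoeff (φ G) = 0 := by
    intro G hG
    obtain ⟨G', rfl⟩ := X_dvd_iff.2 hG
    simp [hφ]
  ext n
  obtain ⟨G, hG⟩ := fexp_expand n hF
  obtain ⟨G', hG'⟩ := fexp_expand n (hφF F hF)
  have key : ∀ H : PowerSeries S, coeff n (X ^ (n + 1) * H) = 0 := fun H => by
    rw [coeff_X_pow_mul']; simp
  have hq : ∀ q : ℚ, φ (algebraMap ℚ _ q) = algebraMap ℚ _ q := fun q =>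
    RingHom.congr_fun (RingHom.ext_rat (φ.comp (algebraMap ℚ _)) (algebraMap ℚ _)) q
  rw [hG, hG', map_add, map_mul, map_pow, hφ, map_add, map_add, key, key, map_sum]
  simp only [map_mul, map_pow, hq]

theorem map_fexp (f : R →+* S) {F : PowerSeries R} (hF : constantCoeff F = 0) :
    PowerSeries.map f (fexp F) = fexp (PowerSeries.map f F) :=
  map_fexp_of_X (PowerSeries.map f) (map_X f) hF

end Fexp

/-! ### Calculus on `A[x]⟦h⟧`: derivations, shifts and Gaussian exponentials -/

section OneVariable

variable {A : Type*} [CommRing A]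

/-- A constant of `A`, as a power series over `A[x]`. -/
def cst : A →+* PowerSeries (Polynomial A) := (PowerSeries.C).comp Polynomial.C

/-- The variable `x`, as a power series over `A[x]`. -/
def xs : PowerSeries (Polynomial A) := PowerSeries.C Polynomial.X

/-- `∂/∂x` on `A[x]⟦h⟧`. -/
def dx : PowerSeries (Polynomial A) →+ PowerSeries (Polynomial A) :=
  cmap (Polynomial.derivative (R := A)).toAddMonoidHom

theorem poly_ind {P : Polynomial A → Prop} (hC : ∀ a, P (Polynomial.C a))
    (hadd : ∀ p q, P p → P q → P (p + q)) (hX : ∀ p, P p → P (Polynomial.X * p))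
    (p : Polynomial A) : P p := by
  induction p using Polynomial.induction_on with
  | C a => exact hC a
  | add p q hp hq => exact hadd p q hp hq
  | monomial n a h =>
    have := hX _ h
    rwa [show Polynomial.X * (Polynomial.C a * Polynomial.X ^ n) =
      Polynomial.C a * Polynomial.X ^ (n + 1) by ring] at this

@[simp] theorem coeff_cst_mul (a : A) (F : PowerSeries (Polynomial A)) (n : ℕ) :
    coeff n (cst a * F) = Polynomial.C a * coeff n F := by simp [cst]

@[simp] theorem coeff_xs_mul (F : PowerSeries (Polynomial A)) (n : ℕ) :
    coeff n (xs * F) = Polynomial.X * coeff n F := by simp [xs]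

@[simp] theorem coeff_dx (F : PowerSeries (Polynomial A)) (n : ℕ) :
    coeff n (dx F) = Polynomial.derivative (coeff n F) := by simp [dx]

theorem dx_mul (F G : PowerSeries (Polynomial A)) : dx (F * G) = F * dx G + G * dx F :=
  cmap_leibniz _ (fun a b => by simp; ring) F G

@[simp] theorem dx_cst (a : A) : dx (cst a) = 0 := by simp [dx, cst]

@[simp] theorem dx_xs : dx (xs : PowerSeries (Polynomial A)) = 1 := by simp [dx, xs]

@[simp] theorem dx_one : dx (1 : PowerSeries (Polynomial A)) = 0 := by
  simpa using dx_cst (1 : A)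

@[simp] theorem dx_X : dx (X : PowerSeries (Polynomial A)) = 0 := by
  have := cmap_X_mul (Polynomial.derivative (R := A)).toAddMonoidHom 1
  rw [mul_one] at this
  rw [dx, this]
  exact (congrArg (X * ·) dx_one).trans (mul_zero _)

/-- The coefficientwise extension of a derivation of `A` to `A[x]`. -/
def polyDer [Algebra ℚ A] (d : Derivation ℚ A A) : Polynomial A →+ Polynomial A :=
  let : Differential A := ⟨d.restrictScalars ℤ⟩
  (Differential.mapCoeffs (A := A) : Derivation ℤ (Polynomial A) (Polynomial A)).toLinearMap.toAddMonoidHom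

section Derivations

variable [Algebra ℚ A] (d : Derivation ℚ A A)

@[simp] theorem coeff_polyDer (p : Polynomial A) (n : ℕ) :
    (polyDer d p).coeff n = d (p.coeff n) := rfl

theorem polyDer_mul (p q : Polynomial A) :
    polyDer d (p * q) = p * polyDer d q + q * polyDer d p := by
  let : Differential A := ⟨d.restrictScalars ℤ⟩
  exact (Differential.mapCoeffs (A := A)).leibniz p q

@[simp] theorem polyDer_C (a : A) : polyDer d (Polynomial.C a) = Polynomial.C (d a) := by
  ext n; simp only [coeff_polyDer, Polynomial.coeff_C]; split_ifs <;> simp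

@[simp] theorem polyDer_X : polyDer d Polynomial.X = 0 := by
  ext n; simp only [coeff_polyDer, Polynomial.coeff_X]; split_ifs <;> simp

/-- The coefficientwise extension of a derivation of `A` to `A[x]⟦h⟧`. -/
def dpar : PowerSeries (Polynomial A) →+ PowerSeries (Polynomial A) := cmap (polyDer d)

@[simp] theorem coeff_dpar (F : PowerSeries (Polynomial A)) (n : ℕ) :
    coeff n (dpar d F) = polyDer d (coeff n F) := by simp [dpar]

theorem dpar_mul (F G : PowerSeries (Polynomial A)) :
    dpar d (F * G) = F * dpar d G + G * dpar d F :=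
  cmap_leibniz _ (polyDer_mul d) F G

@[simp] theorem dpar_cst (a : A) : dpar d (cst a) = cst (d a) := by simp [dpar, cst]

@[simp] theorem dpar_xs : dpar d xs = 0 := by simp [dpar, xs]

@[simp] theorem dpar_one : dpar d 1 = 0 := by simpa using dpar_cst d (1 : A)

@[simp] theorem dpar_X : dpar d X = 0 := by
  have := cmap_X_mul (polyDer d) 1
  rw [mul_one] at this
  rw [dpar, this]
  exact (congrArg (X * ·) (dpar_one d)).trans (mul_zero _)

end Derivations

/-- The shift `x ↦ x + μ h` of `A[x]⟦h⟧`. -/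
def shift (μ : A) : PowerSeries (Polynomial A) →+* PowerSeries (Polynomial A) :=
  hext (Polynomial.eval₂RingHom cst (xs + cst μ * X))

@[simp] theorem shift_X (μ : A) : shift μ X = X := hext_X _

@[simp] theorem shift_xs (μ : A) : shift μ xs = xs + cst μ * X := by
  simp [shift, xs, hext_C]

@[simp] theorem shift_cst (μ a : A) : shift μ (cst a) = cst a := by
  rw [shift, show cst a = C (Polynomial.C a) from rfl, hext_C]; simp [cst]

theorem ringHom_ext_of_gens {S : Type*} [CommRing S]
    (φ₁ φ₂ : PowerSeries (Polynomial A) →+* PowerSeries S) (h₁ : φ₁ X = X)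
    (h₂ : φ₂ X = X) (hc : ∀ a, φ₁ (cst a) = φ₂ (cst a)) (hx : φ₁ xs = φ₂ xs)
    (F : PowerSeries (Polynomial A)) : φ₁ F = φ₂ F :=
  ringHom_ext_of_X φ₁ φ₂ h₁ h₂ (Polynomial.ringHom_ext (fun a => hc a) hx) F

theorem shift_shift (μ ν : A) (F : PowerSeries (Polynomial A)) :
    shift μ (shift ν F) = shift (μ + ν) F :=
  ringHom_ext_of_gens ((shift μ).comp (shift ν)) (shift (μ + ν)) (by simp) (by simp) (by simp)
    (by simp; ring) F

@[simp] theorem shift_zero (F : PowerSeries (Polynomial A)) : shift 0 F = F :=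
  ringHom_ext_of_gens (shift 0) (RingHom.id _) (by simp) (by simp) (by simp) (by simp) F

theorem dx_X_mul (F : PowerSeries (Polynomial A)) : dx (X * F) = X * dx F := by
  simp [dx_mul]

/-- Tool for commutation relations: it suffices to treat constants and to propagate the identity
through multiplication by `x`. -/
theorem eq_of_gens {S : Type*} [CommRing S] (T₁ T₂ : PowerSeries (Polynomial A) →+ PowerSeries S)
    (h₁ : ∀ F, T₁ (X * F) = X * T₁ F) (h₂ : ∀ F, T₂ (X * F) = X * T₂ F)
    (hc : ∀ a, T₁ (cst a) = T₂ (cst a))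
    (hx : ∀ F, T₁ F = T₂ F → T₁ (xs * F) = T₂ (xs * F)) (F : PowerSeries (Polynomial A)) :
    T₁ F = T₂ F :=
  hlin_ext T₁ T₂ h₁ h₂ (fun p => by
    induction p using poly_ind with
    | hC a => exact hc a
    | hadd p q hp hq => rw [map_add, map_add, map_add, hp, hq]
    | hX p hp => rw [map_mul]; exact hx _ hp) F

theorem dx_shift (μ : A) (F : PowerSeries (Polynomial A)) :
    dx (shift μ F) = shift μ (dx F) :=
  eq_of_gens (dx.comp (shift μ).toAddMonoidHom) ((shift μ).toAddMonoidHom.comp dx)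
    (fun F => by simp [dx_X_mul]) (fun F => by simp [dx_X_mul]) (fun a => by simp)
    (fun F h => by simp at h; simp [dx_mul, h]) F

theorem dpar_shift [Algebra ℚ A] (d : Derivation ℚ A A) (μ : A) (hμ : d μ = 0)
    (F : PowerSeries (Polynomial A)) : dpar d (shift μ F) = shift μ (dpar d F) :=
  eq_of_gens ((dpar d).comp (shift μ).toAddMonoidHom) ((shift μ).toAddMonoidHom.comp (dpar d))
    (fun F => by simp [dpar_mul]) (fun F => by simp [dpar_mul]) (fun a => by simp)
    (fun F h => by simp at h; simp [dpar_mul, h, hμ]) F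

section Gexp

variable [Algebra ℚ A]

omit [Algebra ℚ A] in
theorem constantCoeff_gexpo (a b : A) :
    constantCoeff (cst a * X ^ 2 + cst b * X * xs : PowerSeries (Polynomial A)) = 0 := by simp

/-- The series `exp(a h² + b h x)`. -/
def gexp (a b : A) : PowerSeries (Polynomial A) := fexp (cst a * X ^ 2 + cst b * X * xs)

theorem gexp_mul (a b a' b' : A) : gexp a b * gexp a' b' = gexp (a + a') (b + b') := by
  rw [gexp, gexp, ← fexp_add (constantCoeff_gexpo _ _) (constantCoeff_gexpo _ _), gexp]
  congr 1; simp; ring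

@[simp] theorem gexp_zero : gexp (0 : A) 0 = 1 := by simp [gexp]

theorem shift_gexp (μ a b : A) : shift μ (gexp a b) = gexp (a + μ * b) b := by
  rw [gexp, map_fexp_of_X _ (shift_X μ) (constantCoeff_gexpo _ _), gexp]
  congr 1; simp; ring

theorem dx_gexp (a b : A) : dx (gexp a b) = cst b * X * gexp a b := by
  have := cmap_fexp (Polynomial.derivative (R := A)).toAddMonoidHom
    (fun a b => by simp; ring) (constantCoeff_gexpo a b)
  rw [gexp, dx, this, ← dx, ← gexp]
  have h2 : dx (X ^ 2 : PowerSeries (Polynomial A)) = 0 := by rw [pow_two, dx_mul]; simp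
  rw [map_add, dx_mul, dx_mul, h2]
  simp [dx_mul]; ring

theorem dpar_gexp (d : Derivation ℚ A A) (a b : A) :
    dpar d (gexp a b) = (cst (d a) * X ^ 2 + cst (d b) * X * xs) * gexp a b := by
  have := cmap_fexp (polyDer d) (polyDer_mul d) (constantCoeff_gexpo a b)
  rw [gexp, dpar, this, ← dpar, ← gexp]
  have h2 : dpar d (X ^ 2 : PowerSeries (Polynomial A)) = 0 := by rw [pow_two, dpar_mul]; simp
  rw [map_add, dpar_mul, dpar_mul, h2]
  simp [dpar_mul]; ring

theorem constantCoeff_gexp (a b : A) : constantCoeff (gexp a b) = 1 :=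
  constantCoeff_fexp (constantCoeff_gexpo a b)

theorem map_gexp {B : Type*} [CommRing B] [Algebra ℚ B] (f : A →+* B) (a b : A) :
    PowerSeries.map (Polynomial.mapRingHom f) (gexp a b) = gexp (f a) (f b) := by
  rw [gexp, map_fexp _ (constantCoeff_gexpo _ _), gexp]
  simp [cst, xs]

end Gexp

/-! ### The one-variable Gaussian Fourier transform -/

/-- The operator `u x - ∂/∂x`. -/
def fourierOp (u : A) : Module.End A (Polynomial A) :=
  u • LinearMap.mulLeft A Polynomial.X - Polynomial.derivative

/-- `p ↦ p(u x - ∂/∂x) 1`, which is the Gaussian average `p ↦ ⟨p(y + u x)⟩` over `y` of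
variance `-u`. -/
def fourier (u : A) : Polynomial A →ₗ[A] Polynomial A :=
  (LinearMap.applyₗ (1 : Polynomial A)).comp (Polynomial.aeval (fourierOp u)).toLinearMap

theorem fourierOp_apply (u : A) (p : Polynomial A) :
    fourierOp u p = Polynomial.C u * (Polynomial.X * p) - Polynomial.derivative p := by
  simp [fourierOp, Polynomial.smul_eq_C_mul]

theorem fourier_C (u a : A) : fourier u (Polynomial.C a) = Polynomial.C a := by
  simp [fourier, Polynomial.smul_eq_C_mul]

theorem fourier_X_mul (u : A) (p : Polynomial A) :
    fourier u (Polynomial.X * p) =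
      Polynomial.C u * (Polynomial.X * fourier u p) - Polynomial.derivative (fourier u p) := by
  rw [← fourierOp_apply]; simp [fourier]

/-- Chain rule for `⟨p(y + u x)⟩`. -/
theorem derivative_fourier (u : A) (p : Polynomial A) :
    Polynomial.derivative (fourier u p) = Polynomial.C u * fourier u (Polynomial.derivative p) := by
  induction p using poly_ind with
  | hC a => simp [fourier_C]
  | hadd p q hp hq => simp [hp, hq, mul_add]
  | hX p hp =>
    simp only [Polynomial.derivative_mul, Polynomial.derivative_X, one_mul, map_add, fourier_X_mul,
      map_sub, Polynomial.derivative_C, zero_mul, zero_add, hp]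
    ring

theorem fourier_map {B : Type*} [CommRing B] (f : A →+* B) (u : A) (p : Polynomial A) :
    fourier (f u) (p.map f) = (fourier u p).map f := by
  induction p using poly_ind with
  | hC a => simp [fourier_C]
  | hadd p q hp hq => simp [hp, hq]
  | hX p hp => simp [fourier_X_mul, hp, Polynomial.derivative_map]

theorem polyDer_derivative [Algebra ℚ A] (d : Derivation ℚ A A) (p : Polynomial A) :
    polyDer d (Polynomial.derivative p) = Polynomial.derivative (polyDer d p) := by
  induction p using poly_ind with
  | hC a => simp
  | hadd p q hp hq => simp [hp, hq]
  | hX p hp => simp [polyDer_mul, hp]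

/-- Both the mean `u x` and the variance `-u` move with `u`, so besides `d p` there appear `(d u) x
⟨p'⟩` and, by the heat equation, `-(d u / 2) ⟨p''⟩`. Moving `x` inside the average by `⟨t p'⟩ = u x
⟨p'⟩ - u ⟨p''⟩`, where `t = y + u x`, turns the latter sign into `+u/2`. -/
theorem polyDer_fourier [Algebra ℚ A] (d : Derivation ℚ A A) (u : A) (hu : d u = (1 + u) * u)
    (p : Polynomial A) : polyDer d (fourier u p) = fourier u (polyDer d p) +
      Polynomial.C (1 + u) * fourier u (Polynomial.X * Polynomial.derivative p +
        Polynomial.C (u * half A) *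
          Polynomial.derivative (Polynomial.derivative p)) := by
  have hlin : ∀ a q, fourier u (Polynomial.C a * q) = Polynomial.C a * fourier u q := by
    intro a q; rw [← Polynomial.smul_eq_C_mul, map_smul, Polynomial.smul_eq_C_mul]
  induction p using poly_ind with
  | hC a => simp only [fourier_C, polyDer_C, Polynomial.derivative_C, map_zero, mul_zero, add_zero]
  | hadd p q hp hq =>
    simp only [map_add, hp, hq, mul_add, hlin]; ring
  | hX p hp =>
    have h2 : u * half A * 2 = u := by
      have : half A * 2 = 1 := half_mul_two A
      rw [mul_assoc, this, mul_one]
    set c := u * half A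
    clear_value c
    have h3 : Polynomial.X * Polynomial.derivative (Polynomial.X * p) +
        Polynomial.C c * Polynomial.derivative (Polynomial.derivative (Polynomial.X * p)) =
        Polynomial.X * (Polynomial.X * Polynomial.derivative p +
          Polynomial.C c * Polynomial.derivative (Polynomial.derivative p)) +
          Polynomial.X * p + Polynomial.C u * Polynomial.derivative p := by
      have : Polynomial.C u = Polynomial.C c * 2 := by
        rw [← map_ofNat Polynomial.C 2, ← map_mul, h2]
      rw [this]
      simp only [Polynomial.derivative_mul, Polynomial.derivative_X, one_mul, map_add]
      ring
    obtain ⟨G, hG⟩ : ∃ G, G = fourier u (Polynomial.X * Polynomial.derivative p +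
      Polynomial.C c * Polynomial.derivative (Polynomial.derivative p)) := ⟨_, rfl⟩
    rw [← hG] at hp
    rw [h3, map_add (fourier u), map_add (fourier u), fourier_X_mul u p, fourier_X_mul u (_ + _),
      ← hG,      hlin u, ← derivative_fourier,
      polyDer_mul, polyDer_X, mul_zero, add_zero, fourier_X_mul, map_sub, polyDer_mul, polyDer_mul,
      polyDer_C, polyDer_X, mul_zero, add_zero, polyDer_derivative, hp, hu, Polynomial.C_mul]
    simp only [map_add, Polynomial.derivative_mul, Polynomial.derivative_C, zero_mul, zero_add]
    ring

/-- The coefficientwise extension of `fourier` to `A[x]⟦h⟧`. -/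
def fourierS (u : A) : PowerSeries (Polynomial A) →+ PowerSeries (Polynomial A) :=
  cmap (fourier u).toAddMonoidHom

@[simp] theorem coeff_fourierS (u : A) (F : PowerSeries (Polynomial A)) (n : ℕ) :
    coeff n (fourierS u F) = fourier u (coeff n F) := by simp [fourierS]

theorem fourierS_X_mul (u : A) (F : PowerSeries (Polynomial A)) :
    fourierS u (X * F) = X * fourierS u F := cmap_X_mul _ _

theorem fourierS_cst_mul (u a : A) (F : PowerSeries (Polynomial A)) :
    fourierS u (cst a * F) = cst a * fourierS u F := by
  ext1 n
  rw [coeff_fourierS, coeff_cst_mul, coeff_cst_mul, coeff_fourierS, ← Polynomial.smul_eq_C_mul,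
    map_smul, Polynomial.smul_eq_C_mul]

theorem fourierS_cst (u a : A) : fourierS u (cst a) = cst a := by
  have := cmap_C (fourier u).toAddMonoidHom (Polynomial.C a)
  exact this.trans (congrArg _ (fourier_C u a))

theorem fourierS_xs_mul (u : A) (F : PowerSeries (Polynomial A)) :
    fourierS u (xs * F) = cst u * (xs * fourierS u F) - dx (fourierS u F) := by
  ext1 n; simp [fourier_X_mul]

theorem dx_fourierS (u : A) (F : PowerSeries (Polynomial A)) :
    dx (fourierS u F) = cst u * fourierS u (dx F) := by
  ext1 n; simp [derivative_fourier]

theorem dpar_fourierS [Algebra ℚ A] (d : Derivation ℚ A A) (u : A) (hu : d u = (1 + u) * u)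
    (F : PowerSeries (Polynomial A)) : dpar d (fourierS u F) = fourierS u (dpar d F) +
      cst (1 + u) * fourierS u (xs * dx F + cst (u * half A) * dx (dx F)) := by
  ext1 n
  rw [map_add (coeff n), coeff_dpar, coeff_fourierS, coeff_cst_mul, coeff_fourierS, coeff_fourierS,
    map_add (coeff n),    coeff_dpar, coeff_cst_mul, coeff_xs_mul, coeff_dx, coeff_dx, coeff_dx, polyDer_fourier d u hu]

/-- Translating `y + u x` by `u μ h` is the same as translating `x` by `μ h`. -/
theorem fourierS_shift (u μ : A) (F : PowerSeries (Polynomial A)) :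
    fourierS u (shift (u * μ) F) = shift μ (fourierS u F) :=
  eq_of_gens ((fourierS u).comp (shift (u * μ)).toAddMonoidHom)
    ((shift μ).toAddMonoidHom.comp (fourierS u))
    (fun F => by simp [fourierS_X_mul]) (fun F => by simp [fourierS_X_mul])
    (fun a => by simp [fourierS_cst])
    (fun F h => by
      simp only [RingHom.toAddMonoidHom_eq_coe, AddMonoidHom.coe_comp, AddMonoidHom.coe_coe,
        Function.comp_apply] at h
      simp only [RingHom.toAddMonoidHom_eq_coe, AddMonoidHom.coe_comp, AddMonoidHom.coe_coe,
        Function.comp_apply, map_mul, shift_xs, add_mul, map_add, fourierS_xs_mul, map_sub,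
        shift_cst, mul_assoc, fourierS_cst_mul, fourierS_X_mul, h, ← dx_shift]
      ring) F

theorem derivative_gexp [Algebra ℚ A] (a b : A) :
    d⁄dX (Polynomial A) (gexp a b) = gexp a b * (cst (a * 2) * X + cst b * xs) := by
  have hc : ∀ a : A, d⁄dX (Polynomial A) (cst a) = 0 := fun a => derivative_C
  have hx : d⁄dX (Polynomial A) (xs : PowerSeries (Polynomial A)) = 0 := derivative_C
  rw [gexp, derivative_fexp (constantCoeff_gexpo a b)]
  congr 1
  simp only [map_add, Derivation.leibniz, hc, hx, derivative_X, smul_eq_mul, Derivation.leibniz_pow,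
    map_mul, map_ofNat]
  simp
  ring

/-- The moment generating function of a Gaussian of mean `u x` and variance `-u`, obtained from its
differential equation in `h`. -/
theorem fourierS_gexp [Algebra ℚ A] (u b : A) :
    fourierS u (gexp 0 b) = gexp (-(b ^ 2 * u * half A)) (b * u) := by
  refine eq_of_ode (A := cst (b * u) * xs - cst (b ^ 2 * u) * X) ?_ ?_ ?_
  · rw [constantCoeff_gexp, ← coeff_zero_eq_constantCoeff_apply, coeff_fourierS,
      coeff_zero_eq_constantCoeff_apply, constantCoeff_gexp, ← map_one Polynomial.C, fourier_C]
  · have hd := derivative_cmap (fourier u).toAddMonoidHom (gexp 0 b)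
    rw [← fourierS, derivative_gexp] at hd
    rw [hd, show gexp 0 b * (cst (0 * 2) * X + cst b * xs) = cst b * (xs * gexp 0 b) by
      simp; ring, fourierS_cst_mul, fourierS_xs_mul, dx_fourierS, dx_gexp, mul_assoc,
      fourierS_cst_mul, fourierS_X_mul]
    simp only [map_mul, map_pow]
    ring
  · rw [derivative_gexp]
    have : -(b ^ 2 * u * half A) * 2 = - (b ^ 2 * u) := by
      linear_combination (-(b ^ 2 * u)) * half_mul_two A
    rw [this, map_neg]; ring

/-- Completing the square: the weight `exp(b h (y + u x))` moves the mean of `y` by `-u b h`, which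
amounts to moving `x` by `-b h`. -/
theorem fourierS_gexp_mul [Algebra ℚ A] (u b : A) (F : PowerSeries (Polynomial A)) :
    fourierS u (gexp 0 b * F) =
      gexp (-(b ^ 2 * u * half A)) (b * u) * shift (-b) (fourierS u F) :=
  eq_of_gens ((fourierS u).comp (AddMonoidHom.mulLeft (gexp 0 b)))
    ((AddMonoidHom.mulLeft (gexp (-(b ^ 2 * u * half A)) (b * u))).comp
      ((shift (-b)).toAddMonoidHom.comp (fourierS u)))
    (fun F => by simp [mul_left_comm _ X, fourierS_X_mul])
    (fun F => by simp [mul_left_comm _ X, fourierS_X_mul])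
    (fun a => by
      simp only [AddMonoidHom.coe_comp, Function.comp_apply, AddMonoidHom.coe_mulLeft,
        RingHom.toAddMonoidHom_eq_coe, AddMonoidHom.coe_coe, fourierS_cst, shift_cst]
      rw [mul_comm, fourierS_cst_mul, fourierS_gexp, mul_comm])
    (fun F h => by
      simp only [AddMonoidHom.coe_comp, Function.comp_apply, AddMonoidHom.coe_mulLeft,
        RingHom.toAddMonoidHom_eq_coe, AddMonoidHom.coe_coe] at h ⊢
      rw [mul_left_comm, fourierS_xs_mul, h, fourierS_xs_mul]
      simp only [map_sub, map_mul, shift_cst, shift_xs, dx_mul, dx_gexp, ← dx_shift, map_neg]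
      ring) F

end OneVariable

/-! ### Differential and difference equations of the formal quantum dilogarithm `ψ` -/

section Dilog

variable {A : Type*} [CommRing A] [Algebra ℚ A]

/-- The coefficient `B_k / (ℓ! k!) Li_{2-k-ℓ}`, in terms of `u = z / (1 - z)`. -/
def dilogCoeff (u : A) (k l : ℕ) : A :=
  algebraMap ℚ A (bernoulli k / (l.factorial * k.factorial)) *
    Polynomial.aeval u (liPoly (k + l - 2))

/-- The exponent of `ψ_h(x, z)`, in terms of `u = z / (1 - z)`. -/
def dilogExponent (u : A) : PowerSeries (Polynomial A) :=
  PowerSeries.mk fun n =>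
    if n = 0 then 0 else
      - ∑ p ∈ (Finset.range (n + 3) ×ˢ Finset.range (n + 3)).filter
            (fun p : ℕ × ℕ => 2 * p.1 + p.2 = n + 2),
          Polynomial.C (dilogCoeff u p.1 p.2) * Polynomial.X ^ p.2

/-- The series `ψ_h(x, z)`, in terms of `u = z / (1 - z)`. -/
def dilog (u : A) : PowerSeries (Polynomial A) := fexp (dilogExponent u)

theorem constantCoeff_dilogExponent (u : A) : constantCoeff (dilogExponent u) = 0 := by
  rw [← coeff_zero_eq_constantCoeff_apply]; simp [dilogExponent]

theorem coeff_zero_dilogExponent (u : A) : coeff 0 (dilogExponent u) = 0 := by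
  simp [dilogExponent]

theorem coeff_dilogExponent (u : A) {n k l : ℕ} (hn : n ≠ 0) (h : 2 * k + l = n + 2) :
    (coeff n (dilogExponent u)).coeff l = - dilogCoeff u k l := by
  simp only [dilogExponent, coeff_mk, if_neg hn, Polynomial.coeff_neg, Polynomial.finsetSum_coeff,
    Polynomial.coeff_C_mul_X_pow]
  rw [Finset.sum_eq_single (k, l)]
  · simp
  · rintro ⟨k', l'⟩ hm hne
    simp only [Finset.mem_filter] at hm
    rw [if_neg]
    rintro rfl
    apply hne
    have : k' = k := by omega
    rw [this]
  · intro hm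
    exfalso; apply hm
    simp only [Finset.mem_filter, Finset.mem_product, Finset.mem_range]
    omega

theorem coeff_dilogExponent_of_ne (u : A) {n l : ℕ} (h : ∀ k, 2 * k + l ≠ n + 2) :
    (coeff n (dilogExponent u)).coeff l = 0 := by
  simp only [dilogExponent, coeff_mk]
  split_ifs with hn
  · simp
  · simp only [Polynomial.coeff_neg, Polynomial.finsetSum_coeff, Polynomial.coeff_C_mul_X_pow]
    rw [Finset.sum_eq_zero, neg_zero]
    rintro ⟨k', l'⟩ hm
    simp only [Finset.mem_filter] at hm
    rw [if_neg]
    rintro rfl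
    exact h _ hm.2

theorem derivation_aeval_liPoly (d : Derivation ℚ A A) {u s : A} (hu : d u = s * (u + u ^ 2))
    (m : ℕ) : d (Polynomial.aeval u (liPoly m)) = s * Polynomial.aeval u (liPoly (m + 1)) := by
  rw [Derivation.comp_aeval_eq, hu, liPoly]
  simp; ring

/-- Applying `z d/dz` raises the polylogarithm index exactly as raising `ℓ` does. The factor `s`
allows other normalisations of the derivation; `s = 1` is used for `u` and `s = u` for the rotated
parameter `u'`. -/
theorem derivation_dilogCoeff (d : Derivation ℚ A A) {u s : A} (hu : d u = s * (u + u ^ 2))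
    {k l : ℕ} (h : 2 ≤ k + l) :
    d (dilogCoeff u k l) = s * (dilogCoeff u k (l + 1) * (l + 1)) := by
  have h1 : k + (l + 1) - 2 = k + l - 2 + 1 := by omega
  have h2 : algebraMap ℚ A (bernoulli k / (l.factorial * k.factorial)) =
      algebraMap ℚ A (bernoulli k / ((l + 1).factorial * k.factorial)) * (l + 1) := by
    have : ((l : A) + 1) = algebraMap ℚ A (l + 1) := by simp
    rw [this, ← map_mul]
    congr 1
    rw [Nat.factorial_succ]
    have := Nat.factorial_ne_zero l
    have := Nat.factorial_ne_zero k
    field_simp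
    push_cast; ring
  rw [dilogCoeff, dilogCoeff, h1, h2, Derivation.leibniz, ← h2, Derivation.map_algebraMap,
    smul_zero, add_zero, derivation_aeval_liPoly d hu, h2, smul_eq_mul]
  ring

theorem coeff_one_dilogExponent (u : A) : coeff 1 (dilogExponent u) =
    - (Polynomial.C (dilogCoeff u 0 3) * Polynomial.X ^ 3 +
      Polynomial.C (dilogCoeff u 1 1) * Polynomial.X) := by
  simp [dilogExponent, Finset.sum_filter, Finset.sum_product, Finset.sum_range_succ]

theorem coeff_two_dilogExponent (u : A) : coeff 2 (dilogExponent u) =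
    - (Polynomial.C (dilogCoeff u 0 4) * Polynomial.X ^ 4 +
      Polynomial.C (dilogCoeff u 1 2) * Polynomial.X ^ 2 + Polynomial.C (dilogCoeff u 2 0)) := by
  simp [dilogExponent, Finset.sum_filter, Finset.sum_product, Finset.sum_range_succ]

theorem dilogCoeff_one_one (u : A) : dilogCoeff u 1 1 = -(half A * u) := by
  have : algebraMap ℚ A (bernoulli 1 / ((Nat.factorial 1 : ℕ) * (Nat.factorial 1 : ℕ))) =
      - half A := by
    rw [half, ← map_neg, bernoulli_one]; norm_num
  rw [dilogCoeff, this]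
  simp [liPoly]

/-- If all pairs `(k, ℓ)` were present, the exponent would depend only on `z exp(x h)`, and `h z
d/dz` would equal `∂/∂x`. The correction at order `h` comes from the pairs `(0, 3)` and `(1, 1)`,
whose images under `∂/∂x` have no partner because the terms with `k + ℓ/2 ≤ 1` are left out. -/
theorem X_mul_dpar_dilogExponent (d : Derivation ℚ A A) {u s : A} (hu : d u = s * (u + u ^ 2)) :
    X * dpar d (dilogExponent u) = cst s * (dx (dilogExponent u) +
      X * (cst (half A * (u + u ^ 2)) * xs ^ 2
        - cst (half A * u))) := by
  have hq : cst (half A * (u + u ^ 2)) * xs ^ 2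
        - cst (half A * u) =
      C (Polynomial.C (half A * (u + u ^ 2)) * Polynomial.X ^ 2
        - Polynomial.C (half A * u)) := by simp [cst, xs]
  rw [hq]
  ext1 n
  rcases n with _ | _ | m
  · rw [coeff_cst_mul, map_add, coeff_dx, coeff_zero_dilogExponent]
    simp
  · have h3 : dilogCoeff u 0 3 * 3 = half A * (u + u ^ 2) := by
      simp only [dilogCoeff, liPoly, bernoulli_zero]
      have : (algebraMap ℚ A (1 / ((Nat.factorial 3 : ℕ) * (Nat.factorial 0 : ℕ)))) * 3 =
          half A := by
        rw [half, ← map_ofNat (algebraMap ℚ A) 3, ← map_mul]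
        congr 1
        norm_num [Nat.factorial]
      rw [mul_right_comm, this]
      simp
    rw [coeff_succ_X_mul, coeff_dpar, coeff_cst_mul, map_add, coeff_succ_X_mul, coeff_dx,
      coeff_zero_dilogExponent, map_zero, coeff_one_dilogExponent, coeff_zero_C,
      dilogCoeff_one_one, ← h3]
    have h3' : (Polynomial.C (3 : A)) = 3 := map_ofNat _ 3
    have h2' : (Polynomial.C (2 : A)) = 2 := map_ofNat _ 2
    simp [h3', h2']
    ring
  · rw [coeff_succ_X_mul, coeff_dpar, coeff_cst_mul, map_add, coeff_succ_X_mul, coeff_dx,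
      coeff_succ_C, add_zero]
    ext l
    rw [coeff_polyDer, Polynomial.coeff_C_mul, Polynomial.coeff_derivative]
    by_cases h : ∃ k, 2 * k + l = m + 1 + 2
    · obtain ⟨k, hk⟩ := h
      rw [coeff_dilogExponent u (by omega) hk, coeff_dilogExponent u (k := k) (by omega) (by omega),
        map_neg, derivation_dilogCoeff d hu (by omega)]
      ring
    · push Not at h
      rw [coeff_dilogExponent_of_ne u h, coeff_dilogExponent_of_ne u fun k hk => h k (by omega)]
      simp

theorem dx_dilog (u : A) : dx (dilog u) = dilog u * dx (dilogExponent u) :=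
  cmap_fexp _ (fun a b => by simp; ring) (constantCoeff_dilogExponent u)

theorem dpar_dilog (d : Derivation ℚ A A) (u : A) :
    dpar d (dilog u) = dilog u * dpar d (dilogExponent u) :=
  cmap_fexp _ (polyDer_mul d) (constantCoeff_dilogExponent u)

/-- The differential equation of `ψ_h(x, z)` which expresses that, up to elementary factors, it
depends on `x` and `z` only through `z exp(x h)`. -/
theorem X_mul_dpar_dilog (d : Derivation ℚ A A) {u s : A} (hu : d u = s * (u + u ^ 2)) :
    X * dpar d (dilog u) = cst s * (dx (dilog u) +
      X * (cst (half A * (u + u ^ 2)) * xs ^ 2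
        - cst (half A * u)) * dilog u) := by
  rw [dx_dilog, dpar_dilog]
  linear_combination dilog u * X_mul_dpar_dilogExponent d hu

/-- Evaluation at `x = 0`. -/
def evalZero : PowerSeries (Polynomial A) →+* PowerSeries A :=
  PowerSeries.map (Polynomial.evalRingHom 0)

omit [Algebra ℚ A] in
-- At `x = 0` the shift substitutes `h` for `x`, so `x^j` at order `h^(n-j)` contributes to order
-- `h^n`.
theorem coeff_evalZero_shift_one (F : PowerSeries (Polynomial A)) (n : ℕ) :
    coeff n (evalZero (shift 1 F)) =
      ∑ j ∈ Finset.range (n + 1), (coeff (n - j) F).coeff j := by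
  have h : ∀ p : Polynomial A, evalZero (Polynomial.eval₂RingHom cst (xs + cst 1 * X) p) =
      (p : PowerSeries A) := by
    intro p
    have : (evalZero (A := A)).comp (Polynomial.eval₂RingHom cst (xs + cst 1 * X)) =
        Polynomial.coeToPowerSeries.ringHom := by
      apply Polynomial.ringHom_ext <;> simp [evalZero, cst, xs]
    exact RingHom.congr_fun this p
  have h2 : ∀ m (p : Polynomial A), (coeff m (Polynomial.eval₂RingHom cst (xs + cst 1 * X) p)).eval 0
      = p.coeff m := by
    intro m p
    have := congrArg (coeff m) (h p)
    rw [Polynomial.coeff_coe] at this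
    rw [← this]; simp [evalZero]
  have h3 : coeff n (shift 1 F) = ∑ p ∈ Finset.HasAntidiagonal.antidiagonal n,
      coeff p.2 (Polynomial.eval₂RingHom cst (xs + cst 1 * X) (coeff p.1 F)) :=
    coeff_hext _ _ _
  rw [evalZero, coeff_map, h3, map_sum, ← Finset.Nat.sum_antidiagonal_swap,
    Finset.Nat.sum_antidiagonal_eq_sum_range_succ_mk]
  refine Finset.sum_congr rfl fun j _ => ?_
  exact h2 _ _

/-- The polylogarithm depends only on `k + ℓ` and factors out; what remains is the recursion `∑_{k <
n} binom(n, k) B_k = 0` for `n ≥ 2`, which kills every term but `ℓ = 0`. -/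
theorem sum_dilogCoeff (u : A) (m : ℕ) :
    ∑ j ∈ Finset.range (m + 4), dilogCoeff u (m + 3 - j) j = dilogCoeff u (m + 3) 0 := by
  rw [← Finset.sum_range_reflect, Finset.sum_range_succ]
  have : ∀ j ∈ Finset.range (m + 3), dilogCoeff u (m + 3 - (m + 4 - 1 - j)) (m + 4 - 1 - j) =
      algebraMap ℚ A (((m + 3).choose j : ℚ) * bernoulli j) *
      (algebraMap ℚ A (1 / (m + 3).factorial) * Polynomial.aeval u (liPoly (m + 1))) := by
    intro j hj
    have hj' := Finset.mem_range.1 hj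
    have e1 : m + 3 - (m + 4 - 1 - j) = j := by omega
    have e2 : m + 4 - 1 - j = m + 3 - j := by omega
    have e3 : j + (m + 3 - j) - 2 = m + 1 := by omega
    rw [e1, e2, dilogCoeff, e3, ← mul_assoc, ← map_mul]
    congr 2
    rw [Nat.cast_choose ℚ hj'.le]
    have := Nat.factorial_ne_zero j
    have := Nat.factorial_ne_zero (m + 3)
    have := Nat.factorial_ne_zero (m + 3 - j)
    field_simp
  rw [Finset.sum_congr rfl this, ← Finset.sum_mul, ← map_sum, sum_bernoulli]
  simp

theorem evalZero_shift_dilogExponent (u : A) :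
    evalZero (shift 1 (dilogExponent u)) =
      evalZero (dilogExponent u) + C (half A * u) * X ^ 2 := by
  ext n
  rw [coeff_evalZero_shift_one, map_add, evalZero, coeff_map, coeff_C_mul, coeff_X_pow,
    Polynomial.coe_evalRingHom, ← Polynomial.coeff_zero_eq_eval_zero]
  obtain ⟨M, rfl | rfl⟩ := n.even_or_odd'
  · rcases M with _ | _ | m
    · simp [coeff_zero_dilogExponent]
    -- Here `k + ℓ = 2`, and the Bernoulli cancellation fails because `(k, ℓ) = (0, 2)` is excluded
    -- from the exponent. The pair `(1, 1)` survives and gives `u / 2`.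
    · have h1 : (coeff 1 (dilogExponent u)).coeff 1 = _ :=
        coeff_dilogExponent u (k := 1) one_ne_zero rfl
      simp [Finset.sum_range_succ, coeff_zero_dilogExponent, h1,
        dilogCoeff_one_one]
    · have e : 2 * (m + 1 + 1) ≠ 2 := by omega
      rw [if_neg e, mul_zero, add_zero]
      rw [← Finset.sum_subset (s₁ := Finset.range (m + 4))]
      · rw [coeff_dilogExponent u (k := m + 3) (by omega) (by omega), ← sum_dilogCoeff,
          ← Finset.sum_neg_distrib]
        refine Finset.sum_congr rfl fun j hj => ?_
        have := Finset.mem_range.1 hj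
        exact coeff_dilogExponent u (by omega) (by omega)
      · intro j hj
        simp only [Finset.mem_range] at *; omega
      · intro j hj hj'
        simp only [Finset.mem_range] at *
        exact coeff_dilogExponent_of_ne u fun k => by omega
  · rw [if_neg (by omega), mul_zero, add_zero, coeff_dilogExponent_of_ne u fun k => by omega]
    refine Finset.sum_eq_zero fun j hj => ?_
    have := Finset.mem_range.1 hj
    exact coeff_dilogExponent_of_ne u fun k => by omega

theorem eq_zero_of_derivative {p : Polynomial A} (h : Polynomial.derivative p = 0)
    (h0 : p.coeff 0 = 0) : p = 0 := by
  ext n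
  cases n with
  | zero => simpa using h0
  | succ n =>
    have := congrArg (fun q => Polynomial.coeff q n) h
    simp only [Polynomial.coeff_derivative, Polynomial.coeff_zero] at this
    simpa using smul_eq_zero_of_nat this

/-- The equation gives `∂/∂x` of each coefficient in `h` from the preceding ones, and the value at
`x = 0` fixes the constant of integration. -/
theorem eq_zero_of_pde (d : Derivation ℚ A A) {W Q : PowerSeries (Polynomial A)}
    (h : dx W = X * (dpar d W + Q * W)) (h0 : evalZero W = 0) : W = 0 := by
  ext1 n
  rw [map_zero]
  induction n using Nat.strong_induction_on with
  | _ n ih =>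
    apply eq_zero_of_derivative
    · rw [← coeff_dx, h]
      cases n with
      | zero => simp
      | succ n =>
        rw [coeff_succ_X_mul, map_add, coeff_dpar, ih n (Nat.lt_succ_self n), map_zero, coeff_mul,
          zero_add]
        refine Finset.sum_eq_zero fun p hp => ?_
        have := Finset.HasAntidiagonal.mem_antidiagonal.1 hp
        rw [ih p.2 (by omega), mul_zero]
    · have := congrArg (coeff n) h0
      simpa [evalZero, Polynomial.coeff_zero_eq_eval_zero] using this

/-- The difference equation of `ψ_h(x, z)`. -/
theorem shift_dilog (d : Derivation ℚ A A) {u : A} (hu : d u = u + u ^ 2) :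
    shift 1 (dilog u) = gexp (half A * u) u *
      (cst (1 + u) - cst u * gexp 0 1) * dilog u := by
  have hD := X_mul_dpar_dilog d (u := u) (s := 1) (by rw [hu, one_mul])
  have hh : cst (half A) * 2 = 1 := by
    rw [← map_ofNat cst 2, ← map_mul, half_mul_two, map_one]
  rw [map_one, one_mul] at hD
  -- The difference of the two sides satisfies the shifted differential equation, so only its value
  -- at `x = 0` needs checking. There the factor `1 + u - u exp(h x)` becomes `1` and the Bernoulli
  -- identity applies.
  rw [← sub_eq_zero]
  refine eq_zero_of_pde d (Q := - shift 1 (cst (half A * (u + u ^ 2)) * xs ^ 2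
        - cst (half A * u))) ?_ ?_
  · have hS := congrArg (shift 1) hD
    simp only [map_mul, map_add, shift_X, ← dx_shift, ← dpar_shift d 1 (by simp)] at hS
    have hd : d (half A * u) = half A * (u + u ^ 2) := by
      rw [Derivation.leibniz, derivation_half, hu]; simp
    simp only [map_sub, dx_mul, dpar_mul, dx_gexp, dpar_gexp, dx_cst, dpar_cst, hd, hu, map_one,
      dx_one, dpar_one, map_mul, map_add, map_pow, shift_cst, shift_xs, Derivation.map_one_eq_zero, map_zero] at hS hD ⊢
    linear_combination -hS + gexp (half A * u) u *
      (1 + cst u - cst u * gexp 0 1) * hD -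
      gexp (half A * u) u * (1 + cst u - cst u * gexp 0 1) * dilog u * X ^ 2 * (cst u + cst u ^ 2) *
        xs * hh
  · have h1 : evalZero (gexp (half A * u) u) =
        fexp (C (half A * u) * X ^ 2) := by
      rw [gexp, evalZero, map_fexp _ (constantCoeff_gexpo _ _)]
      simp [cst, xs]
    have h2 : evalZero (gexp (0 : A) 1) = 1 := by
      rw [gexp, evalZero, map_fexp _ (constantCoeff_gexpo _ _)]
      simp [cst, xs]
    have h3 : ∀ a : A, evalZero (cst a) = C a := fun a => by simp [evalZero, cst]
    have k1 : constantCoeff (evalZero (dilogExponent u)) = 0 := by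
      rw [← coeff_zero_eq_constantCoeff_apply, evalZero, coeff_map, coeff_zero_dilogExponent,
        map_zero]
    have k2 : constantCoeff (shift 1 (dilogExponent u)) = 0 := by
      rw [← coeff_zero_eq_constantCoeff_apply, shift, coeff_hext]
      simp [constantCoeff_dilogExponent]
    have k3 : evalZero (fexp (shift 1 (dilogExponent u))) = _ := map_fexp _ k2
    have k4 : evalZero (fexp (dilogExponent u)) = _ :=
      map_fexp _ (constantCoeff_dilogExponent u)
    rw [← evalZero] at k3 k4
    rw [map_sub, map_mul, map_mul, map_sub, map_mul, h1, h2, h3, h3, dilog,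
      map_fexp_of_X _ (shift_X _) (constantCoeff_dilogExponent u), k3, k4,
      evalZero_shift_dilogExponent, fexp_add k1 (by simp)]
    simp; ring

/-- At order `h^(n+1)` the difference `F(x + h) - F(x)` is the derivative of coefficient `n`, plus
contributions of lower coefficients; these vanish once the lower coefficients are known to be
constant in `x`. -/
theorem dx_eq_zero_of_shift {F : PowerSeries (Polynomial A)} (h : shift 1 F = F) : dx F = 0 := by
  have hc0 : ∀ p : Polynomial A, coeff 0 (Polynomial.eval₂RingHom cst (xs + cst 1 * X) p) = p := by
    intro p
    induction p using poly_ind with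
    | hC a => simp [cst]
    | hadd p q hp hq => rw [map_add, map_add, hp, hq]
    | hX p hp =>
      rw [map_mul, coeff_zero_eq_constantCoeff_apply, map_mul, ← coeff_zero_eq_constantCoeff_apply,
        ← coeff_zero_eq_constantCoeff_apply, hp]
      simp [xs]
  have hc1 : ∀ p : Polynomial A, coeff 1 (Polynomial.eval₂RingHom cst (xs + cst 1 * X) p) =
      Polynomial.derivative p := by
    intro p
    induction p using poly_ind with
    | hC a => simp [cst]
    | hadd p q hp hq => rw [map_add, map_add, map_add, hp, hq]
    | hX p hp =>
      have := hc0 p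
      rw [map_mul, Polynomial.coe_eval₂RingHom, Polynomial.eval₂_X, map_one, one_mul, add_mul,
        map_add, coeff_xs_mul, coeff_succ_X_mul, ← Polynomial.coe_eval₂RingHom]
      rw [map_one, one_mul] at hp this
      rw [hp, this]
      simp; ring
  have hconst : ∀ (p : Polynomial A) (j : ℕ), Polynomial.derivative p = 0 →
      coeff (j + 1) (Polynomial.eval₂RingHom cst (xs + cst 1 * X) p) = 0 := by
    intro p j hp
    have : p = Polynomial.C (p.coeff 0) := by
      rw [← sub_eq_zero]
      exact eq_zero_of_derivative (by simp [hp]) (by simp)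
    rw [this]
    simp [cst]
  ext1 n
  rw [coeff_dx, map_zero]
  induction n using Nat.strong_induction_on with
  | _ n ih =>
    have h3 : coeff (n + 1) (shift 1 F) = ∑ p ∈ Finset.HasAntidiagonal.antidiagonal (n + 1),
        coeff p.2 (Polynomial.eval₂RingHom cst (xs + cst 1 * X) (coeff p.1 F)) :=
      coeff_hext _ _ _
    rw [h, Finset.Nat.sum_antidiagonal_eq_sum_range_succ_mk, Finset.sum_range_succ,
      Finset.sum_range_succ, Finset.sum_eq_zero] at h3
    · simp only [Nat.sub_self, hc0, Nat.add_sub_cancel_left, hc1, zero_add] at h3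
      simpa using h3
    · intro i hi
      have hi := Finset.mem_range.1 hi
      obtain ⟨j, hj⟩ : ∃ j, n + 1 - i = j + 1 := ⟨n - i, by omega⟩
      simp only [hj]
      exact hconst _ _ (ih i hi)

end Dilog

/-! ### The Fourier transform satisfies the equations of `ψ` -/

section Fourier

variable {A : Type*} [CommRing A] [Algebra ℚ A]

theorem gexp_eq_map (a : A) :
    gexp a 0 = PowerSeries.map Polynomial.C (fexp (C a * X ^ 2)) := by
  rw [gexp, map_fexp _ (by simp)]
  simp [cst]

omit [Algebra ℚ A] in
theorem fourierS_map_C_mul (u : A) (s : PowerSeries A) (F : PowerSeries (Polynomial A)) :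
    fourierS u (PowerSeries.map Polynomial.C s * F) =
      PowerSeries.map Polynomial.C s * fourierS u F :=
  cmap_mul_of_semilinear Polynomial.C Polynomial.C _ (fun a r => by
    simp [← Polynomial.smul_eq_C_mul]) s F

theorem fourierS_gexp_zero_mul (u a : A) (F : PowerSeries (Polynomial A)) :
    fourierS u (gexp a 0 * F) = gexp a 0 * fourierS u F := by
  rw [gexp_eq_map, fourierS_map_C_mul]

/-- The Gaussian average of `exp(h x / 2) ψ_h(x, z')`, where `z' = 1 / (1 - z)`. -/
def fourierDilog (u u' : A) : PowerSeries (Polynomial A) :=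
  fourierS u (gexp 0 (half A) * dilog u')

/-- A shift by `1 = u v` inside the transform is a shift by `v` outside. The two exponentials in the
difference equation of `dilog u'` become shifts by `-u'` and `-(u' + 1) = v`. After a further shift
by `-v`, only shifts by `1` and `0` remain, and the relation is solved for the former. -/
theorem shift_fourierDilog (d : Derivation ℚ A A) {u v u' : A} (huv : u * v = 1)
    (hu' : u' = -v - 1) (hdu : d u = u + u ^ 2) :
    shift 1 (fourierDilog u u') = gexp (half A * u) u *
      (cst (1 + u) - cst u * gexp 0 1) * fourierDilog u u' := by
  have hh := half_mul_two A
  have hdv : d v = - v - 1 := by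
    have h := congrArg d huv
    rw [Derivation.leibniz, Derivation.map_one_eq_zero, hdu, smul_eq_mul, smul_eq_mul] at h
    linear_combination v * h - (d v + v + 1 + u * v) * huv
  have hdu' : (v • d) u' = u' + u' ^ 2 := by
    rw [Derivation.smul_apply, hu', map_sub, map_neg, hdv, Derivation.map_one_eq_zero, smul_eq_mul]
    ring
  have hS := shift_dilog (v • d) hdu'
  have h1 : shift 1 (gexp 0 (half A) * dilog u') =
      gexp (-(half A * v)) 0 * (cst (-v) * (gexp 0 u' * (gexp 0 (half A) * dilog u')) -
        cst u' * (gexp 0 (u' + 1) * (gexp 0 (half A) * dilog u'))) := by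
    have e1 : gexp (-(half A * v)) 0 * gexp 0 u' * gexp 0 (half A) =
        gexp (half A) (half A) * gexp (half A * u') u' := by
      simp only [gexp_mul]; congr 1
      · rw [hu']; ring
      · ring
    have e2 : gexp 0 (u' + 1) = gexp 0 u' * gexp 0 1 := by rw [gexp_mul, add_zero]
    have e3 : 1 + u' = - v := by rw [hu']; ring
    rw [map_mul, hS, shift_gexp, zero_add, one_mul, e2, e3]
    linear_combination (-(cst (-v) - cst u' * gexp 0 1) * dilog u') * e1
  have h2 := congrArg (fourierS u) h1
  have h3 : shift 1 (gexp 0 (half A) * dilog u') =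
      shift (u * v) (gexp 0 (half A) * dilog u') := by rw [huv]
  rw [h3, fourierS_shift, fourierS_gexp_zero_mul, map_sub (fourierS u), fourierS_cst_mul,
    fourierS_cst_mul, fourierS_gexp_mul u u', fourierS_gexp_mul u (u' + 1), ← fourierDilog] at h2
  have h4 := congrArg (shift (-v)) h2
  have n1 : -v + -u' = 1 := by rw [hu']; ring
  have n2 : -v + -(u' + 1) = 0 := by rw [hu']; ring
  simp only [map_mul, map_sub, shift_cst, shift_gexp, shift_shift, n1, n2, shift_zero,
    neg_add_cancel] at h4
  generalize fourierDilog u u' = R at h4 ⊢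
  set G1 := gexp (-(u' ^ 2 * u * half A) + -v * (u' * u)) (u' * u)
  set G2 := gexp (-((u' + 1) ^ 2 * u * half A) + -v * ((u' + 1) * u)) ((u' + 1) * u)
  have k1 : gexp (-(half A * v) + -v * 0) 0 * G1 * gexp (half A * u) u * gexp 0 1 = 1 := by
    simp only [G1, gexp_mul]
    rw [← gexp_zero]
    congr 1
    · rw [hu']
      linear_combination (-half A * v - 2 * half A + v + 1) * huv - (v + 1) * hh
    · rw [hu']; linear_combination -huv
  have k2 : gexp (-(half A * v) + -v * 0) 0 * G2 * gexp 0 1 = 1 := by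
    simp only [G2, gexp_mul]
    rw [← gexp_zero]
    congr 1
    · rw [hu']
      linear_combination (v - half A * v) * huv - v * hh
    · rw [hu']; linear_combination -huv
  have k3 : cst u * cst v = 1 := by rw [← map_mul, huv, map_one]
  have k4 : cst u' = - cst v - 1 := by rw [hu']; simp
  rw [map_neg] at h4
  rw [map_add, map_one]
  rw [k4] at h4
  linear_combination cst u * gexp (half A * u) u * gexp 0 1 * h4 -
    shift 1 R * (cst u * cst v * k1 + k3) +
    R * gexp (half A * u) u * (cst u * (cst v + 1) * k2 + k3)

/-- The equation of `dilog u'` is transformed term by term: inside the average `x` acts as `u x -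
∂/∂x`, and `dpar_fourierS` accounts for the dependence of the Gaussian on `u`. Since `d` is
normalised for `u`, one has `d u' = u (u' + u'^2)`. -/
theorem X_mul_dpar_fourierDilog (d : Derivation ℚ A A) {u v u' : A} (huv : u * v = 1)
    (hu' : u' = -v - 1) (hdu : d u = u + u ^ 2) :
    X * dpar d (fourierDilog u u') = dx (fourierDilog u u') +
      X * (cst (half A * (u + u ^ 2)) * xs ^ 2 - cst (half A * u)) * fourierDilog u u' := by
  have hh : cst (half A) * 2 = 1 := by
    rw [← map_ofNat cst 2, ← map_mul, half_mul_two, map_one]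
  have hdv : d v = - v - 1 := by
    have h := congrArg d huv
    rw [Derivation.leibniz, Derivation.map_one_eq_zero, hdu, smul_eq_mul, smul_eq_mul] at h
    linear_combination v * h - (d v + v + 1 + u * v) * huv
  have hdu' : d u' = u * (u' + u' ^ 2) := by
    rw [hu', map_sub, map_neg, hdv, Derivation.map_one_eq_zero]
    linear_combination (-1 - v) * huv
  have k3 : cst u * cst v = 1 := by rw [← map_mul, huv, map_one]
  have k4 : cst u' = - cst v - 1 := by rw [hu']; simp
  have hD := X_mul_dpar_dilog d hdu'
  set φ := gexp 0 (half A) * dilog u' with hφ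
  have h1 : X * dpar d φ = cst u * dx φ + X * (cst (half A) * φ) +
      X * (cst (half A * (v + 1)) * (xs * (xs * φ))) := by
    rw [hφ, dpar_mul, dx_mul, dpar_gexp, dx_gexp]
    simp only [map_zero, derivation_half, map_mul, map_add, map_one, k4, map_pow] at hD ⊢
    linear_combination gexp 0 (half A) * hD + cst (half A) * X * gexp 0 (half A) * dilog u' *
      ((cst v + 1) * xs ^ 2 + 1) * k3
  have h2 := congrArg (fourierS u) h1
  simp only [map_add (fourierS u), fourierS_X_mul, fourierS_cst_mul, fourierS_xs_mul] at h2
  rw [fourierDilog, ← hφ, dpar_fourierS d u (by rw [hdu]; ring), map_add (fourierS u),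
    fourierS_cst_mul]
  simp only [fourierS_xs_mul, dx_fourierS, map_sub, dx_mul,
    dx_cst, dx_xs, map_add, map_mul, map_pow, map_one] at h2 ⊢
  generalize fourierS u φ = P at *
  generalize fourierS u (dx φ) = P₁ at *
  generalize fourierS u (dx (dx φ)) = P₂ at *
  linear_combination h2 + X * cst (half A) * (xs * (cst u * xs * P - cst u * P₁) - P -
    cst u * xs * P₁ + cst u * P₂) * k3 - (1 + cst u) * cst u * X * (xs * P₁ - P₂) * hh

omit [Algebra ℚ A] in
theorem eq_map_C_of_dx_eq_zero [Algebra ℚ A] {F : PowerSeries (Polynomial A)} (h : dx F = 0) :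
    F = PowerSeries.map Polynomial.C (evalZero F) := by
  ext1 n
  rw [coeff_map, evalZero, coeff_map, ← sub_eq_zero]
  apply eq_zero_of_derivative
  · have := congrArg (coeff n) h
    rw [coeff_dx, map_zero] at this
    simp [this]
  · simp [Polynomial.coeff_zero_eq_eval_zero]

/-- The quotient by `dilog u` is invariant under `x ↦ x + h`, hence free of `x`; the differential
equation then says that `d` kills its coefficients. -/
theorem fourierDilog_eq_mul (d : Derivation ℚ A A) {u v u' : A} (huv : u * v = 1)
    (hu' : u' = -v - 1) (hdu : d u = u + u ^ 2) :
    ∃ c : PowerSeries A, (∀ n, d (coeff n c) = 0) ∧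
      fourierDilog u u' = PowerSeries.map Polynomial.C c * dilog u := by
  have hR := shift_fourierDilog d huv hu' hdu
  have hψ := shift_dilog d hdu
  have hRD := X_mul_dpar_fourierDilog d huv hu' hdu
  have hψD := X_mul_dpar_dilog d (u := u) (s := 1) (by rw [hdu, one_mul])
  rw [map_one, one_mul] at hψD
  generalize fourierDilog u u' = R at *
  obtain ⟨ψi, hψi⟩ : ∃ ψi, ψi * dilog u = 1 :=
    ⟨_, fexp_neg_mul (constantCoeff_dilogExponent u)⟩
  have hs : shift 1 (R * ψi) = R * ψi := by
    have h1 := congrArg (shift 1) hψi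
    rw [map_mul, map_one, hψ] at h1
    rw [map_mul, hR]
    linear_combination R * ψi * h1 - (gexp (half A * u) u *
      (cst (1 + u) - cst u * gexp 0 1) * R * shift 1 ψi) * hψi
  have hd := dx_eq_zero_of_shift hs
  have hR' : R = R * ψi * dilog u := by linear_combination -R * hψi
  generalize R * ψi = φ at hR' hd
  refine ⟨evalZero φ, fun n => ?_, by rw [← eq_map_C_of_dx_eq_zero hd]; exact hR'⟩
  have h2 : X * dpar d φ = 0 := by
    rw [hR', dpar_mul, dx_mul, hd] at hRD
    linear_combination ψi * hRD - ψi * φ * hψD - X * dpar d φ * hψi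
  have h3 := congrArg (coeff (n + 1)) h2
  rw [coeff_succ_X_mul, coeff_dpar, map_zero] at h3
  rw [evalZero, coeff_map, Polynomial.coe_evalRingHom, ← Polynomial.coeff_zero_eq_eval_zero,
    ← coeff_polyDer, h3, Polynomial.coeff_zero]

end Fourier

/-! ### Determination of the constant `1/24` over Laurent polynomials -/

section Universal

open LaurentPolynomial in
/-- The Euler operator `T d/dT` on Laurent polynomials, as a linear map. -/
def eulerLin : LaurentPolynomial ℚ →ₗ[ℚ] LaurentPolynomial ℚ where
  toFun p := AddMonoidAlgebra.ofCoeff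
    (Finsupp.onFinset p.coeff.support (fun n => (n : ℚ) * p.coeff n) (fun n h => by
      rw [Finsupp.mem_support_iff]; exact right_ne_zero_of_mul h))
  map_add' p q := by ext n; simp [mul_add]
  map_smul' a p := by ext n; simp; ring

theorem coeff_eulerLin (p : LaurentPolynomial ℚ) (n : ℤ) :
    (eulerLin p).coeff n = n * p.coeff n := rfl

theorem eulerLin_monomial (n : ℤ) (a : ℚ) :
    eulerLin (LaurentPolynomial.C a * LaurentPolynomial.T n) =
      (n : ℚ) • (LaurentPolynomial.C a * LaurentPolynomial.T n) := by
  rw [← LaurentPolynomial.single_eq_C_mul_T]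
  ext m
  change (m : ℚ) * Finsupp.single n a m = (n : ℚ) * Finsupp.single n a m
  by_cases h : n = m
  · rw [h]
  · rw [Finsupp.single_eq_of_ne (Ne.symm h), mul_zero, mul_zero]

/-- The Euler operator `T d/dT` on Laurent polynomials. -/
def euler : Derivation ℚ (LaurentPolynomial ℚ) (LaurentPolynomial ℚ) :=
  Derivation.mk' eulerLin fun p q => by
    induction p using LaurentPolynomial.induction_on' with
    | add p p' hp hp' => rw [add_mul, map_add, hp, hp', map_add]; simp only [smul_eq_mul]; ring
    | C_mul_T n a =>
      induction q using LaurentPolynomial.induction_on' with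
      | add p p' hp hp' => rw [mul_add, map_add, hp, hp', map_add]; simp only [smul_eq_mul]; ring
      | C_mul_T m b =>
        rw [eulerLin_monomial, eulerLin_monomial,
          show LaurentPolynomial.C a * LaurentPolynomial.T n * (LaurentPolynomial.C b *
            LaurentPolynomial.T m) = LaurentPolynomial.C (a * b) * LaurentPolynomial.T (n + m) by
            rw [LaurentPolynomial.T_add, map_mul]; ring, eulerLin_monomial, LaurentPolynomial.T_add,
          map_mul]
        simp only [smul_eq_mul, Algebra.smul_def]
        rw [Int.cast_add, map_add]
        ring

theorem eq_C_of_euler_eq_zero {p : LaurentPolynomial ℚ} (h : euler p = 0) :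
    p = LaurentPolynomial.C (p.coeff 0) := by
  ext n
  have h1 : (n : ℚ) * p.coeff n = 0 := by
    rw [← coeff_eulerLin]
    have : eulerLin p = 0 := h
    rw [this]; rfl
  change _ = Finsupp.single 0 (p.coeff 0) n
  by_cases hn : n = 0
  · subst hn; simp
  · have : (n : ℚ) ≠ 0 := by exact_mod_cast hn
    have h2 := (mul_eq_zero.1 h1).resolve_left this
    rw [h2, Finsupp.single_eq_of_ne hn]

variable {A B : Type*} [CommRing A] [Algebra ℚ A] [CommRing B] [Algebra ℚ B]

theorem map_dilogCoeff (f : A →+* B) (u : A) (k l : ℕ) :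
    f (dilogCoeff u k l) = dilogCoeff (f u) k l := by
  have h : f.comp (algebraMap ℚ A) = algebraMap ℚ B := RingHom.ext_rat _ _
  rw [dilogCoeff, dilogCoeff, map_mul, Polynomial.aeval_def, Polynomial.aeval_def,
    Polynomial.hom_eval₂, h]
  congr 1
  rw [← h]; rfl

theorem map_dilogExponent (f : A →+* B) (u : A) :
    PowerSeries.map (Polynomial.mapRingHom f) (dilogExponent u) = dilogExponent (f u) := by
  ext1 n
  simp only [dilogExponent, coeff_map, coeff_mk]
  split_ifs with h
  · simp
  · rw [map_neg, map_sum]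
    simp only [map_mul, Polynomial.coe_mapRingHom, Polynomial.map_C, map_dilogCoeff,
      Polynomial.map_pow, Polynomial.map_X]

theorem map_dilog (f : A →+* B) (u : A) :
    PowerSeries.map (Polynomial.mapRingHom f) (dilog u) = dilog (f u) := by
  rw [dilog, map_fexp _ (constantCoeff_dilogExponent u), map_dilogExponent, dilog]

theorem map_fourierDilog (f : A →+* B) (u u' : A) :
    PowerSeries.map (Polynomial.mapRingHom f) (fourierDilog u u') =
      fourierDilog (f u) (f u') := by
  have : ∀ F, PowerSeries.map (Polynomial.mapRingHom f) (fourierS u F) =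
      fourierS (f u) (PowerSeries.map (Polynomial.mapRingHom f) F) := by
    intro F; ext1 n; simp [fourier_map]
  rw [fourierDilog, this, map_mul, map_gexp, map_dilog, fourierDilog, map_zero, map_half]

theorem aeval_zero_liPoly (m : ℕ) : Polynomial.aeval (0 : A) (liPoly m) = 0 := by
  cases m <;> simp [liPoly]

theorem aeval_neg_one_liPoly (m : ℕ) : Polynomial.aeval (-1 : A) (liPoly (m + 1)) = 0 := by
  simp [liPoly]

theorem dilog_zero : dilog (0 : A) = 1 := by
  have : dilogExponent (0 : A) = 0 := by
    ext1 n
    simp [dilogExponent, dilogCoeff, aeval_zero_liPoly]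
  rw [dilog, this, fexp_zero]

/-- At `u = -1` the polynomials `liPoly (m + 1)` vanish, having the factor `u + u^2`. Only the pairs
`(1, 1)` and `(2, 0)` with `k + ℓ = 2` survive. -/
theorem dilog_neg_one : dilog (-1 : A) = gexp (algebraMap ℚ A (1 / 12)) (-half A) := by
  have h0 : ∀ k l, 2 < k + l → dilogCoeff (-1 : A) k l = 0 := by
    intro k l h
    obtain ⟨m, hm⟩ : ∃ m, k + l - 2 = m + 1 := ⟨k + l - 3, by omega⟩
    rw [dilogCoeff, hm, aeval_neg_one_liPoly, mul_zero]
  have h1 : dilogCoeff (-1 : A) 2 0 = -algebraMap ℚ A (1 / 12) := by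
    have : (bernoulli 2 / ((Nat.factorial 0 : ℕ) * (Nat.factorial 2 : ℕ)) : ℚ) = 1 / 12 := by
      rw [bernoulli_two]; norm_num [Nat.factorial]
    rw [dilogCoeff, this]
    change algebraMap ℚ A (1 / 12) * Polynomial.aeval (-1) (liPoly 0) = _
    rw [liPoly, Polynomial.aeval_X, mul_neg_one]
  generalize algebraMap ℚ A (1 / 12) = c at *
  rw [dilog, gexp]
  congr 1
  have hr : (cst c * X ^ 2 + cst (-half A) * X * xs :
      PowerSeries (Polynomial A)) = C (Polynomial.C c) * X ^ 2 +
      C (Polynomial.C (-half A) * Polynomial.X) * X ^ 1 := by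
    simp only [cst, xs, RingHom.comp_apply, map_mul, pow_one]; ring
  rw [hr]
  ext1 n
  rw [map_add, coeff_C_mul, coeff_C_mul, coeff_X_pow, coeff_X_pow]
  rcases n with _ | _ | _ | n
  · simp [constantCoeff_dilogExponent]
  · rw [coeff_one_dilogExponent, h0 0 3 (by norm_num), dilogCoeff_one_one]
    simp
  · rw [coeff_two_dilogExponent, h0 0 4 (by norm_num), h0 1 2 (by norm_num), h1]
    simp
  · rw [if_neg (by omega), if_neg (by omega), dilogExponent, coeff_mk, if_neg (by omega),
      Finset.sum_eq_zero]
    · simp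
    · rintro ⟨k, l⟩ h
      simp only [Finset.mem_filter] at h
      rw [h0 k l (by omega)]; simp

/-- The source of the constant: the Gaussian average of `exp(h x / 2)` contributes `1/8`, and `1/8 =
1/24 + 1/12`. -/
theorem fourierDilog_neg_one : fourierDilog (-1 : A) 0 =
    gexp (algebraMap ℚ A (1 / 24)) 0 * dilog (-1) := by
  rw [fourierDilog, dilog_zero, mul_one, fourierS_gexp, dilog_neg_one, gexp_mul]
  congr 1
  · rw [half, ← map_pow, ← map_add, mul_neg_one, neg_mul, neg_neg, ← map_mul]
    norm_num
  · ring

open LaurentPolynomial in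
-- For `d = (1 + T) T d/dT` on Laurent polynomials, the kernel is `ℚ`, because the ring is a domain
-- and `1 + T ≠ 0`. The unknown factor thus has rational coefficients, which are read off at `T =
-- -1`.
theorem fourierDilog_universal :
    fourierDilog (T 1 : LaurentPolynomial ℚ) (-T (-1) - 1) =
      gexp (algebraMap ℚ _ (1 / 24)) 0 * dilog (T 1) := by
  have huv : (T 1 : LaurentPolynomial ℚ) * T (-1) = 1 := by rw [← T_add]; simp
  have heu : euler (T 1) = T 1 := by
    have := eulerLin_monomial 1 1
    simp only [map_one, one_mul, Int.cast_one, one_smul] at this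
    exact this
  have hdu : ((1 + T 1 : LaurentPolynomial ℚ) • euler) (T 1) = T 1 + T 1 ^ 2 := by
    rw [Derivation.smul_apply, heu, smul_eq_mul]; ring
  obtain ⟨c, hc, h⟩ := fourierDilog_eq_mul _ huv rfl hdu
  have hne : (1 + T 1 : LaurentPolynomial ℚ) ≠ 0 := by
    intro h
    have := congrArg (fun p : LaurentPolynomial ℚ => p.coeff 1) h
    rw [← T_zero] at this
    change Finsupp.single (0 : ℤ) (1 : ℚ) 1 + Finsupp.single (1 : ℤ) (1 : ℚ) 1 = 0 at this
    rw [Finsupp.single_eq_of_ne one_ne_zero, Finsupp.single_eq_same] at this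
    norm_num at this
  have hc' : ∀ n, coeff n c = LaurentPolynomial.C ((coeff n c).coeff 0) := by
    intro n
    apply eq_C_of_euler_eq_zero
    have := hc n
    rw [Derivation.smul_apply, smul_eq_mul] at this
    exact (mul_eq_zero.1 this).resolve_left hne
  set f : LaurentPolynomial ℚ →+* ℚ := eval₂ (RingHom.id ℚ) (-1)
  have hf1 : f (T 1) = -1 := by simp [f]
  have hf2 : f (-T (-1) - 1) = 0 := by simp [f]
  have hcf : c = PowerSeries.map LaurentPolynomial.C (PowerSeries.map f c) := by
    ext1 n
    rw [coeff_map, coeff_map, hc' n]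
    simp [f]
  have h2 := congrArg (PowerSeries.map (Polynomial.mapRingHom f)) h
  rw [map_mul, map_fourierDilog, map_dilog, hf1, hf2, fourierDilog_neg_one] at h2
  obtain ⟨ψi, hψi⟩ : ∃ ψi, ψi * dilog (-1 : ℚ) = 1 :=
    ⟨_, fexp_neg_mul (constantCoeff_dilogExponent _)⟩
  have h3 : gexp (algebraMap ℚ ℚ (1 / 24)) 0 =
      PowerSeries.map (Polynomial.mapRingHom f) (PowerSeries.map Polynomial.C c) := by
    linear_combination ψi * h2 - (gexp (algebraMap ℚ ℚ (1 / 24)) 0 -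
      PowerSeries.map (Polynomial.mapRingHom f) (PowerSeries.map Polynomial.C c)) * hψi
  have h4 : PowerSeries.map Polynomial.C c = PowerSeries.map
      (Polynomial.mapRingHom LaurentPolynomial.C) (gexp (algebraMap ℚ ℚ (1 / 24)) 0) := by
    rw [h3, hcf]
    ext1 n
    simp [f]
  rw [h, h4, map_gexp, map_zero]
  rfl

/-- The Fourier transform of the series `ψ_h(x, z)`. -/
theorem fourierDilog_eq {u v u' : A} (huv : u * v = 1) (hu' : u' = -v - 1) :
    fourierDilog u u' = gexp (algebraMap ℚ A (1 / 24)) 0 * dilog u := by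
  -- An invertible `u` in a `ℚ`-algebra is the image of `T`, so the identity specialises from the
  -- universal case.
  let f : LaurentPolynomial ℚ →+* A := LaurentPolynomial.eval₂ (algebraMap ℚ A)
    ⟨u, v, huv, by rw [mul_comm, huv]⟩
  have hf1 : f (LaurentPolynomial.T 1) = u := by simp [f]
  have hf2 : f (-LaurentPolynomial.T (-1) - 1) = u' := by simp [f, hu']
  have h := congrArg (PowerSeries.map (Polynomial.mapRingHom f)) fourierDilog_universal
  rw [map_mul, map_fourierDilog, map_dilog, map_gexp, hf1, hf2, map_zero] at h
  rw [h]
  congr 2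
  exact RingHom.congr_fun (RingHom.ext_rat (f.comp (algebraMap ℚ _)) (algebraMap ℚ A)) _

end Universal

/-! ### Multivariate formal Gaussian integration, characterised by integration by parts -/

section GaussianIntegral

variable {ι K : Type*} [Fintype ι] [DecidableEq ι] [Field K] [CharZero K]

omit [Fintype ι] [CharZero K] in
theorem pderiv_comm (i j : ι) (p : MvPolynomial ι K) :
    MvPolynomial.pderiv i (MvPolynomial.pderiv j p) =
      MvPolynomial.pderiv j (MvPolynomial.pderiv i p) := by
  induction p using MvPolynomial.induction_on with
  | C a => simp
  | add p q hp hq => simp [hp, hq]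
  | mul_X p k hp =>
    simp only [Derivation.leibniz, MvPolynomial.pderiv_X, smul_eq_mul, map_add, hp, Pi.single_apply]
    split_ifs <;> simp <;> ring

omit [Fintype ι] [DecidableEq ι] [CharZero K] in
theorem totalDegree_pderiv_le (i : ι) (p : MvPolynomial ι K) :
    (MvPolynomial.pderiv i p).totalDegree ≤ p.totalDegree - 1 := by
  refine Finset.sup_le fun s hs => ?_
  rw [MvPolynomial.mem_support_iff, MvPolynomial.coeff_pderiv] at hs
  have h := MvPolynomial.le_totalDegree (MvPolynomial.mem_support_iff.2 (left_ne_zero_of_mul hs))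
  rw [Finsupp.sum_add_index' (fun _ => rfl) (fun _ _ _ => rfl), Finsupp.sum_single_index rfl] at h
  omega

omit [CharZero K] in
theorem gaussOp_apply (L : Matrix ι ι K) (p : MvPolynomial ι K) :
    gaussOp L p = (1 / 2 : K) • ∑ i, ∑ j, L⁻¹ i j •
      MvPolynomial.pderiv i (MvPolynomial.pderiv j p) := by
  simp [gaussOp, LinearMap.sum_apply]

omit [CharZero K] in
theorem totalDegree_gaussOp_le (L : Matrix ι ι K) (p : MvPolynomial ι K) :
    (gaussOp L p).totalDegree ≤ p.totalDegree - 1 := by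
  rw [gaussOp_apply]
  refine (MvPolynomial.totalDegree_smul_le _ _).trans ?_
  refine MvPolynomial.totalDegree_finsetSum_le fun i _ => ?_
  refine MvPolynomial.totalDegree_finsetSum_le fun j _ => ?_
  refine (MvPolynomial.totalDegree_smul_le _ _).trans ?_
  refine (totalDegree_pderiv_le _ _).trans ?_
  have := totalDegree_pderiv_le j p
  omega

omit [CharZero K] in
theorem gaussOp_pow_eq_zero (L : Matrix ι ι K) (m : ℕ) :
    ∀ p : MvPolynomial ι K, p.totalDegree < m → (gaussOp L ^ m) p = 0 := by
  induction m with
  | zero => intro p h; omega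
  | succ m ih =>
    intro p h
    rw [pow_succ, Module.End.mul_apply]
    by_cases h0 : p.totalDegree = 0
    · rw [MvPolynomial.totalDegree_eq_zero_iff_eq_C.1 h0, gaussOp_apply]
      simp
    · have := totalDegree_gaussOp_le L p
      exact ih _ (by omega)

omit [CharZero K] in
theorem gaussPoly_eq_sum (L : Matrix ι ι K) (p : MvPolynomial ι K) {N : ℕ}
    (hN : p.totalDegree < N) : gaussPoly L p = ∑ m ∈ Finset.range N,
      (1 / (m.factorial : K)) * MvPolynomial.constantCoeff ((gaussOp L ^ m) p) := by
  refine Finset.sum_subset (fun m hm => ?_) fun m _ hm => ?_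
  · rw [Finset.mem_range] at *; omega
  · rw [gaussOp_pow_eq_zero L m p (by rw [Finset.mem_range] at hm; omega)]
    simp

/-- `gaussPoly` as a linear form. -/
def gaussLin (L : Matrix ι ι K) : MvPolynomial ι K →ₗ[K] K where
  toFun := gaussPoly L
  map_add' p q := by
    set N := max (max p.totalDegree q.totalDegree) (p + q).totalDegree + 1
    rw [gaussPoly_eq_sum L p (N := N) (by omega), gaussPoly_eq_sum L q (N := N) (by omega),
      gaussPoly_eq_sum L (p + q) (N := N) (by omega), ← Finset.sum_add_distrib]
    simp [mul_add]
  map_smul' a p := by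
    set N := max p.totalDegree (a • p).totalDegree + 1
    rw [gaussPoly_eq_sum L p (N := N) (by omega),
      gaussPoly_eq_sum L (a • p) (N := N) (by omega), RingHom.id_apply, smul_eq_mul, Finset.mul_sum]
    refine Finset.sum_congr rfl fun m _ => ?_
    rw [map_smul, MvPolynomial.smul_eq_C_mul, map_mul, MvPolynomial.constantCoeff_C]; ring

theorem gaussLin_apply (L : Matrix ι ι K) (p : MvPolynomial ι K) :
    gaussLin L p = gaussPoly L p := rfl

theorem gaussLin_C (L : Matrix ι ι K) (a : K) : gaussLin L (MvPolynomial.C a) = a := by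
  simp [gaussLin_apply, gaussPoly]

/-- The first order operator `∑_j (L⁻¹)_{ij} ∂_j`. -/
def gradOp (L : Matrix ι ι K) (i : ι) : MvPolynomial ι K →ₗ[K] MvPolynomial ι K :=
  ∑ j, L⁻¹ i j • (MvPolynomial.pderiv j :
    Derivation K (MvPolynomial ι K) (MvPolynomial ι K)).toLinearMap

omit [CharZero K] in
theorem gradOp_apply (L : Matrix ι ι K) (i : ι) (p : MvPolynomial ι K) :
    gradOp L i p = ∑ j, L⁻¹ i j • MvPolynomial.pderiv j p := by
  simp [gradOp, LinearMap.sum_apply]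

omit [CharZero K] in
theorem gradOp_gaussOp (L : Matrix ι ι K) (i : ι) (p : MvPolynomial ι K) :
    gradOp L i (gaussOp L p) = gaussOp L (gradOp L i p) := by
  have h : ∀ k (p : MvPolynomial ι K), MvPolynomial.pderiv k (gaussOp L p) =
      gaussOp L (MvPolynomial.pderiv k p) := by
    intro k p
    simp only [gaussOp_apply, Derivation.map_smul, map_sum, pderiv_comm k]
  simp only [gradOp_apply, map_sum, map_smul, h]

/-- The commutator of the second order operator with multiplication by `x_i` is `gradOp L i`;
symmetry of `L⁻¹` merges the two cross terms and absorbs the factor `1/2`. -/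
theorem gaussOp_X_mul {L : Matrix ι ι K} (hL : L.IsSymm) (i : ι) (p : MvPolynomial ι K) :
    gaussOp L (MvPolynomial.X i * p) = MvPolynomial.X i * gaussOp L p + gradOp L i p := by
  have hs : ∀ a b, L⁻¹ a b = L⁻¹ b a := fun a b => by
    rw [← Matrix.transpose_apply L⁻¹, Matrix.transpose_nonsing_inv, hL.eq]
  have h0 : ∀ b (p : MvPolynomial ι K), MvPolynomial.pderiv b (MvPolynomial.X i * p) =
      MvPolynomial.X i * MvPolynomial.pderiv b p + if b = i then p else 0 := by
    intro b p
    rw [MvPolynomial.pderiv_mul, MvPolynomial.pderiv_X, Pi.single_apply]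
    by_cases hb : b = i
    · simp [hb, add_comm]
    · simp [hb, Ne.symm hb]
  have h1 : ∀ a b, MvPolynomial.pderiv a (MvPolynomial.pderiv b (MvPolynomial.X i * p)) =
      MvPolynomial.X i * MvPolynomial.pderiv a (MvPolynomial.pderiv b p) +
      ((if a = i then MvPolynomial.pderiv b p else 0) +
        (if b = i then MvPolynomial.pderiv a p else 0)) := by
    intro a b
    rw [h0, map_add, h0, add_assoc, apply_ite (MvPolynomial.pderiv a), map_zero]
  rw [gaussOp_apply, gaussOp_apply, gradOp_apply]
  simp only [h1, smul_add, Finset.sum_add_distrib, smul_ite, smul_zero]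
  rw [Finset.sum_comm (f := fun a b => if a = i then L⁻¹ a b • MvPolynomial.pderiv b p else 0)]
  simp only [Finset.sum_ite_eq', Finset.mem_univ, if_true]
  have h2 : ∀ a, L⁻¹ a i • MvPolynomial.pderiv a p = L⁻¹ i a • MvPolynomial.pderiv a p :=
    fun a => by rw [hs]
  simp only [h2, ← add_assoc, Finset.mul_sum, mul_smul_comm]
  rw [add_assoc, ← smul_add, ← two_smul K, smul_smul]
  norm_num

theorem gaussOp_pow_X_mul {L : Matrix ι ι K} (hL : L.IsSymm) (i : ι) (m : ℕ)
    (p : MvPolynomial ι K) :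
    (gaussOp L ^ (m + 1)) (MvPolynomial.X i * p) = MvPolynomial.X i * (gaussOp L ^ (m + 1)) p +
      ((m + 1 : ℕ) : K) • (gaussOp L ^ m) (gradOp L i p) := by
  induction m generalizing p with
  | zero => simp [gaussOp_X_mul hL]
  | succ m ih =>
    rw [pow_succ, Module.End.mul_apply, gaussOp_X_mul hL, map_add, ih, gradOp_gaussOp,
      ← Module.End.mul_apply, ← Module.End.mul_apply, ← pow_succ, ← pow_succ, add_assoc,
      Nat.cast_succ (m + 1), add_smul, one_smul]

theorem gaussLin_X_mul {L : Matrix ι ι K} (hL : L.IsSymm) (i : ι) (p : MvPolynomial ι K) :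
    gaussLin L (MvPolynomial.X i * p) = ∑ j, L⁻¹ i j * gaussLin L (MvPolynomial.pderiv j p) := by
  have h1 : ∑ j, L⁻¹ i j * gaussLin L (MvPolynomial.pderiv j p) = gaussLin L (gradOp L i p) := by
    rw [gradOp_apply, map_sum]; simp
  rw [h1, gaussLin_apply, gaussLin_apply]
  set N := max (MvPolynomial.X i * p).totalDegree (gradOp L i p).totalDegree + 1
  -- The left sum gets one more term: its term `m = 0` dies at `x = 0`, and afterwards `(m + 1) / (m
  -- + 1)! = 1 / m!` matches the two sums.
  rw [gaussPoly_eq_sum L _ (N := N + 1) (by omega), gaussPoly_eq_sum L _ (N := N) (by omega),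
    Finset.sum_range_succ']
  simp only [pow_zero, Module.End.one_apply, map_mul, MvPolynomial.constantCoeff_X, zero_mul,
    mul_zero, add_zero]
  refine Finset.sum_congr rfl fun m _ => ?_
  rw [gaussOp_pow_X_mul hL, map_add, map_mul, MvPolynomial.constantCoeff_X, zero_mul, zero_add,
    MvPolynomial.smul_eq_C_mul, map_mul, MvPolynomial.constantCoeff_C, ← mul_assoc]
  congr 1
  have : ((m + 1 : ℕ) : K) ≠ 0 := by exact_mod_cast Nat.succ_ne_zero m
  have : (m.factorial : K) ≠ 0 := by exact_mod_cast m.factorial_ne_zero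
  rw [Nat.factorial_succ, Nat.cast_mul]
  field_simp

theorem gaussLin_pderiv {L : Matrix ι ι K} (hL : L.IsSymm) (hdet : L.det ≠ 0) (i : ι)
    (p : MvPolynomial ι K) :
    gaussLin L (MvPolynomial.pderiv i p) = ∑ k, L i k * gaussLin L (MvPolynomial.X k * p) := by
  simp only [gaussLin_X_mul hL]
  have h := Matrix.mul_nonsing_inv L (isUnit_iff_ne_zero.2 hdet)
  have := congrFun (Matrix.mulVec_mulVec (fun j => gaussLin L (MvPolynomial.pderiv j p)) L L⁻¹) i
  rw [h, Matrix.one_mulVec] at this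
  rw [← this]
  rfl

/-- The partial derivative `∂_i` on `K[x]⟦h⟧`. -/
def mdx (i : ι) : PowerSeries (MvPolynomial ι K) →+ PowerSeries (MvPolynomial ι K) :=
  cmap (MvPolynomial.pderiv i : Derivation K (MvPolynomial ι K) _).toLinearMap.toAddMonoidHom

/-- The variable `x_i` in `K[x]⟦h⟧`. -/
def mx (i : ι) : PowerSeries (MvPolynomial ι K) := C (MvPolynomial.X i)

/-- The inclusion of `K⟦h⟧` in `K[x]⟦h⟧`. -/
def scal : PowerSeries K →+* PowerSeries (MvPolynomial ι K) := PowerSeries.map MvPolynomial.C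

omit [Fintype ι] [DecidableEq ι] [CharZero K] in
@[simp] theorem coeff_mdx (i : ι) (F : PowerSeries (MvPolynomial ι K)) (n : ℕ) :
    coeff n (mdx i F) = MvPolynomial.pderiv i (coeff n F) := by simp [mdx]

omit [Fintype ι] [DecidableEq ι] [CharZero K] in
theorem mdx_mul (i : ι) (F G : PowerSeries (MvPolynomial ι K)) :
    mdx i (F * G) = F * mdx i G + G * mdx i F :=
  cmap_leibniz _ (fun a b => by simp [Derivation.leibniz]) F G

/-- Formal Gaussian integration with a linear exponential weight, characterized up to scaling by
integration by parts. -/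
structure GaussLike (L : Matrix ι ι K) (b : ι → K)
    (W : PowerSeries (MvPolynomial ι K) →+ PowerSeries K) : Prop where
  scal_mul : ∀ s F, W (scal s * F) = s * W F
  mdx_eq : ∀ i F, W (mdx i F) = ∑ k, C (L i k) * W (mx k * F) - X * C (b i) * W F

/-- `gauss` as an additive map. -/
def gaussAdd (L : Matrix ι ι K) : PowerSeries (MvPolynomial ι K) →+ PowerSeries K :=
  cmap (gaussLin L).toAddMonoidHom

theorem gauss_eq (L : Matrix ι ι K) (F : PowerSeries (MvPolynomial ι K)) :
    gauss L F = gaussAdd L F := rfl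

theorem gaussLike_gaussAdd {L : Matrix ι ι K} (hL : L.IsSymm) (hdet : L.det ≠ 0) :
    GaussLike L 0 (gaussAdd L) where
  scal_mul s F := by
    have := cmap_mul_of_semilinear MvPolynomial.C (RingHom.id K) (gaussLin L).toAddMonoidHom
      (fun a r => by simp [← MvPolynomial.smul_eq_C_mul]) s F
    rwa [PowerSeries.map_id] at this
  mdx_eq i F := by
    ext n
    simp [gaussAdd, gaussLin_pderiv hL hdet, mx, coeff_C_mul]

omit [CharZero K] in
-- Induction on the degree of monomials: integration by parts expresses `L` applied to the vector of
-- values `W (x_k m)` through values on lower degree, and `L` is invertible.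
theorem GaussLike.eq_zero {L : Matrix ι ι K} {b : ι → K} (hdet : L.det ≠ 0)
    {W : PowerSeries (MvPolynomial ι K) →+ PowerSeries K} (hW : GaussLike L b W) (h1 : W 1 = 0)
    (F : PowerSeries (MvPolynomial ι K)) : W F = 0 := by
  have hX : ∀ F, W (X * F) = X * W F := fun F => by
    have := hW.scal_mul X F
    rwa [scal, map_X] at this
  have hmon : ∀ n (s : ι →₀ ℕ) (a : K), s.degree = n → W (C (MvPolynomial.monomial s a)) = 0 := by
    intro n
    induction n using Nat.strong_induction_on with
    | _ n ih =>
      intro s a hs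
      by_cases h0 : s = 0
      · subst h0
        have := hW.scal_mul (C a) 1
        rw [h1, mul_zero, mul_one, scal, map_C] at this
        exact this
      · obtain ⟨k, hk⟩ : ∃ k, s k ≠ 0 := by
          by_contra! h; exact h0 (Finsupp.ext h)
        obtain ⟨t, rfl⟩ : ∃ t, s = Finsupp.single k 1 + t :=
          ⟨s - Finsupp.single k 1, by
            rw [add_tsub_cancel_of_le]
            rw [Finsupp.single_le_iff]; omega⟩
        rw [map_add, Finsupp.degree_single] at hs
        have key : ∀ i, ∑ k, C (L i k) * W (mx k * C (MvPolynomial.monomial t a)) = 0 := by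
          intro i
          have h2 := hW.mdx_eq i (C (MvPolynomial.monomial t a))
          rw [ih t.degree (by omega) t a rfl, mul_zero, sub_zero] at h2
          rw [← h2, mdx, cmap_C]
          change W (C (MvPolynomial.pderiv i (MvPolynomial.monomial t a))) = 0
          rw [MvPolynomial.pderiv_monomial]
          refine ih (t - Finsupp.single i 1).degree ?_ _ _ rfl
          have : (t - Finsupp.single i 1).degree ≤ t.degree := Finsupp.degree_mono tsub_le_self
          omega
        have h3 : MvPolynomial.monomial (Finsupp.single k 1 + t) a =
            MvPolynomial.X k * MvPolynomial.monomial t a := by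
          rw [MvPolynomial.X, MvPolynomial.monomial_mul, one_mul]
        rw [h3, map_mul]
        change W (mx k * _) = 0
        ext n
        have h4 : L *ᵥ (fun k => coeff n (W (mx k * C (MvPolynomial.monomial t a)))) = 0 := by
          ext i
          have := congrArg (coeff n) (key i)
          simpa [Matrix.mulVec, dotProduct] using this
        exact congrFun (Matrix.eq_zero_of_mulVec_eq_zero hdet h4) k
  refine hlin_eq_zero W hX (fun p => ?_) F
  induction p using MvPolynomial.induction_on' with
  | monomial s a => exact hmon _ s a rfl
  | add p q hp hq => rw [map_add, map_add, hp, hq, add_zero]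

omit [CharZero K] in
theorem GaussLike.eq_mul {L : Matrix ι ι K} {b : ι → K} (hdet : L.det ≠ 0)
    {W₁ W₂ : PowerSeries (MvPolynomial ι K) →+ PowerSeries K} (h₁ : GaussLike L b W₁)
    (h₂ : GaussLike L b W₂) {s : PowerSeries K} (h1 : W₁ 1 = s * W₂ 1)
    (F : PowerSeries (MvPolynomial ι K)) : W₁ F = s * W₂ F := by
  have h : GaussLike L b (W₁ - (AddMonoidHom.mulLeft s).comp W₂) := by
    refine ⟨fun t F => ?_, fun i F => ?_⟩
    · simp [h₁.scal_mul, h₂.scal_mul]; ring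
    · simp only [AddMonoidHom.sub_apply, AddMonoidHom.comp_apply, AddMonoidHom.coe_mulLeft,
        h₁.mdx_eq, h₂.mdx_eq, mul_sub, Finset.mul_sum, Finset.sum_sub_distrib]
      have : ∀ k, s * (C (L i k) * W₂ (mx k * F)) = C (L i k) * (s * W₂ (mx k * F)) :=
        fun k => by ring
      simp only [this]
      ring
  have := h.eq_zero hdet (by simp [h1]) F
  simpa [sub_eq_zero] using this

/-- The series `exp(h ∑ c_i x_i)`. -/
def linExp (c : ι → K) : PowerSeries (MvPolynomial ι K) :=
  fexp (X * C (∑ i, MvPolynomial.C (c i) * MvPolynomial.X i))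

theorem mdx_linExp (c : ι → K) (i : ι) : mdx i (linExp c) = X * scal (C (c i)) * linExp c := by
  have h := cmap_fexp (MvPolynomial.pderiv i :
    Derivation K (MvPolynomial ι K) _).toLinearMap.toAddMonoidHom
    (fun a b => by simp [Derivation.leibniz])
    (F := X * C (∑ i, MvPolynomial.C (c i) * MvPolynomial.X i)) (by simp)
  rw [linExp, mdx, h, cmap_X_mul, cmap_C, mul_comm]
  congr 2
  rw [scal, map_C]
  congr 1
  simp [MvPolynomial.pderiv_X, Pi.single_apply]

/-- Leibniz rule for the inserted exponential; the linear weights add. -/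
theorem GaussLike.linExp_mul {L : Matrix ι ι K} {b : ι → K}
    {W : PowerSeries (MvPolynomial ι K) →+ PowerSeries K} (hW : GaussLike L b W) (c : ι → K) :
    GaussLike L (b + c) (W.comp (AddMonoidHom.mulLeft (linExp c))) where
  scal_mul s F := by
    simp [mul_left_comm _ (scal s), hW.scal_mul]
  mdx_eq i F := by
    have h := hW.mdx_eq i (linExp c * F)
    have h2 : F * (X * scal (C (c i)) * linExp c) = scal (X * C (c i)) * (linExp c * F) := by
      rw [map_mul, scal, map_X]; ring
    rw [mdx_mul, mdx_linExp, map_add, h2, hW.scal_mul] at h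
    simp only [AddMonoidHom.comp_apply, AddMonoidHom.coe_mulLeft, mul_left_comm (linExp c),
      Pi.add_apply, map_add]
    linear_combination h

theorem gaussAdd_linExp {L : Matrix ι ι K} (hL : L.IsSymm) (hdet : L.det ≠ 0) {c v : ι → K}
    (hv : L *ᵥ v = c) :
    gaussAdd L (linExp c) = fexp (C (half K * (c ⬝ᵥ v)) * X ^ 2) := by
  have hG := gaussLike_gaussAdd hL hdet
  have h0 : constantCoeff (X * C (∑ i, MvPolynomial.C (c i) * MvPolynomial.X i) :
    PowerSeries (MvPolynomial ι K)) = 0 := by simp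
  have hx : ∀ k, gaussAdd L (mx k * linExp c) = X * C (v k) * gaussAdd L (linExp c) := by
    intro k
    rw [← sub_eq_zero]
    ext n
    -- Integration by parts applied to `linExp c` gives `∑ L i k ⟨x_k e⟩ = h c_i ⟨e⟩`, where `e` is
    -- `linExp c`; inverting `L` gives `⟨x_k e⟩ = h v_k ⟨e⟩`, the input for the differential
    -- equation in `h`.
    have h4 : L *ᵥ (fun k => coeff n (gaussAdd L (mx k * linExp c) -
        X * C (v k) * gaussAdd L (linExp c))) = 0 := by
      ext i
      have h := hG.mdx_eq i (linExp c)
      rw [mdx_linExp, show X * scal (C (c i)) = scal (ι := ι) (X * C (c i)) by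
        rw [map_mul, scal, map_X], hG.scal_mul] at h
      have h5 : X * C (c i) * gaussAdd L (linExp c) =
          ∑ k, C (L i k) * (X * C (v k) * gaussAdd L (linExp c)) := by
        rw [← hv]
        simp only [Matrix.mulVec, dotProduct, map_sum, map_mul, Finset.mul_sum, Finset.sum_mul]
        refine Finset.sum_congr rfl fun k _ => by ring
      rw [h5] at h
      simp only [Pi.zero_apply, map_zero, mul_zero, zero_mul, sub_zero] at h
      have h6 := congrArg (coeff n) h
      simp only [map_sum, coeff_C_mul] at h6
      simp only [Matrix.mulVec, dotProduct, map_sub, mul_sub, Finset.sum_sub_distrib, h6, sub_self,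
        Pi.zero_apply]
    exact congrFun (Matrix.eq_zero_of_mulVec_eq_zero hdet h4) k
  refine eq_of_ode (A := X * C (c ⬝ᵥ v)) ?_ ?_ ?_
  · rw [constantCoeff_fexp (by simp), ← coeff_zero_eq_constantCoeff_apply, gaussAdd, coeff_cmap,
      coeff_zero_eq_constantCoeff_apply, linExp, constantCoeff_fexp h0]
    exact gaussLin_C L 1
  · rw [gaussAdd, derivative_cmap, ← gaussAdd]
    conv_lhs => rw [linExp, derivative_fexp h0, ← linExp]
    have : linExp c * d⁄dX (MvPolynomial ι K)
        (X * C (∑ i, MvPolynomial.C (c i) * MvPolynomial.X i)) =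
        ∑ i, scal (C (c i)) * (mx i * linExp c) := by
      rw [Derivation.leibniz, derivative_C, derivative_X]
      simp [scal, mx, Finset.mul_sum]
      refine Finset.sum_congr rfl fun k _ => by ring
    rw [this, map_sum]
    simp only [hG.scal_mul, hx, dotProduct, map_sum, map_mul, Finset.mul_sum]
    refine Finset.sum_congr rfl fun k _ => by ring
  · rw [derivative_fexp (by simp)]
    congr 1
    have := half_mul_two K
    rw [Derivation.leibniz, derivative_C, Derivation.leibniz_pow, derivative_X]
    have h2 : (C (half K) * 2 : PowerSeries K) = 1 := by
      rw [← map_ofNat C 2, ← map_mul, this, map_one]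
    simp only [map_mul, smul_eq_mul, nsmul_eq_mul, mul_zero, add_zero]
    push_cast
    simp only [pow_one, mul_one]
    linear_combination X * C (c ⬝ᵥ v) * h2

end GaussianIntegral

/-! ### Fourier transform in one variable under the Gaussian integral, and the pivot of the form -/

section FourierAt

variable {ι K : Type*} [DecidableEq ι] [Field K]

/-- The operator `fourier u` in the variable `x_j`. -/
def fourierAt (j : ι) (u : K) : MvPolynomial ι K →ₗ[K] MvPolynomial ι K :=
  (MvPolynomial.basisMonomials ι K).constr K fun s =>
    MvPolynomial.monomial (s.erase j) 1 *
      Polynomial.aeval (MvPolynomial.X j) (fourier u (Polynomial.X ^ s j))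

omit [DecidableEq ι] in
theorem fourierAt_monomial (j : ι) (u : K) (s : ι →₀ ℕ) :
    fourierAt j u (MvPolynomial.monomial s 1) = MvPolynomial.monomial (s.erase j) 1 *
      Polynomial.aeval (MvPolynomial.X j) (fourier u (Polynomial.X ^ s j)) := by
  have := (MvPolynomial.basisMonomials ι K).constr_basis K (fun s =>
    MvPolynomial.monomial (s.erase j) (1 : K) *
      Polynomial.aeval (MvPolynomial.X j : MvPolynomial ι K) (fourier u (Polynomial.X ^ s j))) s
  rwa [MvPolynomial.coe_basisMonomials] at this

omit [DecidableEq ι] in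
theorem pderiv_aeval_X (j : ι) (q : Polynomial K) :
    MvPolynomial.pderiv j (Polynomial.aeval (MvPolynomial.X j : MvPolynomial ι K) q) =
      Polynomial.aeval (MvPolynomial.X j) (Polynomial.derivative q) := by
  rw [Derivation.comp_aeval_eq, MvPolynomial.pderiv_X_self, smul_eq_mul, mul_one]

omit [DecidableEq ι] in
theorem fourierAt_C_mul (j : ι) (u a : K) (p : MvPolynomial ι K) :
    fourierAt j u (MvPolynomial.C a * p) = MvPolynomial.C a * fourierAt j u p := by
  rw [← MvPolynomial.smul_eq_C_mul, map_smul, MvPolynomial.smul_eq_C_mul]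

omit [DecidableEq ι] in
theorem fourierAt_one (j : ι) (u : K) : fourierAt j u 1 = 1 := by
  have := fourierAt_monomial j u (0 : ι →₀ ℕ)
  have h := fourier_C u 1
  rw [map_one] at h
  simpa [h] using this

omit [DecidableEq ι] in
theorem mvPoly_linear_ind {T₁ T₂ : MvPolynomial ι K →ₗ[K] MvPolynomial ι K}
    (h : ∀ s, T₁ (MvPolynomial.monomial s 1) = T₂ (MvPolynomial.monomial s 1))
    (p : MvPolynomial ι K) : T₁ p = T₂ p := by
  have : T₁ = T₂ := (MvPolynomial.basisMonomials ι K).ext fun s => by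
    simpa using h s
  rw [this]

omit [DecidableEq ι] in
theorem fourierAt_X_mul_of_ne {i j : ι} (hij : i ≠ j) (u : K) (p : MvPolynomial ι K) :
    fourierAt j u (MvPolynomial.X i * p) = MvPolynomial.X i * fourierAt j u p := by
  refine mvPoly_linear_ind
    (T₁ := (fourierAt j u).comp (LinearMap.mulLeft K (MvPolynomial.X i)))
    (T₂ := (LinearMap.mulLeft K (MvPolynomial.X i)).comp (fourierAt j u)) (fun s => ?_) p
  simp only [LinearMap.comp_apply, LinearMap.mulLeft_apply]
  have h : ∀ t : ι →₀ ℕ, (MvPolynomial.X i * MvPolynomial.monomial t 1 : MvPolynomial ι K) =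
      MvPolynomial.monomial (Finsupp.single i 1 + t) 1 := fun t => by
    rw [MvPolynomial.X, MvPolynomial.monomial_mul, one_mul]
  rw [h, fourierAt_monomial, fourierAt_monomial, ← mul_assoc, h]
  congr 3
  · rw [Finsupp.erase_add, Finsupp.erase_single_ne hij.symm]
  · simp [hij]

omit [DecidableEq ι] in
theorem fourierAt_X_mul (j : ι) (u : K) (p : MvPolynomial ι K) :
    fourierAt j u (MvPolynomial.X j * p) =
      MvPolynomial.C u * (MvPolynomial.X j * fourierAt j u p) -
        MvPolynomial.pderiv j (fourierAt j u p) := by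
  rw [← MvPolynomial.smul_eq_C_mul]
  refine mvPoly_linear_ind
    (T₁ := (fourierAt j u).comp (LinearMap.mulLeft K (MvPolynomial.X j)))
    (T₂ := (u • (LinearMap.mulLeft K (MvPolynomial.X j)) - (MvPolynomial.pderiv j :
      Derivation K (MvPolynomial ι K) _).toLinearMap).comp (fourierAt j u)) (fun s => ?_) p
  have h : (MvPolynomial.X j * MvPolynomial.monomial s 1 : MvPolynomial ι K) =
      MvPolynomial.monomial (Finsupp.single j 1 + s) 1 := by
    rw [MvPolynomial.X, MvPolynomial.monomial_mul, one_mul]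
  have h2 : (Finsupp.single j 1 + s).erase j = s.erase j := by
    rw [Finsupp.erase_add, Finsupp.erase_single, zero_add]
  have h3 : (Finsupp.single j 1 + s : ι →₀ ℕ) j = s j + 1 := by simp [add_comm]
  have h4 : MvPolynomial.pderiv j (MvPolynomial.monomial (s.erase j) (1 : K)) = 0 := by
    rw [MvPolynomial.pderiv_monomial]; simp
  simp only [LinearMap.comp_apply, LinearMap.mulLeft_apply, LinearMap.sub_apply,
    LinearMap.smul_apply, Derivation.coeFn_coe]
  rw [h, fourierAt_monomial, fourierAt_monomial, h2, h3, pow_succ', fourier_X_mul,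
    MvPolynomial.pderiv_mul, h4, pderiv_aeval_X, MvPolynomial.smul_eq_C_mul]
  simp only [map_sub, map_mul, Polynomial.aeval_X, Polynomial.aeval_C,
    MvPolynomial.algebraMap_eq]
  ring

omit [DecidableEq ι] in
theorem mvPoly_ind {P : MvPolynomial ι K → Prop} (hC : ∀ a, P (MvPolynomial.C a))
    (hadd : ∀ p q, P p → P q → P (p + q)) (hX : ∀ i p, P p → P (MvPolynomial.X i * p))
    (p : MvPolynomial ι K) : P p := by
  induction p using MvPolynomial.induction_on with
  | C a => exact hC a
  | add p q hp hq => exact hadd p q hp hq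
  | mul_X p i hp => rw [mul_comm]; exact hX i p hp

omit [DecidableEq ι] in
theorem fourierAt_C (j : ι) (u a : K) :
    fourierAt j u (MvPolynomial.C a) = MvPolynomial.C a := by
  simpa [fourierAt_one] using fourierAt_C_mul j u a 1

theorem pderiv_fourierAt_of_ne {i j : ι} (hij : i ≠ j) (u : K) (p : MvPolynomial ι K) :
    MvPolynomial.pderiv i (fourierAt j u p) = fourierAt j u (MvPolynomial.pderiv i p) := by
  induction p using mvPoly_ind with
  | hC a => simp [fourierAt_C]
  | hadd p q hp hq => simp [hp, hq]
  | hX k p hp =>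
    by_cases hk : k = j
    · subst hk
      rw [fourierAt_X_mul, map_sub, MvPolynomial.pderiv_mul, MvPolynomial.pderiv_mul,
        MvPolynomial.pderiv_mul, MvPolynomial.pderiv_C, MvPolynomial.pderiv_X_of_ne hij.symm,
        pderiv_comm, hp, zero_mul, zero_mul, zero_mul, zero_add, zero_add, zero_add,
        fourierAt_X_mul]
    · rw [fourierAt_X_mul_of_ne hk, MvPolynomial.pderiv_mul, MvPolynomial.pderiv_mul, map_add,
        fourierAt_X_mul_of_ne hk, hp]
      congr 1
      by_cases hki : k = i
      · subst hki; simp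
      · simp [MvPolynomial.pderiv_X_of_ne hki]

theorem pderiv_fourierAt (j : ι) (u : K) (p : MvPolynomial ι K) :
    MvPolynomial.pderiv j (fourierAt j u p) =
      MvPolynomial.C u * fourierAt j u (MvPolynomial.pderiv j p) := by
  induction p using mvPoly_ind with
  | hC a => simp [fourierAt_C]
  | hadd p q hp hq => simp [hp, hq, mul_add]
  | hX k p hp =>
    by_cases hk : k = j
    · subst hk
      simp only [MvPolynomial.pderiv_mul, MvPolynomial.pderiv_X_self, one_mul, map_add,
        fourierAt_X_mul, map_sub, MvPolynomial.pderiv_C, zero_mul, zero_add, hp]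
      ring
    · rw [fourierAt_X_mul_of_ne hk, MvPolynomial.pderiv_mul, MvPolynomial.pderiv_mul,
        MvPolynomial.pderiv_X_of_ne hk, zero_mul, zero_mul, zero_add, zero_add,
        fourierAt_X_mul_of_ne hk, hp]
      ring

/-- The coefficientwise extension of `fourierAt`. -/
def fourierAtS (j : ι) (u : K) :
    PowerSeries (MvPolynomial ι K) →+ PowerSeries (MvPolynomial ι K) :=
  cmap (fourierAt j u).toAddMonoidHom

omit [DecidableEq ι] in
@[simp] theorem coeff_fourierAtS (j : ι) (u : K) (F : PowerSeries (MvPolynomial ι K)) (n : ℕ) :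
    coeff n (fourierAtS j u F) = fourierAt j u (coeff n F) := by simp [fourierAtS]

omit [DecidableEq ι] in
@[simp] theorem coeff_mx_mul (i : ι) (F : PowerSeries (MvPolynomial ι K)) (n : ℕ) :
    coeff n (mx i * F) = MvPolynomial.X i * coeff n F := by simp [mx]

omit [DecidableEq ι] in
theorem fourierAtS_scal_mul (j : ι) (u : K) (s : PowerSeries K)
    (F : PowerSeries (MvPolynomial ι K)) :
    fourierAtS j u (scal s * F) = scal s * fourierAtS j u F :=
  cmap_mul_of_semilinear MvPolynomial.C MvPolynomial.C _ (fourierAt_C_mul j u) s F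

omit [DecidableEq ι] in
theorem fourierAtS_mx_mul_of_ne {i j : ι} (hij : i ≠ j) (u : K)
    (F : PowerSeries (MvPolynomial ι K)) :
    fourierAtS j u (mx i * F) = mx i * fourierAtS j u F := by
  ext1 n; simp [fourierAt_X_mul_of_ne hij]

omit [DecidableEq ι] in
theorem fourierAtS_mx_mul (j : ι) (u : K) (F : PowerSeries (MvPolynomial ι K)) :
    fourierAtS j u (mx j * F) =
      scal (C u) * (mx j * fourierAtS j u F) - mdx j (fourierAtS j u F) := by
  ext1 n
  rw [coeff_fourierAtS, coeff_mx_mul, fourierAt_X_mul, map_sub, scal, map_C, coeff_C_mul,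
    coeff_mx_mul, coeff_mdx, coeff_fourierAtS]

theorem mdx_fourierAtS_of_ne {i j : ι} (hij : i ≠ j) (u : K)
    (F : PowerSeries (MvPolynomial ι K)) :
    mdx i (fourierAtS j u F) = fourierAtS j u (mdx i F) := by
  ext1 n; simp [pderiv_fourierAt_of_ne hij]

theorem mdx_fourierAtS (j : ι) (u : K) (F : PowerSeries (MvPolynomial ι K)) :
    mdx j (fourierAtS j u F) = scal (C u) * fourierAtS j u (mdx j F) := by
  ext1 n; simp [pderiv_fourierAt, scal]

omit [DecidableEq ι] in
theorem fourierAtS_one (j : ι) (u : K) : fourierAtS j u 1 = 1 := by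
  have := cmap_C (fourierAt j u).toAddMonoidHom 1
  rw [map_one] at this
  rw [fourierAtS, this]
  exact (congrArg C (fourierAt_one j u)).trans (map_one C)

/-- The effect on a quadratic form of the Fourier transform in the variable `x_j`. -/
def pivotForm (L : Matrix ι ι K) (j : ι) (u : K) : Matrix ι ι K :=
  Matrix.of fun i k =>
    if i = j then (if k = j then 1 / (u - L j j) - 1 / u else L j k / (u - L j j))
    else if k = j then L i j / (u - L j j) else L i k + L i j * L j k / (u - L j j)

/-- The effect on a linear form of the Fourier transform in the variable `x_j`. -/
def pivotVec (L : Matrix ι ι K) (j : ι) (u β : K) : ι → K := fun i =>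
  (if i = j then 1 else L i j) * (β / (u - L j j))

variable [Fintype ι]

theorem sum_pivot (j : ι) {M : Type*} [AddCommMonoid M] (f : ι → M) :
    ∑ k, f k = f j + ∑ k ∈ Finset.univ.erase j, f k :=
  (Finset.add_sum_erase _ _ (Finset.mem_univ j)).symm

/-- Formal counterpart of a change of variables. With `t = y + u x_j`, the weight in `x_j` and `t`
is `exp((t - u x_j)^2 / (2u))` times the old one, and integrating out `x_j` completes a square with
pivot `L j j - u`, giving `pivotForm` and `pivotVec`. The proof checks integration by parts for the
composite. -/
theorem GaussLike.comp_fourierAtS {L : Matrix ι ι K} {j : ι} {u β : K} (hu : u ≠ 0)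
    (hp : u - L j j ≠ 0) {W : PowerSeries (MvPolynomial ι K) →+ PowerSeries K}
    (hW : GaussLike L (Pi.single j β) W) :
    GaussLike (pivotForm L j u) (pivotVec L j u β) (W.comp (fourierAtS j u)) where
  scal_mul s F := by
    simp [fourierAtS_scal_mul, hW.scal_mul]
  mdx_eq i F := by
    simp only [AddMonoidHom.comp_apply]
    set G := fourierAtS j u F with hG
    -- the integral of `x_j` times the transform
    set I := W (mx j * G) with hI
    set S : ι → PowerSeries K := fun i => ∑ k ∈ Finset.univ.erase j,
      C (L i k) * W (mx k * G) with hS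
    set p := u - L j j with hpdef
    have hne : ∀ k ∈ Finset.univ.erase j, W (fourierAtS j u (mx k * F)) = W (mx k * G) := by
      intro k hk
      rw [fourierAtS_mx_mul_of_ne (Finset.ne_of_mem_erase hk)]
    have hXj : W (fourierAtS j u (mx j * F)) = C u * I - W (mdx j G) := by
      rw [fourierAtS_mx_mul, map_sub, hW.scal_mul]
    have hdj : W (mdx j G) = C (L j j) * I + S j - X * C β * W G := by
      rw [hW.mdx_eq, sum_pivot j, Pi.single_eq_same]
    have cu : C u * C (1 / u) = (1 : PowerSeries K) := by
      rw [← map_mul, mul_one_div_cancel hu, map_one]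
    have cp : (C u - C (L j j)) * C (1 / p) = (1 : PowerSeries K) := by
      rw [← map_sub, ← map_mul, mul_one_div_cancel hp, map_one]
    -- Elimination of the old variable `x_j`: the two preceding relations are solved for its
    -- integral, with denominator `u - L j j`.
    have hI2 : I = C (1 / p) * (W (fourierAtS j u (mx j * F)) + S j - X * C β * W G) := by
      rw [hXj, hdj]
      linear_combination -I * cp
    by_cases hi : i = j
    · subst hi
      have h1 : W (fourierAtS i u (mdx i F)) = C (1 / u) * W (mdx i G) := by
        rw [hG, mdx_fourierAtS, hW.scal_mul]
        linear_combination -W (fourierAtS i u (mdx i F)) * cu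
      have h2 : ∑ k, C (pivotForm L i u i k) * W (fourierAtS i u (mx k * F)) =
          (C (1 / p) - C (1 / u)) * W (fourierAtS i u (mx i * F)) + C (1 / p) * S i := by
        rw [sum_pivot i]
        congr 1
        · simp [pivotForm, hpdef]
        · rw [hS, Finset.mul_sum]
          refine Finset.sum_congr rfl fun k hk => ?_
          rw [hne k hk, ← mul_assoc, ← map_mul]
          congr 2
          simp [pivotForm, Finset.ne_of_mem_erase hk, hpdef]; ring
      have h3 : C (pivotVec L i u β i) = C (1 / p) * C β := by
        rw [← map_mul]; congr 1; simp [pivotVec, hpdef]; ring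
      rw [h1, h2, h3]
      linear_combination hI2 + I * cu + C (1 / u) * hXj
    · have h1 : W (fourierAtS j u (mdx i F)) = C (L i j) * I + S i := by
        rw [← mdx_fourierAtS_of_ne hi, hW.mdx_eq, sum_pivot j, Pi.single_eq_of_ne hi]
        simp [hI, hS, hG]
      have h2 : ∑ k, C (pivotForm L j u i k) * W (fourierAtS j u (mx k * F)) =
          C (L i j) * C (1 / p) * W (fourierAtS j u (mx j * F)) +
            (S i + C (L i j) * C (1 / p) * S j) := by
        rw [sum_pivot j]
        congr 1
        · rw [← map_mul]; congr 2
          simp only [pivotForm, Matrix.of_apply, if_neg hi, if_true, hpdef]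
          rw [mul_one_div]
        · rw [hS, Finset.mul_sum, ← Finset.sum_add_distrib]
          refine Finset.sum_congr rfl fun k hk => ?_
          rw [hne k hk, ← mul_assoc, ← map_mul, ← map_mul, ← add_mul, ← map_add]
          congr 2
          simp only [pivotForm, Matrix.of_apply, if_neg hi, if_neg (Finset.ne_of_mem_erase hk), hpdef]
          ring
      have h3 : C (pivotVec L j u β i) = C (L i j) * (C (1 / p) * C β) := by
        rw [← map_mul, ← map_mul]; congr 1
        simp only [pivotVec, if_neg hi, hpdef]; ring
      rw [h1, h2, h3]
      linear_combination C (L i j) * hI2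

/-- In the change of variables, `x_j` is replaced by a variable of mean `u x_j`, so a vector `w`
corresponds to `w` with `w j` multiplied by `u`. This transports kernels and critical points between
the two forms. -/
theorem pivotForm_mulVec_update {L : Matrix ι ι K} {j : ι} {u : K} (hu : u ≠ 0)
    (hp : u - L j j ≠ 0) (w : ι → K) (i : ι) :
    (pivotForm L j u *ᵥ Function.update w j (u * w j)) i =
      (if i = j then 0 else (L *ᵥ w) i) +
        (if i = j then 1 else L i j) * ((L *ᵥ w) j / (u - L j j)) := by
  have hs : ∀ f : ι → K, ∑ k ∈ Finset.univ.erase j, f k * Function.update w j (u * w j) k =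
      ∑ k ∈ Finset.univ.erase j, f k * w k := fun f =>
    Finset.sum_congr rfl fun k hk => by rw [Function.update_of_ne (Finset.ne_of_mem_erase hk)]
  simp only [Matrix.mulVec, dotProduct]
  rw [sum_pivot j, sum_pivot j (fun k => L j k * w k), sum_pivot j (fun k => L i k * w k), hs,
    Function.update_self]
  set T := ∑ k ∈ Finset.univ.erase j, L j k * w k
  by_cases hij : i = j
  · subst hij
    have : ∑ k ∈ Finset.univ.erase i, pivotForm L i u i k * w k = T / (u - L i i) := by
      rw [Finset.sum_div]
      refine Finset.sum_congr rfl fun k hk => ?_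
      simp [pivotForm, Finset.ne_of_mem_erase hk]; ring
    rw [this]
    simp only [pivotForm, Matrix.of_apply, if_true]
    field_simp
    ring
  · have : ∑ k ∈ Finset.univ.erase j, pivotForm L j u i k * w k =
        ∑ k ∈ Finset.univ.erase j, L i k * w k + L i j / (u - L j j) * T := by
      rw [Finset.mul_sum, ← Finset.sum_add_distrib]
      refine Finset.sum_congr rfl fun k hk => ?_
      simp [pivotForm, Finset.ne_of_mem_erase hk, hij]; ring
    rw [this]
    simp only [pivotForm, Matrix.of_apply, if_neg hij, if_true]
    field_simp
    ring

theorem pivotForm_mulVec {L : Matrix ι ι K} {j : ι} {u : K} (hu : u ≠ 0)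
    (hp : u - L j j ≠ 0) (w : ι → K) (β : K) (hw : L *ᵥ w = Pi.single j β) :
    pivotForm L j u *ᵥ (Function.update w j (u * w j)) = pivotVec L j u β := by
  ext i
  rw [pivotForm_mulVec_update hu hp, hw, Pi.single_eq_same, pivotVec]
  by_cases hi : i = j <;> simp [hi]

theorem pivotForm_det_ne_zero {L : Matrix ι ι K} {j : ι} {u : K} (hu : u ≠ 0)
    (hp : u - L j j ≠ 0) : (pivotForm L j u).det ≠ 0 ↔ L.det ≠ 0 := by
  have key : ∀ M : Matrix ι ι K, M.det ≠ 0 ↔ ∀ v, M *ᵥ v = 0 → v = 0 := fun M => by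
    rw [← not_iff_not, not_not, ← Matrix.exists_mulVec_eq_zero_iff]
    push Not
    exact exists_congr fun v => and_comm
  rw [key, key]
  refine ⟨fun h w hw => ?_, fun h v hv => ?_⟩
  · have h1 := h (Function.update w j (u * w j)) <| by
      ext i
      rw [pivotForm_mulVec_update hu hp, hw]
      simp
    ext i
    by_cases hi : i = j
    · subst hi
      simpa [hu] using congrFun h1 i
    · simpa [hi] using congrFun h1 i
  · set w := Function.update v j (u⁻¹ * v j) with hwdef
    have hvw : v = Function.update w j (u * w j) := by
      ext i
      by_cases hi : i = j
      · subst hi; simp [hwdef, hu]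
      · simp [hwdef, hi]
    have hj : (L *ᵥ w) j = 0 := by
      have := pivotForm_mulVec_update hu hp w j
      rw [← hvw, hv] at this
      simpa [hp] using this.symm
    have hw : L *ᵥ w = 0 := by
      ext i
      by_cases hi : i = j
      · rw [hi, hj]; rfl
      · have := pivotForm_mulVec_update hu hp w i
        rw [← hvw, hv, hj] at this
        simpa [hi] using this.symm
    rw [hvw, h w hw]
    ext i
    by_cases hi : i = j
    · subst hi; simp
    · simp [hi]

omit [Fintype ι] in
theorem pivotForm_isSymm {L : Matrix ι ι K} (hL : L.IsSymm) (j : ι) (u : K) :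
    (pivotForm L j u).IsSymm := by
  have hs : ∀ a b, L a b = L b a := fun a b => by rw [← Matrix.transpose_apply L, hL.eq]
  ext i k
  simp only [Matrix.transpose_apply, pivotForm, Matrix.of_apply]
  by_cases hi : i = j <;> by_cases hk : k = j <;> simp [hi, hk]
  · rw [hs]
  · rw [hs]
  · rw [hs k i, hs k j, hs j i]; ring

/-- The Fourier transform in the variable `x_j` under the Gaussian integral. -/
theorem gaussAdd_fourierAtS [CharZero K] {L : Matrix ι ι K} (hL : L.IsSymm) (hdet : L.det ≠ 0)
    {j : ι} {u : K} (β : K) (hu : u ≠ 0) (hp : u - L j j ≠ 0)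
    (F : PowerSeries (MvPolynomial ι K)) :
    gaussAdd L (linExp (Pi.single j β) * fourierAtS j u F) =
      fexp (C (-(half K * (β ^ 2 / (u - L j j)))) * X ^ 2) *
        gaussAdd (pivotForm L j u) (linExp (pivotVec L j u β) * F) := by
  have hL2 := pivotForm_isSymm hL j u
  have hdet2 := (pivotForm_det_ne_zero hu hp).2 hdet
  have h1 := ((gaussLike_gaussAdd hL hdet).linExp_mul (Pi.single j β))
  rw [zero_add] at h1
  have h2 := ((gaussLike_gaussAdd hL2 hdet2).linExp_mul (pivotVec L j u β))
  rw [zero_add] at h2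
  -- Both sides are functionals with the same integration by parts, so it suffices to compare them
  -- at `F = 1`, where both are explicit exponentials.
  refine (h1.comp_fourierAtS hu hp).eq_mul hdet2 h2 ?_ F
  set w := L⁻¹ *ᵥ (Pi.single j β)
  have hw : L *ᵥ w = Pi.single j β := by
    rw [Matrix.mulVec_mulVec, Matrix.mul_nonsing_inv _ (isUnit_iff_ne_zero.2 hdet),
      Matrix.one_mulVec]
  simp only [AddMonoidHom.comp_apply, fourierAtS_one, AddMonoidHom.coe_mulLeft, mul_one]
  rw [gaussAdd_linExp hL hdet hw, gaussAdd_linExp hL2 hdet2 (pivotForm_mulVec hu hp w β hw),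
    ← fexp_add (by simp) (by simp), ← add_mul, ← map_add]
  congr 3
  have hj := congrFun hw j
  have hs : ∀ a b, L a b = L b a := fun a b => by rw [← Matrix.transpose_apply L, hL.eq]
  have h3 : pivotVec L j u β ⬝ᵥ Function.update w j (u * w j) = β * w j + β ^ 2 / (u - L j j) := by
    simp only [Matrix.mulVec, dotProduct] at hj ⊢
    rw [sum_pivot j, Pi.single_eq_same] at hj
    rw [sum_pivot j, Function.update_self]
    have : ∑ k ∈ Finset.univ.erase j, pivotVec L j u β k * Function.update w j (u * w j) k =
        β / (u - L j j) * ∑ k ∈ Finset.univ.erase j, L j k * w k := by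
      rw [Finset.mul_sum]
      refine Finset.sum_congr rfl fun k hk => ?_
      rw [Function.update_of_ne (Finset.ne_of_mem_erase hk), pivotVec,
        if_neg (Finset.ne_of_mem_erase hk), hs]
      ring
    rw [this, pivotVec, if_pos rfl]
    field_simp
    linear_combination β * hj
  rw [h3, single_dotProduct]
  ring

end FourierAt

/-! ### Products of dilogarithms under the Gaussian integral -/

section Embed

variable {ι K : Type*} [Field K] [CharZero K]

/-- The inclusion of `K[x]⟦h⟧` in `K[x_i, i ∈ ι]⟦h⟧` sending `x` to `x_i`. -/
def embed (i : ι) : PowerSeries (Polynomial K) →+* PowerSeries (MvPolynomial ι K) :=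
  PowerSeries.map (Polynomial.aeval (MvPolynomial.X i : MvPolynomial ι K)).toRingHom

theorem psi_eq_embed (i : ι) (z : K) :
    psi (MvPolynomial.X i : MvPolynomial ι K) z = embed i (dilog (z / (1 - z))) := by
  rw [psi, embed, dilog, map_fexp _ (constantCoeff_dilogExponent _)]
  congr 1
  ext1 n
  simp only [psiExponent, dilogExponent, coeff_mk, coeff_map]
  split_ifs
  · simp
  · simp only [dilogCoeff, li, AlgHom.toRingHom_eq_coe, RingHom.coe_coe, map_neg, map_sum, map_mul,
      map_pow, Polynomial.aeval_X, Polynomial.aeval_C, MvPolynomial.algebraMap_eq]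
    simp

theorem embed_gexp (i : ι) (a b : K) :
    embed i (gexp a b) = fexp (C (MvPolynomial.C a) * X ^ 2 +
      C (MvPolynomial.C b) * X * C (MvPolynomial.X i)) := by
  rw [gexp, embed, map_fexp _ (constantCoeff_gexpo a b)]
  simp [cst, xs, MvPolynomial.algebraMap_eq]

theorem embed_gexp_zero (i : ι) (a : K) :
    embed i (gexp a 0) = scal (fexp (C a * X ^ 2)) := by
  rw [embed_gexp, scal, map_fexp _ (by simp)]
  simp

theorem prod_embed_gexp [Fintype ι] (c : ι → K) :
    ∏ i, embed i (gexp 0 (c i)) = linExp c := by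
  simp only [embed_gexp]
  rw [← fexp_sum _ _ (by simp), linExp, map_sum, Finset.mul_sum]
  congr 1
  refine Finset.sum_congr rfl fun i _ => ?_
  simp only [map_zero, zero_mul, zero_add, map_mul]
  ring

variable [DecidableEq ι]

omit [DecidableEq ι] [CharZero K] in
theorem fourierAt_aeval (j : ι) (u : K) (q : Polynomial K) :
    fourierAt j u (Polynomial.aeval (MvPolynomial.X j) q) =
      Polynomial.aeval (MvPolynomial.X j) (fourier u q) := by
  induction q using poly_ind with
  | hC a =>
    rw [fourier_C, Polynomial.aeval_C, MvPolynomial.algebraMap_eq, fourierAt_C]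
  | hadd p q hp hq => simp [hp, hq]
  | hX p hp =>
    rw [map_mul, Polynomial.aeval_X, fourierAt_X_mul, hp, fourier_X_mul, pderiv_aeval_X]
    simp [MvPolynomial.algebraMap_eq]

omit [DecidableEq ι] [CharZero K] in
theorem fourierAt_aeval_mul {i j : ι} (hij : i ≠ j) (u : K) (q : Polynomial K)
    (p : MvPolynomial ι K) :
    fourierAt j u (Polynomial.aeval (MvPolynomial.X i) q * p) =
      Polynomial.aeval (MvPolynomial.X i) q * fourierAt j u p := by
  induction q using poly_ind with
  | hC a => rw [Polynomial.aeval_C, MvPolynomial.algebraMap_eq, fourierAt_C_mul]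
  | hadd q r hq hr => simp [hq, hr, add_mul]
  | hX q hq =>
    rw [map_mul (Polynomial.aeval _), Polynomial.aeval_X, mul_assoc, fourierAt_X_mul_of_ne hij, hq,
      mul_assoc]

omit [DecidableEq ι] [CharZero K] in
theorem fourierAtS_embed_mul {i j : ι} (hij : i ≠ j) (u : K) (f : PowerSeries (Polynomial K))
    (F : PowerSeries (MvPolynomial ι K)) :
    fourierAtS j u (embed i f * F) = embed i f * fourierAtS j u F := by
  ext1 n
  simp only [coeff_fourierAtS, coeff_mul, map_sum, embed, coeff_map]
  exact Finset.sum_congr rfl fun p _ => fourierAt_aeval_mul hij u _ _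

omit [CharZero K] in
theorem fourierAtS_prod_mul {j : ι} (u : K) (s : Finset ι) (hs : j ∉ s)
    (f : ι → PowerSeries (Polynomial K)) (F : PowerSeries (MvPolynomial ι K)) :
    fourierAtS j u ((∏ i ∈ s, embed i (f i)) * F) =
      (∏ i ∈ s, embed i (f i)) * fourierAtS j u F := by
  induction s using Finset.induction_on with
  | empty => simp
  | insert i s hi ih =>
    have hij : i ≠ j := fun h => hs (h ▸ Finset.mem_insert_self i s)
    rw [Finset.prod_insert hi, mul_assoc, fourierAtS_embed_mul hij,
      ih fun h => hs (Finset.mem_insert_of_mem h), mul_assoc]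

omit [DecidableEq ι] [CharZero K] in
theorem fourierAtS_embed (j : ι) (u : K) (F : PowerSeries (Polynomial K)) :
    fourierAtS j u (embed j F) = embed j (fourierS u F) := by
  ext1 n
  simp only [coeff_fourierAtS, embed, coeff_map, coeff_fourierS]
  exact fourierAt_aeval j u _

variable [Fintype ι]

/-- The Gaussian integral of a product of series `ψ_h(x_i, z_i)` and the exponential of a linear
form. -/
def gaussDilog (L : Matrix ι ι K) (α u : ι → K) : PowerSeries K :=
  gaussAdd L (∏ i, embed i (gexp 0 (α i) * dilog (u i)))

/-- The change of `gaussDilog` under `z_j ↦ 1 / (1 - z_j)`. -/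
theorem gaussDilog_pivot {L : Matrix ι ι K} (hL : L.IsSymm) (hdet : L.det ≠ 0) {j : ι}
    (α : ι → K) {u : ι → K} (hu : u j ≠ 0) (hp : u j - L j j ≠ 0) :
    gaussDilog L α u =
      fexp (C (-(1 / 24) - half K * (α j ^ 2 / (u j - L j j))) * X ^ 2) *
        gaussDilog (pivotForm L j (u j))
          (pivotVec L j (u j) (α j) + Function.update α j (half K))
          (Function.update u j (-(u j)⁻¹ - 1)) := by
  set u' := -(u j)⁻¹ - 1 with hu'
  -- The Fourier identity read backwards introduces the rotated shape and the factor `exp(-ħ/24)`.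
  -- The factor `exp(h x / 2)` in it makes `half K` the `j`-th entry of the linear form.
  have hd : dilog (u j) = gexp (-(1 / 24)) 0 * fourierS (u j) (gexp 0 (half K) * dilog u') := by
    have h := fourierDilog_eq (mul_inv_cancel₀ hu) hu'
    rw [fourierDilog] at h
    rw [h, ← mul_assoc, gexp_mul]
    simp
  set R := ∏ i ∈ Finset.univ.erase j, embed i (gexp 0 (α i) * dilog (u i)) with hR
  have hsingle : embed j (gexp 0 (α j)) = linExp (Pi.single j (α j)) := by
    rw [← prod_embed_gexp, ← Finset.mul_prod_erase _ _ (Finset.mem_univ j), Pi.single_eq_same,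
      Finset.prod_eq_one fun i hi => ?_, mul_one]
    rw [Pi.single_eq_of_ne (Finset.ne_of_mem_erase hi), gexp_zero, map_one]
  have hRj : R * embed j (gexp 0 (half K) * dilog u') = ∏ i, embed i
      (gexp 0 (Function.update α j (half K) i) * dilog (Function.update u j u' i)) := by
    rw [← Finset.prod_erase_mul _ _ (Finset.mem_univ j), Function.update_self,
      Function.update_self]
    refine congrArg (· * _) (Finset.prod_congr rfl fun i hi => ?_)
    rw [Function.update_of_ne (Finset.ne_of_mem_erase hi),
      Function.update_of_ne (Finset.ne_of_mem_erase hi)]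
  have h1 : ∏ i, embed i (gexp 0 (α i) * dilog (u i)) = scal (fexp (C (-(1 / 24)) * X ^ 2)) *
      (linExp (Pi.single j (α j)) *
        fourierAtS j (u j) (R * embed j (gexp 0 (half K) * dilog u'))) := by
    rw [hR, fourierAtS_prod_mul _ _ (Finset.notMem_erase j _), fourierAtS_embed,
      ← Finset.mul_prod_erase _ _ (Finset.mem_univ j), map_mul, hd, map_mul, hsingle,
      embed_gexp_zero]
    ring
  have h2 : linExp (pivotVec L j (u j) (α j)) * (R * embed j (gexp 0 (half K) * dilog u')) =
      ∏ i, embed i (gexp 0 ((pivotVec L j (u j) (α j) + Function.update α j (half K)) i) *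
        dilog (Function.update u j u' i)) := by
    rw [hRj, ← prod_embed_gexp, ← Finset.prod_mul_distrib]
    refine Finset.prod_congr rfl fun i _ => ?_
    rw [← map_mul, ← mul_assoc, gexp_mul, Pi.add_apply, zero_add]
  rw [gaussDilog, h1, (gaussLike_gaussAdd hL hdet).scal_mul, gaussAdd_fourierAtS hL hdet _ hu hp,
    h2, ← gaussDilog, ← mul_assoc, ← fexp_add (by simp) (by simp), ← add_mul, ← map_add,
    ← sub_eq_add_neg]

end Embed

/-! ### The series `Φ` as a Gaussian integral of dilogarithms -/

namespace Datum

variable {ι K : Type*} [Fintype ι] [DecidableEq ι] [Field K] [CharZero K]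

/-- The coefficients of the linear form in the exponent of the integrand. -/
def lin (X : Datum ι K) : ι → K := fun i => half K * (1 - (X.BK⁻¹ *ᵥ X.nuK) i)

/-- Eight times the coefficient of `ħ` in the constant term of the exponent. -/
def quad (X : Datum ι K) : K := X.fK ⬝ᵥ ((X.BK⁻¹ * X.AK) *ᵥ X.fK)

theorem Phi_eq (X : Datum ι K) (hL : X.Lam.IsSymm) (hdet : X.Lam.det ≠ 0) :
    X.Phi = fexp (C (1 / 8 * X.quad) * PowerSeries.X ^ 2) *
      gaussDilog X.Lam X.lin (fun i => X.z i / (1 - X.z i)) := by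
  have hhalf : half K = 1 / 2 := by simp [half]
  have h : X.integrand = scal (fexp (C (1 / 8 * X.quad) * PowerSeries.X ^ 2)) *
      ∏ i, embed i (gexp 0 (X.lin i) * dilog (X.z i / (1 - X.z i))) := by
    simp only [map_mul (embed _), Finset.prod_mul_distrib, ← psi_eq_embed]
    have h1 : ∑ i, MvPolynomial.C ((1 / 2 : K)) * MvPolynomial.X i
          - ∑ i, MvPolynomial.C ((1 / 2 : K) * (X.BK⁻¹ *ᵥ X.nuK) i) * MvPolynomial.X i =
        ∑ i, MvPolynomial.C (X.lin i) * MvPolynomial.X i := by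
      rw [← Finset.sum_sub_distrib]
      refine Finset.sum_congr rfl fun i _ => ?_
      rw [lin, hhalf, ← sub_mul, ← map_sub, mul_sub, mul_one]
    have h2 : PowerSeries.X ^ 2 * C (MvPolynomial.C (1 / 8 * X.quad)) =
        scal (ι := ι) (C (1 / 8 * X.quad) * PowerSeries.X ^ 2) := by
      generalize 1 / 8 * X.quad = κ
      rw [scal, map_mul, map_pow, map_X, map_C, mul_comm]
    rw [prod_embed_gexp, integrand, fexp_add (by simp) (by simp), h1, ← linExp, ← quad, h2, scal,
      ← map_fexp _ (by simp), ← mul_assoc, mul_comm (linExp _)]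
  rw [Phi, gauss_eq, h, (gaussLike_gaussAdd hL hdet).scal_mul, gaussDilog]

end Datum

/-! ### The pivot of `B⁻¹ A` when one quad is rotated -/

section Pivot

variable {ι K : Type*} [Fintype ι] [DecidableEq ι] [Field K]

/-- The effect on `B⁻¹ A` of the change of quad `q_j ↦ q_j + 1`. -/
def quadPivot (M : Matrix ι ι K) (j : ι) : Matrix ι ι K :=
  Matrix.of fun i k =>
    if i = j then (if k = j then -1 / (M j j - 1) else M j k / (M j j - 1))
    else if k = j then M i j / (M j j - 1) else M i k - M i j * M j k / (M j j - 1)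

/-- Rotating the quad `j` replaces the `j`-th columns of `(A, B)` by those of `(-B, A - B)`. Solving
for the new quotient column by column divides by `M j j - 1`. -/
theorem updateCol_mul_quadPivot {A B M : Matrix ι ι K} (hA : B * M = A) {j : ι}
    (hp : M j j - 1 ≠ 0) :
    B.updateCol j (fun i => A i j - B i j) * quadPivot M j = A.updateCol j fun i => -B i j := by
  subst hA
  ext i k
  have hs : ∀ f : ι → K, ∑ l ∈ Finset.univ.erase j, B.updateCol j
      (fun i => (B * M) i j - B i j) i l * f l = ∑ l ∈ Finset.univ.erase j, B i l * f l :=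
    fun f => Finset.sum_congr rfl fun l hl => by
      rw [Matrix.updateCol_ne (Finset.ne_of_mem_erase hl)]
  rw [Matrix.mul_apply, sum_pivot j, hs, Matrix.updateCol_self]
  by_cases hk : k = j
  · subst hk
    have : ∑ l ∈ Finset.univ.erase k, B i l * quadPivot M k l k =
        (∑ l ∈ Finset.univ.erase k, B i l * M l k) / (M k k - 1) := by
      rw [Finset.sum_div]
      refine Finset.sum_congr rfl fun l hl => ?_
      simp [quadPivot, Finset.ne_of_mem_erase hl]; ring
    rw [this, Matrix.updateCol_self, Matrix.mul_apply, sum_pivot k (fun l => B i l * M l k)]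
    simp only [quadPivot, Matrix.of_apply, if_true]
    field_simp
    ring
  · have : ∑ l ∈ Finset.univ.erase j, B i l * quadPivot M j l k =
        ∑ l ∈ Finset.univ.erase j, B i l * M l k -
        (∑ l ∈ Finset.univ.erase j, B i l * M l j) * (M j k / (M j j - 1)) := by
      rw [Finset.sum_mul, ← Finset.sum_sub_distrib]
      refine Finset.sum_congr rfl fun l hl => ?_
      simp only [quadPivot, Matrix.of_apply, if_neg (Finset.ne_of_mem_erase hl), if_neg hk]; ring
    rw [this, Matrix.updateCol_ne hk, Matrix.mul_apply, Matrix.mul_apply,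
      sum_pivot j (fun l => B i l * M l j), sum_pivot j (fun l => B i l * M l k)]
    simp only [quadPivot, Matrix.of_apply, if_true, if_neg hk]
    field_simp
    ring

omit [Fintype ι] in
/-- The diagonal shift of `-B⁻¹ A` transforms as the quadratic form of a Gaussian. -/
theorem pivotForm_eq (M : Matrix ι ι K) (j : ι) (u : ι → K) :
    pivotForm (-M + Matrix.diagonal fun i => 1 + u i) j (u j) =
      -quadPivot M j + Matrix.diagonal fun i => 1 + Function.update u j (-(u j)⁻¹ - 1) i := by
  have hp : u j - (-M + Matrix.diagonal fun i => 1 + u i) j j = M j j - 1 := by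
    simp only [Matrix.add_apply, Matrix.neg_apply, Matrix.diagonal_apply_eq]; ring
  ext i k
  simp only [pivotForm, quadPivot, Matrix.of_apply, Matrix.add_apply, Matrix.neg_apply]
  by_cases hi : i = j
  · subst hi
    by_cases hk : k = i
    · subst hk
      simp; ring
    · simp [hk, Ne.symm hk]; ring
  · by_cases hk : k = j
    · subst hk
      simp [hi]; ring
    · by_cases hik : i = k
      · subst hik
        simp [hi, Ne.symm hi]; ring
      · simp [hi, hk, hik, Ne.symm hk]; ring

theorem quadPivot_mulVec {M : Matrix ι ι K} {j : ι} (hp : M j j - 1 ≠ 0) (f : ι → K) (b : K)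
    (i : ι) : (quadPivot M j *ᵥ Function.update f j b) i =
      if i = j then -((b + f j - (M *ᵥ f) j) / (M j j - 1)) - f j
      else (M *ᵥ f) i + M i j * ((b + f j - (M *ᵥ f) j) / (M j j - 1)) := by
  have hs : ∀ g : ι → K, ∑ k ∈ Finset.univ.erase j, g k * Function.update f j b k =
      ∑ k ∈ Finset.univ.erase j, g k * f k := fun g =>
    Finset.sum_congr rfl fun k hk => by rw [Function.update_of_ne (Finset.ne_of_mem_erase hk)]
  simp only [Matrix.mulVec, dotProduct]
  rw [sum_pivot j, sum_pivot j (fun k => M j k * f k), sum_pivot j (fun k => M i k * f k), hs,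
    Function.update_self]
  set T := ∑ k ∈ Finset.univ.erase j, M j k * f k
  split_ifs with hi
  · subst hi
    have : ∑ k ∈ Finset.univ.erase i, quadPivot M i i k * f k = T / (M i i - 1) := by
      rw [Finset.sum_div]
      refine Finset.sum_congr rfl fun k hk => ?_
      simp [quadPivot, Finset.ne_of_mem_erase hk]; ring
    rw [this]
    simp only [quadPivot, Matrix.of_apply, if_true]
    field_simp
    ring
  · have : ∑ k ∈ Finset.univ.erase j, quadPivot M j i k * f k =
        ∑ k ∈ Finset.univ.erase j, M i k * f k - M i j / (M j j - 1) * T := by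
      rw [Finset.mul_sum, ← Finset.sum_sub_distrib]
      refine Finset.sum_congr rfl fun k hk => ?_
      simp only [quadPivot, Matrix.of_apply, if_neg (Finset.ne_of_mem_erase hk), if_neg hi]; ring
    rw [this]
    simp only [quadPivot, Matrix.of_apply, if_true, if_neg hi]
    field_simp
    ring

/-- Here `b` will be the rotated entry of the flattening at `j`. The subtracted square is the one
that the Gaussian integral produces, and the remaining terms are integral for a flattening. -/
theorem quadPivot_quad {M : Matrix ι ι K} (hM : M.IsSymm) {j : ι} (hp : M j j - 1 ≠ 0)
    (f : ι → K) (b : K) :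
    Function.update f j b ⬝ᵥ (quadPivot M j *ᵥ Function.update f j b) =
      f ⬝ᵥ (M *ᵥ f) - (b + f j - (M *ᵥ f) j) ^ 2 / (M j j - 1) - f j ^ 2 - 2 * (f j * b) := by
  have hs : ∀ a c, M a c = M c a := fun a c => by rw [← Matrix.transpose_apply M, hM.eq]
  rw [dotProduct, dotProduct, sum_pivot j, sum_pivot j (fun i => f i * (M *ᵥ f) i),
    quadPivot_mulVec hp, if_pos rfl, Function.update_self]
  set a := (b + f j - (M *ᵥ f) j) / (M j j - 1) with ha
  have h1 : ∑ i ∈ Finset.univ.erase j, Function.update f j b i *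
      (quadPivot M j *ᵥ Function.update f j b) i =
      ∑ i ∈ Finset.univ.erase j, f i * (M *ᵥ f) i + a * ((M *ᵥ f) j - M j j * f j) := by
    have h2 : (M *ᵥ f) j - M j j * f j = ∑ i ∈ Finset.univ.erase j, M j i * f i := by
      rw [Matrix.mulVec, dotProduct, sum_pivot j, add_sub_cancel_left]
    rw [h2, Finset.mul_sum, ← Finset.sum_add_distrib]
    refine Finset.sum_congr rfl fun i hi => ?_
    rw [quadPivot_mulVec hp, if_neg (Finset.ne_of_mem_erase hi),
      Function.update_of_ne (Finset.ne_of_mem_erase hi), hs i j]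
    ring
  rw [h1]
  have h3 : (b + f j - (M *ᵥ f) j) ^ 2 / (M j j - 1) = a * (b + f j - (M *ᵥ f) j) := by
    rw [ha]; ring
  have h4 : a * (M j j - 1) = b + f j - (M *ᵥ f) j := div_mul_cancel₀ _ hp
  rw [h3]
  linear_combination -f j * h4

end Pivot

/-! ### Symmetry and flattening relations for an arbitrary quad -/

namespace Gluing

variable {ι : Type*} [Fintype ι]

theorem fin_three_cases (a b : Fin 3) : b = a ∨ b = a + 1 ∨ b = a + 2 := by
  revert a b; decide

/-- Symmetry is a sum over tetrahedra of the antisymmetric expression `A_ij B_kj - B_ij A_kj`, and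
each summand is invariant under cyclic rotation of the three matrices. -/
theorem isSymm_A_mul_B (D : Gluing ι) (hD : D.IsSymplectic) (q : ι → Fin 3) :
    (D.A q * (D.B q)ᵀ).IsSymm := by
  ext i k
  have h := congrFun (congrFun hD i) k
  simp only [Matrix.transpose_apply, Matrix.mul_apply, Matrix.sub_apply] at h ⊢
  rw [← sub_eq_zero, ← Finset.sum_sub_distrib] at h ⊢
  rw [← h]
  refine Finset.sum_congr rfl fun j _ => ?_
  simp only [A, B, Matrix.of_apply]
  generalize q j = a
  fin_cases a <;> simp <;> ring

/-- Eliminating the middle flattening entry through `f + f' + f'' = 1` leaves `A f + B f'' = ν`. -/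
theorem A_mulVec_add (D : Gluing ι) {F : Fin 3 → ι → ℤ} (hF : D.IsFlattening F)
    (q : ι → Fin 3) :
    (D.A q *ᵥ fun j => F (q j) j) + (D.B q *ᵥ fun j => F (q j + 2) j) = D.nu q := by
  ext i
  have h := congrFun hF.2 i
  simp only [Pi.add_apply, Matrix.mulVec, dotProduct] at h
  simp only [Pi.add_apply, Matrix.mulVec, dotProduct, nu, ← h, A, B, Matrix.of_apply]
  rw [← Finset.sum_add_distrib, ← Finset.sum_add_distrib, ← Finset.sum_add_distrib,
    ← Finset.sum_sub_distrib]
  refine Finset.sum_congr rfl fun j _ => ?_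
  have h1 := hF.1 j
  generalize q j = a
  fin_cases a
  · simp; linear_combination -D.G 1 i j * h1
  · simp; linear_combination -D.G 2 i j * h1
  · simp; linear_combination -D.G 0 i j * h1

variable [DecidableEq ι] (K : Type*) [Field K]

/-- The matrix `B⁻¹ A` of a choice of quad. -/
def quot (D : Gluing ι) (q : ι → Fin 3) : Matrix ι ι K :=
  ((D.B q).map (Int.cast : ℤ → K))⁻¹ * (D.A q).map (Int.cast : ℤ → K)

variable {K} [CharZero K]

theorem isUnit_det_map {B : Matrix ι ι ℤ} (hB : B.det ≠ 0) :
    IsUnit (B.map (Int.cast : ℤ → K)).det := by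
  have : (B.map (Int.cast : ℤ → K)).det = (B.det : K) := (Int.cast_det B).symm
  rw [this, isUnit_iff_ne_zero]
  exact_mod_cast hB

theorem B_mul_quot (D : Gluing ι) {q : ι → Fin 3} (hq : (D.B q).det ≠ 0) :
    (D.B q).map (Int.cast : ℤ → K) * D.quot K q = (D.A q).map (Int.cast : ℤ → K) := by
  rw [quot, Matrix.mul_nonsing_inv_cancel_left _ _ (isUnit_det_map hq)]

theorem quot_isSymm (D : Gluing ι) (hD : D.IsSymplectic) {q : ι → Fin 3}
    (hq : (D.B q).det ≠ 0) : (D.quot K q).IsSymm := by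
  set A := (D.A q).map (Int.cast : ℤ → K) with hA
  set B := (D.B q).map (Int.cast : ℤ → K) with hB
  have hu : IsUnit B.det := isUnit_det_map hq
  have hBM : B * D.quot K q = A := D.B_mul_quot hq
  have hs : B * Aᵀ = A * Bᵀ := by
    have := congrArg (fun M : Matrix ι ι ℤ => M.map (Int.castRingHom K)) (D.isSymm_A_mul_B hD q).eq
    rw [Matrix.transpose_mul, Matrix.transpose_transpose, Matrix.map_mul, Matrix.map_mul] at this
    exact this
  have h1 : (D.quot K q)ᵀ * Bᵀ = Aᵀ := by rw [← Matrix.transpose_mul, hBM]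
  have h2 : B * (D.quot K q)ᵀ * Bᵀ = A * Bᵀ := by rw [Matrix.mul_assoc, h1, hs]
  have huT : IsUnit Bᵀ.det := by rwa [Matrix.det_transpose]
  have h3 : B * (D.quot K q)ᵀ = A := by
    have := congrArg (· * (Bᵀ)⁻¹) h2
    simpa [Matrix.mul_assoc, Matrix.mul_nonsing_inv _ huT] using this
  calc (D.quot K q)ᵀ = B⁻¹ * (B * (D.quot K q)ᵀ) :=
        (Matrix.nonsing_inv_mul_cancel_left _ _ hu).symm
    _ = D.quot K q := by rw [h3, quot]

end Gluing

/-! ### Connectivity of the nondegenerate quads -/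

namespace Gluing

variable {ι : Type*} [Fintype ι] [DecidableEq ι] {K : Type*} [Field K] [CharZero K]

/-- The matrix `B_q⁻¹ B_s` of a change of quads from `q` to `s`. -/
def transition (M : Matrix ι ι K) (q s : ι → Fin 3) : Matrix ι ι K :=
  Matrix.of fun i k =>
    if s k = q k then (1 : Matrix ι ι K) i k
    else if s k = q k + 1 then M i k - (1 : Matrix ι ι K) i k else -M i k

theorem B_mul_transition (D : Gluing ι) {q : ι → Fin 3} (hq : (D.B q).det ≠ 0)
    (s : ι → Fin 3) : (D.B q).map (Int.cast : ℤ → K) * transition (D.quot K q) q s =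
      (D.B s).map (Int.cast : ℤ → K) := by
  ext i k
  have hM := congrFun (congrFun (D.B_mul_quot (K := K) hq) i) k
  have h1 := congrFun (congrFun (Matrix.mul_one ((D.B q).map (Int.cast : ℤ → K))) i) k
  rw [Matrix.mul_apply] at hM h1 ⊢
  obtain h | h | h := fin_three_cases (q k) (s k)
  · simp only [transition, Matrix.of_apply, if_pos h]
    rw [h1]
    simp [B, h]
  · have h0 : s k ≠ q k := by rw [h]; generalize q k = a; revert a; decide
    simp only [transition, Matrix.of_apply, if_neg h0, if_pos h, mul_sub, Finset.sum_sub_distrib]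
    rw [hM, h1]
    have h2 : q k + 1 + 2 = q k := by generalize q k = a; revert a; decide
    have h3 : q k + 1 + 1 = q k + 2 := by generalize q k = a; revert a; decide
    simp only [A, B, h, Matrix.map_apply, Matrix.of_apply, h2, h3]
    push_cast
    ring
  · have h0 : s k ≠ q k := by rw [h]; generalize q k = a; revert a; decide
    have h1 : s k ≠ q k + 1 := by rw [h]; generalize q k = a; revert a; decide
    simp only [transition, Matrix.of_apply, if_neg h0, if_neg h1, mul_neg, Finset.sum_neg_distrib]
    rw [hM]
    have h2 : q k + 2 + 2 = q k + 1 := by generalize q k = a; revert a; decide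
    have h3 : q k + 2 + 1 = q k := by generalize q k = a; revert a; decide
    simp only [A, B, h, Matrix.map_apply, Matrix.of_apply, h2, h3]
    push_cast
    ring

theorem det_B_ne_zero_iff (D : Gluing ι) {q : ι → Fin 3} (hq : (D.B q).det ≠ 0)
    (s : ι → Fin 3) : (D.B s).det ≠ 0 ↔ (transition (D.quot K q) q s).det ≠ 0 := by
  have h := congrArg Matrix.det (D.B_mul_transition (K := K) hq s)
  have hs : ((D.B s).map (Int.cast : ℤ → K)).det = ((D.B s).det : K) := (Int.cast_det _).symm
  rw [Matrix.det_mul, hs] at h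
  rw [← Int.cast_ne_zero (α := K), ← h, mul_ne_zero_iff,
    and_iff_right (isUnit_iff_ne_zero.1 (isUnit_det_map hq))]

omit [Fintype ι] [CharZero K] in
theorem transition_eq {M : Matrix ι ι K} {q s : ι → Fin 3} {k : ι} (h : s k = q k) (i : ι) :
    transition M q s i k = (1 : Matrix ι ι K) i k := by
  simp [transition, h]

omit [CharZero K] in
/-- A change of quads in two tetrahedra is nondegenerate if its `2 × 2` minor is. -/
theorem det_transition_ne_zero {M : Matrix ι ι K} {q s : ι → Fin 3} {i j : ι} (hij : i ≠ j)
    (h : ∀ k, k ≠ i → k ≠ j → s k = q k)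
    (hd : transition M q s i i * transition M q s j j -
      transition M q s i j * transition M q s j i ≠ 0) :
    (transition M q s).det ≠ 0 := by
  intro h0
  obtain ⟨w, hw, hw0⟩ := Matrix.exists_mulVec_eq_zero_iff.2 h0
  set T := transition M q s
  have hrow : ∀ l, T l i * w i + T l j * w j + (if l = i ∨ l = j then 0 else w l) = 0 := by
    intro l
    have hl := congrFun hw0 l
    rw [Matrix.mulVec, dotProduct, sum_pivot i, ← Finset.add_sum_erase _ _
      (Finset.mem_erase.2 ⟨hij.symm, Finset.mem_univ j⟩), ← add_assoc] at hl
    refine Eq.trans (congrArg _ ?_) hl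
    have : ∀ k ∈ (Finset.univ.erase i).erase j, T l k * w k = if l = k then w k else 0 := by
      intro k hk
      simp only [Finset.mem_erase, Finset.mem_univ, and_true] at hk
      rw [show T l k = _ from transition_eq (h k hk.2 hk.1) l, Matrix.one_apply]
      split_ifs <;> simp
    rw [Finset.sum_congr rfl this, Finset.sum_ite_eq]
    by_cases h1 : l = i
    · simp [h1, hij]
    · by_cases h2 : l = j <;> simp [h1, h2]
  have hi : T i i * w i + T i j * w j = 0 := by simpa using hrow i
  have hj : T j i * w i + T j j * w j = 0 := by simpa using hrow j
  have wi : w i = 0 := by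
    refine (mul_eq_zero.1 ?_).resolve_left hd
    linear_combination T j j * hi - T i j * hj
  have wj : w j = 0 := by
    refine (mul_eq_zero.1 ?_).resolve_left hd
    linear_combination T i i * hj - T j i * hi
  refine hw (funext fun l => ?_)
  by_cases hl : l = i ∨ l = j
  · rcases hl with rfl | rfl <;> assumption
  · simpa [wi, wj, hl] using hrow l

omit [CharZero K] in
-- Only one column differs from the identity matrix, so the determinant is a Cramer minor.
theorem det_transition_update {M : Matrix ι ι K} {q : ι → Fin 3} {j : ι} {c : Fin 3} :
    (transition M q (Function.update q j c)).det = transition M q (Function.update q j c) j j := by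
  have : transition M q (Function.update q j c) =
      (1 : Matrix ι ι K).updateCol j fun i => transition M q (Function.update q j c) i j := by
    ext i k
    by_cases hk : k = j
    · subst hk; simp
    · rw [Matrix.updateCol_ne hk, transition_eq (Function.update_of_ne hk c q)]
  rw [this, ← Matrix.cramer_apply, Matrix.cramer_one]
  simp

omit [Fintype ι] [CharZero K] in
theorem transition_congr {M : Matrix ι ι K} {q s t : ι → Fin 3} {k : ι} (h : s k = t k) (i : ι) :
    transition M q s i k = transition M q t i k := by
  simp [transition, h]

/-- Two nondegenerate choices of quad are connected by changes in one tetrahedron at a time. -/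
theorem connected (D : Gluing ι) (hD : D.IsSymplectic) {R : (ι → Fin 3) → (ι → Fin 3) → Prop}
    (hrefl : ∀ q, R q q) (htrans : ∀ q s t, R q s → R s t → R q t)
    (hstep : ∀ (q : ι → Fin 3) j c, (D.B q).det ≠ 0 → (D.B (Function.update q j c)).det ≠ 0 →
      R q (Function.update q j c))
    {q s : ι → Fin 3} (hq : (D.B q).det ≠ 0) (hs : (D.B s).det ≠ 0) : R q s := by
  suffices H : ∀ (n : ℕ) q, (D.B q).det ≠ 0 →
      (Finset.univ.filter fun k => s k ≠ q k).card = n → R q s from H _ q hq rfl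
  intro n
  induction n using Nat.strong_induction_on with
  | _ n ih =>
    intro q hq hn
    by_cases hqs : s = q
    · subst hqs; exact hrefl _
    obtain ⟨j, hj⟩ := Function.ne_iff.1 hqs
    set M := D.quot ℚ q
    have hM : ∀ a b, M a b = M b a := fun a b =>
      congrFun (congrFun (D.quot_isSymm (K := ℚ) hD hq).eq b) a
    -- moving closer to `s`
    have hcloser : ∀ q' : ι → Fin 3, (∀ k, s k = q k → s k = q' k) →
        (∃ k, s k ≠ q k ∧ s k = q' k) → (D.B q').det ≠ 0 → R q' s := by
      intro q' h1 ⟨k, h2, h3⟩ h4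
      refine ih _ ?_ q' h4 rfl
      rw [← hn]
      refine Finset.card_lt_card (Finset.ssubset_iff_subset_ne.2 ⟨fun l => ?_, fun h => ?_⟩)
      · simpa using fun h5 h6 => h5 (h1 l h6)
      · have := Finset.ext_iff.1 h k
        simp [h3] at this
        exact h2 (h3.symm ▸ this)
    have hdirect : ∀ k, s k ≠ q k → transition M q s k k ≠ 0 → R q s := by
      intro k hk hT
      have hnd : (D.B (Function.update q k (s k))).det ≠ 0 := by
        rw [D.det_B_ne_zero_iff (K := ℚ) hq, det_transition_update,
          transition_congr (Function.update_self k (s k) q)]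
        exact hT
      refine htrans _ _ _ (hstep q k (s k) hq hnd) (hcloser _ (fun l hl => ?_) ⟨k, hk, by simp⟩ hnd)
      by_cases hlk : l = k
      · subst hlk; simp
      · rw [Function.update_of_ne hlk, hl]
    -- The row `j` is nonzero since `s` is nondegenerate. A nonzero diagonal entry at `j` or `i`
    -- permits a direct change there; otherwise `i ≠ j`, both diagonal entries vanish and `M j i ≠
    -- 0`.
    obtain ⟨i, hi⟩ : ∃ i, transition M q s j i ≠ 0 := by
      by_contra! h
      exact (D.det_B_ne_zero_iff (K := ℚ) hq s).1 hs (Matrix.det_eq_zero_of_row_eq_zero j h)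
    by_cases hjj : transition M q s j j = 0
    swap
    · exact hdirect j hj hjj
    have hij : i ≠ j := by rintro rfl; exact hi hjj
    have hiq : s i ≠ q i := fun h => hi (by rw [transition_eq h, Matrix.one_apply_ne hij.symm])
    by_cases hii : transition M q s i i = 0
    swap
    · exact hdirect i hiq hii
    have hMij : M j i ≠ 0 := by
      simp only [transition, Matrix.of_apply, if_neg hiq, Matrix.one_apply_ne hij.symm] at hi
      split_ifs at hi <;> simpa using hi
    -- Symmetry of `M` makes the opposite off-diagonal entry nonzero too, so the `2 × 2` minor with
    -- a vanishing diagonal entry does not vanish.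
    have hTij : ∀ t : ι → Fin 3, t j ≠ q j → transition M q t i j ≠ 0 := by
      intro t ht
      simp only [transition, Matrix.of_apply, if_neg ht, Matrix.one_apply_ne hij, hM i j]
      split_ifs <;> simpa using hMij
    have hTji : ∀ t : ι → Fin 3, t i ≠ q i → transition M q t j i ≠ 0 := by
      intro t ht
      simp only [transition, Matrix.of_apply, if_neg ht, Matrix.one_apply_ne hij.symm]
      split_ifs <;> simpa using hMij
    -- the third quad of the tetrahedron `i`
    obtain ⟨c, hc, hTc⟩ : ∃ c, c ≠ q i ∧
        ∀ t : ι → Fin 3, t i = c → transition M q t i i ≠ 0 := by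
      have e1 : q i + 1 ≠ q i := by generalize q i = a; revert a; decide
      have e2 : q i + 2 ≠ q i := by generalize q i = a; revert a; decide
      have e3 : q i + 2 ≠ q i + 1 := by generalize q i = a; revert a; decide
      -- The diagonal entries for the two other quads are `M i i - 1` and `-M i i`, which cannot
      -- both vanish.
      obtain h | h | h := fin_three_cases (q i) (s i)
      · exact absurd h hiq
      · refine ⟨q i + 2, e2, fun t ht => ?_⟩
        simp [transition, h, e1] at hii
        simp [transition, ht, e2, e3]
        intro h0; rw [h0] at hii; norm_num at hii
      · refine ⟨q i + 1, e1, fun t ht => ?_⟩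
        simp [transition, h, e2, e3] at hii
        simp [transition, ht, e1, hii]
    -- The detour changes `i` to its third quad, then `j` to its target, then `i` to its target. The
    -- minors of the last two stages reduce to `-T i j * T j i`, where `T` is the transition matrix
    -- of the stage, because the entry at `(j, j)` is zero.
    set s₁ := Function.update q i c with hs₁
    set s₂ := Function.update s₁ j (s j) with hs₂
    set s₃ := Function.update s₂ i (s i) with hs₃
    have h1i : s₁ i = c := by simp [hs₁]
    have h2i : s₂ i = c := by rw [hs₂, Function.update_of_ne hij, h1i]
    have h2j : s₂ j = s j := by simp [hs₂]
    have h3i : s₃ i = s i := by simp [hs₃]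
    have h3j : s₃ j = s j := by rw [hs₃, Function.update_of_ne hij.symm, h2j]
    have hoff : ∀ k, k ≠ i → k ≠ j → s₃ k = q k ∧ s₂ k = q k := by
      intro k hki hkj
      simp [hs₃, hs₂, hs₁, hki, hkj]
    have nd₁ : (D.B s₁).det ≠ 0 := by
      rw [D.det_B_ne_zero_iff (K := ℚ) hq, hs₁, det_transition_update]
      exact hTc _ (by simp)
    have nd₂ : (D.B s₂).det ≠ 0 := by
      rw [D.det_B_ne_zero_iff (K := ℚ) hq]
      refine det_transition_ne_zero hij (fun k hki hkj => (hoff k hki hkj).2) ?_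
      rw [transition_congr h2j j, hjj, mul_zero, zero_sub, neg_ne_zero]
      exact mul_ne_zero (hTij _ (by rwa [h2j])) (hTji _ (by rwa [h2i]))
    have nd₃ : (D.B s₃).det ≠ 0 := by
      rw [D.det_B_ne_zero_iff (K := ℚ) hq]
      refine det_transition_ne_zero hij (fun k hki hkj => (hoff k hki hkj).1) ?_
      rw [transition_congr h3j j, hjj, mul_zero, zero_sub, neg_ne_zero]
      exact mul_ne_zero (hTij _ (by rwa [h3j])) (hTji _ (by rwa [h3i]))
    refine htrans _ _ _ (hstep q i c hq nd₁) (htrans _ _ _ (hstep s₁ j (s j) nd₁ nd₂)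
      (htrans _ _ _ (hstep s₂ i (s i) nd₂ nd₃) (hcloser s₃ (fun k hk => ?_) ⟨i, hiq, h3i.symm⟩ nd₃)))
    by_cases hki : k = i
    · rw [hki, h3i]
    · by_cases hkj : k = j
      · rw [hkj, h3j]
      · rw [hk, (hoff k hki hkj).1]

end Gluing

/-! ### Comparison of `Φ` for different quads and flattenings -/

namespace Gluing

variable {ι : Type*} [Fintype ι] [DecidableEq ι] {K : Type*} [Field K] [CharZero K]

omit [CharZero K] in
theorem shape_ne {z : K} (h0 : z ≠ 0) (h1 : z ≠ 1) (a : Fin 3) : shape z a ≠ 0 ∧ shape z a ≠ 1 := by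
  have h : 1 - z ≠ 0 := sub_ne_zero.2 h1.symm
  fin_cases a
  · exact ⟨h0, h1⟩
  · refine ⟨one_div_ne_zero h, fun h2 => h0 ?_⟩
    have : 1 / (1 - z) = 1 := h2
    rw [div_eq_one_iff_eq h] at this
    linear_combination this
  · refine ⟨fun h2 => h1 ?_, fun h2 => ?_⟩
    · have : 1 - 1 / z = 0 := h2
      field_simp at this
      linear_combination this
    · have : 1 - 1 / z = 1 := h2
      have h3 : 1 / z = 0 := by linear_combination -this
      exact one_div_ne_zero h0 h3

omit [CharZero K] in
theorem shape_succ {z : K} (h0 : z ≠ 0) (h1 : z ≠ 1) (a : Fin 3) :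
    shape z (a + 1) = 1 / (1 - shape z a) := by
  have h : 1 - z ≠ 0 := sub_ne_zero.2 h1.symm
  fin_cases a
  · rfl
  · change 1 - 1 / z = 1 / (1 - 1 / (1 - z))
    have h2 : 1 - 1 / (1 - z) = -z / (1 - z) := by field_simp; ring
    rw [h2]; field_simp; ring
  · change z = 1 / (1 - (1 - 1 / z))
    simp

omit [CharZero K] in
theorem shape_ratio {z z' : K} (h0 : z ≠ 0) (h1 : z ≠ 1) (hz : z' = 1 / (1 - z)) :
    z' / (1 - z') = -(z / (1 - z))⁻¹ - 1 := by
  have h : 1 - z ≠ 0 := sub_ne_zero.2 h1.symm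
  have h2 : 1 - z' = -z / (1 - z) := by rw [hz]; field_simp; ring
  rw [h2, hz]; field_simp; ring

variable (D : Gluing ι) (q : ι → Fin 3) (z : ι → K) (F : Fin 3 → ι → ℤ)

/-- The parameters `z / (1 - z)` of the shapes of a choice of quad. -/
def ratio : ι → K := fun i => shape (z i) (q i) / (1 - shape (z i) (q i))

omit [Fintype ι] [CharZero K] in
theorem ratio_update (hz : ∀ j, z j ≠ 0 ∧ z j ≠ 1) (j : ι) :
    ratio (Function.update q j (q j + 1)) z = Function.update (ratio q z) j (-(ratio q z j)⁻¹ - 1) := by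
  ext i
  by_cases hi : i = j
  · subst hi
    have h := shape_ne (hz i).1 (hz i).2 (q i)
    rw [Function.update_self, ratio, Function.update_self, ratio]
    exact shape_ratio h.1 h.2 (shape_succ (hz i).1 (hz i).2 (q i))
  · rw [Function.update_of_ne hi, ratio, ratio, Function.update_of_ne hi]

omit [CharZero K] in
theorem Lam_datum (hz : ∀ j, z j ≠ 0 ∧ z j ≠ 1) :
    (D.datum q z F).Lam = -D.quot K q + Matrix.diagonal fun i => 1 + ratio q z i := by
  rw [Datum.Lam]
  congr 2
  ext i
  have h : 1 - shape (z i) (q i) ≠ 0 :=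
    sub_ne_zero.2 (shape_ne (hz i).1 (hz i).2 (q i)).2.symm
  simp only [datum, ratio]
  field_simp
  ring

theorem Lam_isSymm (hD : D.IsSymplectic) {q : ι → Fin 3} (hq : (D.B q).det ≠ 0)
    (hz : ∀ j, z j ≠ 0 ∧ z j ≠ 1) : (D.datum q z F).Lam.IsSymm := by
  rw [Lam_datum D q z F hz]
  exact (D.quot_isSymm hD hq).neg.add (Matrix.isSymm_diagonal _)

variable {F q}

/-- This is where the flattening enters: it makes the linear form in the integrand compatible with
the pivot. -/
theorem inv_B_mulVec_nu (hq : (D.B q).det ≠ 0) (hF : D.IsFlattening F) :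
    (D.datum q z F).BK⁻¹ *ᵥ (D.datum q z F).nuK =
      D.quot K q *ᵥ (fun i => (F (q i) i : K)) + fun i => (F (q i + 2) i : K) := by
  have h : (D.datum q z F).nuK =
      (D.A q).map (Int.cast : ℤ → K) *ᵥ (fun i => (F (q i) i : K)) +
        (D.B q).map (Int.cast : ℤ → K) *ᵥ fun i => (F (q i + 2) i : K) := by
    ext i
    have := congrArg (Int.cast : ℤ → K) (congrFun (D.A_mulVec_add hF q) i)
    simpa [Datum.nuK, datum, Matrix.mulVec, dotProduct] using this.symm
  have hB : (D.datum q z F).BK = (D.B q).map (Int.cast : ℤ → K) := rfl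
  rw [h, ← D.B_mul_quot hq, hB, ← Matrix.mulVec_mulVec, ← Matrix.mulVec_add, Matrix.mulVec_mulVec,
    Matrix.nonsing_inv_mul _ (isUnit_det_map hq), Matrix.one_mulVec]

theorem lin_datum (hq : (D.B q).det ≠ 0) (hF : D.IsFlattening F) (i : ι) :
    (D.datum q z F).lin i = half K *
      (1 - ((D.quot K q *ᵥ fun i => (F (q i) i : K)) i + (F (q i + 2) i : K))) := by
  rw [Datum.lin, inv_B_mulVec_nu D z hq hF, Pi.add_apply]

omit [CharZero K] in
theorem quad_datum : (D.datum q z F).quad =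
    (fun i => (F (q i) i : K)) ⬝ᵥ (D.quot K q *ᵥ fun i => (F (q i) i : K)) := rfl

theorem quot_update (hq : (D.B q).det ≠ 0) {j : ι}
    (hq' : (D.B (Function.update q j (q j + 1))).det ≠ 0) :
    D.quot K q j j - 1 ≠ 0 ∧
      D.quot K (Function.update q j (q j + 1)) = quadPivot (D.quot K q) j := by
  have hp : D.quot K q j j - 1 ≠ 0 := by
    rw [D.det_B_ne_zero_iff (K := K) hq, det_transition_update] at hq'
    have e1 : q j + 1 ≠ q j := by generalize q j = a; revert a; decide
    simpa [transition] using hq'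
  refine ⟨hp, ?_⟩
  have h := updateCol_mul_quadPivot (D.B_mul_quot (K := K) hq) hp
  have e2 : q j + 1 + 2 = q j := by generalize q j = a; revert a; decide
  have e3 : q j + 1 + 1 = q j + 2 := by generalize q j = a; revert a; decide
  have hB : (D.B (Function.update q j (q j + 1))).map (Int.cast : ℤ → K) =
      ((D.B q).map (Int.cast : ℤ → K)).updateCol j fun i =>
        (D.A q).map (Int.cast : ℤ → K) i j - (D.B q).map (Int.cast : ℤ → K) i j := by
    ext i k
    by_cases hk : k = j
    · subst hk; simp [A, B, e2, e3]
    · rw [Matrix.updateCol_ne hk]; simp [B, hk]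
  have hA : (D.A (Function.update q j (q j + 1))).map (Int.cast : ℤ → K) =
      ((D.A q).map (Int.cast : ℤ → K)).updateCol j fun i =>
        -(D.B q).map (Int.cast : ℤ → K) i j := by
    ext i k
    by_cases hk : k = j
    · subst hk; simp [A, B, e3]
    · rw [Matrix.updateCol_ne hk]; simp [A, hk]
  rw [← hB, ← hA] at h
  rw [quot, ← h, Matrix.nonsing_inv_mul_cancel_left _ _ (isUnit_det_map hq')]

/-- `Φ` for two choices of quad and a common flattening agree up to `exp(m ħ / 24)`. -/
def Equiv (D : Gluing ι) (K : Type*) [Field K] [CharZero K] (F : Fin 3 → ι → ℤ)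
    (q s : ι → Fin 3) : Prop :=
  ∃ m : ℤ, ∀ z : ι → K, (∀ j, z j ≠ 0 ∧ z j ≠ 1) →
    ((D.datum q z F).Lam.det ≠ 0 ↔ (D.datum s z F).Lam.det ≠ 0) ∧
    ((D.datum q z F).Lam.det ≠ 0 → (D.datum q z F).Phi =
      fexp (C ((m : K) / 24) * X ^ 2) * (D.datum s z F).Phi)

theorem Equiv.refl (q : ι → Fin 3) : D.Equiv K F q q :=
  ⟨0, fun z _ => ⟨Iff.rfl, fun _ => by simp⟩⟩

variable {D}

theorem Equiv.symm {q s : ι → Fin 3} (h : D.Equiv K F q s) : D.Equiv K F s q := by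
  obtain ⟨m, hm⟩ := h
  refine ⟨-m, fun z hz => ⟨(hm z hz).1.symm, fun hs => ?_⟩⟩
  rw [(hm z hz).2 ((hm z hz).1.2 hs), ← mul_assoc, ← fexp_add (by simp) (by simp), ← add_mul,
    ← map_add]
  simp [neg_div]

theorem Equiv.trans {q s t : ι → Fin 3} (h : D.Equiv K F q s) (h' : D.Equiv K F s t) :
    D.Equiv K F q t := by
  obtain ⟨m, hm⟩ := h
  obtain ⟨n, hn⟩ := h'
  refine ⟨m + n, fun z hz => ⟨(hm z hz).1.trans (hn z hz).1, fun hq => ?_⟩⟩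
  rw [(hm z hz).2 hq, (hn z hz).2 ((hm z hz).1.1 hq), ← mul_assoc,
    ← fexp_add (by simp) (by simp), ← add_mul, ← map_add, Int.cast_add, add_div]

/-- Rotating the quad of one tetrahedron. -/
theorem equiv_succ (hD : D.IsSymplectic) (hF : D.IsFlattening F) (hq : (D.B q).det ≠ 0) {j : ι}
    (hq' : (D.B (Function.update q j (q j + 1))).det ≠ 0) :
    D.Equiv K F q (Function.update q j (q j + 1)) := by
  obtain ⟨hp, hN⟩ := D.quot_update (K := K) hq hq'
  -- The `-1` is the `-1/24` of the Fourier identity, and `3 / 24 = 1/8` multiplies `f_j^2 + 2 f_j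
  -- f_j'`, left over from the change of `fᵗ B⁻¹ A f`.
  refine ⟨-1 + 3 * (F (q j) j ^ 2 + 2 * (F (q j) j * F (q j + 1) j)), fun z hz => ?_⟩
  set q' := Function.update q j (q j + 1) with hq'def
  have hu : ratio q z j ≠ 0 := by
    have h := shape_ne (hz j).1 (hz j).2 (q j)
    exact div_ne_zero h.1 (sub_ne_zero.2 h.2.symm)
  have hπ : ratio q z j - (D.datum q z F).Lam j j = D.quot K q j j - 1 := by
    rw [Lam_datum D q z F hz]
    simp only [Matrix.add_apply, Matrix.neg_apply, Matrix.diagonal_apply_eq]; ring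
  have hp' := hπ ▸ hp
  have hL : (D.datum q' z F).Lam = pivotForm (D.datum q z F).Lam j (ratio q z j) := by
    rw [Lam_datum D q z F hz, Lam_datum D q' z F hz, pivotForm_eq, hN, hq'def,
      ratio_update q z hz j]
  have hdet : (D.datum q z F).Lam.det ≠ 0 ↔ (D.datum q' z F).Lam.det ≠ 0 := by
    rw [hL, pivotForm_det_ne_zero hu hp']
  refine ⟨hdet, fun hd => ?_⟩
  have hsymm := D.Lam_isSymm z F hD hq hz
  have e2 : q j + 1 + 2 = q j := by generalize q j = a; revert a; decide
  have hsum : (F (q j) j : K) + F (q j + 1) j + F (q j + 2) j = 1 := by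
    have := hF.1 j
    generalize q j = a
    have h3 : F a j + F (a + 1) j + F (a + 2) j = 1 := by
      rw [← this]; fin_cases a <;> simp <;> ring
    exact_mod_cast h3
  set f : ι → K := fun i => (F (q i) i : K) with hf
  have hf' : (fun i => (F (q' i) i : K)) = Function.update f j (F (q j + 1) j : K) := by
    ext i
    by_cases hi : i = j
    · subst hi; simp [hq'def]
    · simp [hq'def, hi, hf]
  set a := (F (q j + 1) j : K) + f j - (D.quot K q *ᵥ f) j with ha
  -- Since `f_j + f_j' + f_j'' = 1`, the linear coefficient is half of the quantity whose square
  -- occurs in `quadPivot_quad`; the two squares cancel in the end.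
  have hlinj : (D.datum q z F).lin j = half K * a := by
    rw [lin_datum D z hq hF]
    congr 1
    linear_combination -hsum
  have hlin : pivotVec (D.datum q z F).Lam j (ratio q z j) ((D.datum q z F).lin j) +
      Function.update (D.datum q z F).lin j (half K) = (D.datum q' z F).lin := by
    ext i
    rw [lin_datum D z hq' hF, hf', hN, quadPivot_mulVec hp, Pi.add_apply, pivotVec, hπ, hlinj]
    by_cases hi : i = j
    · subst hi
      rw [if_pos rfl, if_pos rfl, Function.update_self, hq'def, Function.update_self, e2, ← ha]
      ring
    · have hLi : (D.datum q z F).Lam i j = -D.quot K q i j := by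
        rw [Lam_datum D q z F hz, Matrix.add_apply, Matrix.diagonal_apply_ne _ hi,
          Matrix.neg_apply, add_zero]
      rw [if_neg hi, if_neg hi, Function.update_of_ne hi, hq'def, Function.update_of_ne hi,
        lin_datum D z hq hF, hLi, ← ha]
      ring
  have hratio : (fun i => (D.datum q' z F).z i / (1 - (D.datum q' z F).z i)) =
      Function.update (ratio q z) j (-(ratio q z j)⁻¹ - 1) := ratio_update q z hz j
  have hhalf : half K = 1 / 2 := by simp [half]
  rw [Datum.Phi_eq _ hsymm hd, Datum.Phi_eq _ (D.Lam_isSymm z F hD hq' hz) (hdet.1 hd), hratio,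
    hL, ← hlin]
  have hG := gaussDilog_pivot hsymm hd (D.datum q z F).lin hu hp'
  change _ * gaussDilog _ _ (ratio q z) = _
  rw [hG, ← mul_assoc, ← mul_assoc, ← fexp_add (by simp) (by simp),
    ← fexp_add (by simp) (by simp), ← add_mul, ← add_mul, ← map_add, ← map_add]
  congr 4
  rw [quad_datum, quad_datum, hf', hN, quadPivot_quad (D.quot_isSymm hD hq) hp, hlinj, hπ, hhalf,
    ← hf, ← ha]
  push_cast
  rw [hf]
  field_simp
  ring

theorem equiv_update (hD : D.IsSymplectic) (hF : D.IsFlattening F) (hq : (D.B q).det ≠ 0) {j : ι}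
    {c : Fin 3} (hq' : (D.B (Function.update q j c)).det ≠ 0) :
    D.Equiv K F q (Function.update q j c) := by
  obtain rfl | rfl | h := fin_three_cases (q j) c
  · rw [Function.update_eq_self]; exact Equiv.refl D q
  · exact equiv_succ hD hF hq hq'
  -- Rotating twice is undone by one rotation, so the forward move is applied starting from the
  -- target; the doubly rotated quad need not pass through a nondegenerate one.
  · set s := Function.update q j c with hs
    have h1 : Function.update s j (s j + 1) = q := by
      have : q j + 2 + 1 = q j := by generalize q j = a; revert a; decide
      rw [hs, Function.update_self, Function.update_idem, h, this, Function.update_eq_self]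
    have := equiv_succ (K := K) hD hF hq' (j := j) (by rwa [h1])
    rw [h1] at this
    exact this.symm

theorem equiv_of_det_ne_zero (hD : D.IsSymplectic) (hF : D.IsFlattening F) {q s : ι → Fin 3}
    (hq : (D.B q).det ≠ 0) (hs : (D.B s).det ≠ 0) : D.Equiv K F q s :=
  D.connected hD (R := D.Equiv K F) (Equiv.refl D) (fun _ _ _ => Equiv.trans)
    (fun _ _ _ h h' => equiv_update hD hF h h') hq hs

/-- The dependence of `Φ` on the flattening. -/
theorem Phi_flattening (hD : D.IsSymplectic) {F₁ F₂ : Fin 3 → ι → ℤ} (hF₁ : D.IsFlattening F₁)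
    (hF₂ : D.IsFlattening F₂) (hq : (D.B q).det ≠ 0) :
    ∃ m : ℤ, ∀ z : ι → K, (∀ j, z j ≠ 0 ∧ z j ≠ 1) → (D.datum q z F₁).Lam.det ≠ 0 →
      (D.datum q z F₁).Phi = fexp (C ((m : K) / 24) * X ^ 2) * (D.datum q z F₂).Phi := by
  -- Both flattenings give the same `B⁻¹ ν = M f + f''`, so `M (f₁ - f₂) = -(f₁'' - f₂'')`. By
  -- symmetry of `M`, the quadratic values differ by `(f₁ + f₂)ᵗ M (f₁ - f₂)`, an integer,
  -- multiplied by `1/8 = 3/24`.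
  refine ⟨-3 * ∑ i, (F₁ (q i) i + F₂ (q i) i) * (F₁ (q i + 2) i - F₂ (q i + 2) i),
    fun z hz hd => ?_⟩
  rw [Datum.Phi_eq _ (D.Lam_isSymm z F₁ hD hq hz) hd,
    Datum.Phi_eq (D.datum q z F₂) (D.Lam_isSymm z F₂ hD hq hz) hd]
  -- Neither `Λ` nor the linear form involves the flattening, so the two Gaussian integrals coincide
  -- definitionally.
  change _ * gaussDilog (D.datum q z F₁).Lam (D.datum q z F₁).lin _ =
    _ * (_ * gaussDilog (D.datum q z F₁).Lam (D.datum q z F₁).lin _)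
  rw [← mul_assoc, ← fexp_add (by simp) (by simp), ← add_mul, ← map_add]
  congr 4
  rw [quad_datum, quad_datum]
  set M := D.quot K q
  set f₁ : ι → K := fun i => (F₁ (q i) i : K) with hf₁
  set f₂ : ι → K := fun i => (F₂ (q i) i : K) with hf₂
  have hs : ∀ v w : ι → K, v ⬝ᵥ (M *ᵥ w) = w ⬝ᵥ (M *ᵥ v) := fun v w => by
    rw [Matrix.dotProduct_mulVec, ← Matrix.mulVec_transpose, (D.quot_isSymm hD hq).eq,
      dotProduct_comm]
  have h1 : M *ᵥ f₁ - M *ᵥ f₂ =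
      -((fun i => (F₁ (q i + 2) i : K)) - fun i => (F₂ (q i + 2) i : K)) := by
    have h : M *ᵥ f₁ + _ = M *ᵥ f₂ + _ :=
      (inv_B_mulVec_nu D z hq hF₁).symm.trans (inv_B_mulVec_nu (F := F₂) D z hq hF₂)
    rw [sub_eq_iff_eq_add, neg_sub, sub_add_eq_add_sub, eq_sub_iff_add_eq, h, add_comm]
  have h2 : f₁ ⬝ᵥ (M *ᵥ f₁) - f₂ ⬝ᵥ (M *ᵥ f₂) = (f₁ + f₂) ⬝ᵥ (M *ᵥ f₁ - M *ᵥ f₂) := by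
    rw [dotProduct_sub, add_dotProduct, add_dotProduct, hs f₂ f₁]
    ring
  have h3 : (f₁ + f₂) ⬝ᵥ (M *ᵥ f₁ - M *ᵥ f₂) =
      -((∑ i, (F₁ (q i) i + F₂ (q i) i) * (F₁ (q i + 2) i - F₂ (q i + 2) i) : ℤ) : K) := by
    rw [h1, dotProduct_neg, dotProduct]
    simp [hf₁, hf₂]
  rw [h3] at h2
  rw [Int.cast_mul]
  push_cast at h2 ⊢
  linear_combination (1 / 8 : K) * h2

end Gluing

end NZ

end

theorem theorem5p1 {ι : Type*} [Fintype ι] [DecidableEq ι] {K : Type*} [Field K] [CharZero K]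
    (D : NZ.Gluing ι) (hD : D.IsSymplectic)
    (F₁ F₂ : Fin 3 → ι → ℤ) (hF₁ : D.IsFlattening F₁) (hF₂ : D.IsFlattening F₂)
    (q₁ q₂ : ι → Fin 3) (hq₁ : (D.B q₁).det ≠ 0) (hq₂ : (D.B q₂).det ≠ 0) :
    ∃ m : ℤ, ∀ z : ι → K, (∀ j, z j ≠ 0 ∧ z j ≠ 1) →
      (D.datum q₁ z F₁).Lam.det ≠ 0 →
        (D.datum q₂ z F₂).Lam.det ≠ 0 ∧
        (D.datum q₁ z F₁).Phi =
          NZ.fexp (PowerSeries.C ((m : K) / 24) * PowerSeries.X ^ 2) *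
            (D.datum q₂ z F₂).Phi := by
  obtain ⟨m, hm⟩ := NZ.Gluing.equiv_of_det_ne_zero (K := K) hD hF₁ hq₁ hq₂
  obtain ⟨n, hn⟩ := NZ.Gluing.Phi_flattening (K := K) hD hF₁ hF₂ hq₂
  refine ⟨m + n, fun z hz hd => ?_⟩
  have hd₂ := (hm z hz).1.1 hd
  refine ⟨hd₂, ?_⟩
  rw [(hm z hz).2 hd, hn z hz hd₂, ← mul_assoc, ← NZ.fexp_add (by simp) (by simp), ← add_mul,
    ← map_add, Int.cast_add, add_div]
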